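/- **Setting.** For a graph $G_n$ on $n$ vertices with symmetric $0/1$ adjacency matrix $A_n$, $\beta>0$ and $h\in\mathbb R$, let $X=(X_1,\dots,X_n)\in\{-1,1\}^n$ have the Ising law $p(x)=\exp(\beta x^{T}A_nx+h\mathbf 1^{T}x)/Z_n(\beta,h)$, where $Z_n(\beta,h)=\sum_{x}\exp(\beta x^{T}A_nx+h\mathbf 1^{T}x)$ (so the coupling along each edge is $2\beta$). Given $X$, let $Y_1,\dots,Y_n\in\{-1,1\}$ be conditionally independent, with $Y_i=-X_i$ with probability $p$ and $Y_i=X_i$ otherwise, where $0\le p<1/2$. Write $\overline{X_n}=\frac1n\sum_i X_i$, $\overline{Y_n}=\frac1n\sum_i Y_i$. For a threshold $S\in(-1,1)$ put $m=\operatorname{sign}(\overline{X_n}-S)$, $\hat m=\operatorname{sign}(\overline{Y_n}-(1-2p)S)$ (with $\operatorname{sign}(0)=0$) and $P_e^{(n)}=\mathbb P(m\ne\hat m)$. For $0<p<1/2$ let $D_p=(1-2p)/\sqrt{4p(1-p)}$; $\operatorname{arccot}x=\frac\pi2-\arctan x$. The Star graph on $n$ vertices has a centre vertex $X_c$ joined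 to all the others and no further edges; the Wheel graph has in addition the edges of a ring through the other $n-1$ vertices. Let $\psi(\beta,h)=\lim_{n\to\infty}\frac1n\log Z_n(\beta,h)$; for $h\neq0$ let $\mu_{\beta,h}=\lim_n\mathbb E[\overline{X_n}]$ and $\sigma^2_{\beta,h}=\lim_n n\mathbb V[\overline{X_n}]$; let $\mu^+_{\beta,0}$ be the right derivative of $\psi(\beta,\cdot)$ at $0$, and for $h=0$ let $\sigma^2_{\beta,0}=\lim_n n\mathbb V[\overline{X_n}\mid X_c=1]$; $\sigma=\sqrt{\sigma^2}$. **Proposition (Star and Wheel graphs).** For the Star graphs, and likewise for the Wheel graphs, and every $\beta>0$: 1. All these limits and derivatives exist, and for $h\ne0$, $\mu_{\beta,h}=\partial_h\psi(\beta,h)$ and $\sigma^2_{\beta,h}=\partial_h^2\psi(\beta,h)$. With $J=2\beta$ and $H=J+|h|$: for the Star, $\psi=\log(2\cosh H)$, $\mu_{\beta,h}=\tanh(H)\operatorname{sign}(h)$ and $\sigma^2_{\beta,h}=1/\cosh^2H$ ($h\neq 0$), $\mu^+_{\beta,0}=\tanh J$, $\sigma^2_{\beta,0}=1/\cosh^2J$;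 for the Wheel, with $R(t)=\sinh^2t+e^{-4J}$, $\psi=J+\log(\cosh H+\sqrt{R(H)})$, $\mu_{\beta,h}=\sinh(H)\operatorname{sign}(h)/\sqrt{R(H)}$ and $\sigma^2_{\beta,h}=e^{-4J}\cosh(H)/R(H)^{3/2}$ ($h\ne0$), $\mu^+_{\beta,0}=\sinh(J)/\sqrt{R(J)}$, $\sigma^2_{\beta,0}=e^{-4J}\cosh(J)/R(J)^{3/2}$. 2. When $h\neq0$: (a) if $S\ne\mu_{\beta,h}$, then $\lim_{n\to\infty}P_e^{(n)}=0$ and moreover $\limsup_{n\to\infty}\frac1n\log P_e^{(n)}<0$ (with $\log0=-\infty$); (b) if $S=\mu_{\beta,h}$ and $p>0$, then $\lim_{n\to\infty}P_e^{(n)}=\frac1\pi\operatorname{arccot}(D_p\sigma_{\beta,h})>0$. 3. When $h=0$, the law of $\overline{X_n}$ is bimodal at $\pm\mu^+_{\beta,0}\neq0$: $\mu^+_{\beta,0}>0$, and for every $b>0$ there is $\alpha_b>0$ such that for all $n$, $\mathbb P(|\overline{X_n}-\mu^+_{\beta,0}|\le b)=\mathbb P(|\overline{X_n}+\mu^+_{\beta,0}|\le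 b)\ge\frac12-e^{-n\alpha_b}$. Further: (a) if $S\neq\pm\mu^+_{\beta,0}$, then $\lim_{n\to\infty}P_e^{(n)}=0$ and moreover $\limsup_{n\to\infty}\frac1n\log P_e^{(n)}<0$; (b) if $S=\mu^+_{\beta,0}$ or $S=-\mu^+_{\beta,0}$, and $p>0$, then $\lim_{n\to\infty}P_e^{(n)}=\frac1{2\pi}\operatorname{arccot}(D_p\sigma_{\beta,0})>0$. -/

import Mathlib

open Filter Topology

namespace Sentiment

noncomputable section

/-- A sentiment vector in `{-1, 1}^n`. -/
abbrev Spins (n : ℕ) : Type := Fin n → ℤˣ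

/-- The real vector with entries `±1` of a sentiment vector. -/
def toVec {n : ℕ} (x : Spins n) : Fin n → ℝ := fun i => ((x i : ℤ) : ℝ)

/-- The sample average `(x₁ + ⋯ + xₙ) / n`. -/
def avg {n : ℕ} (x : Spins n) : ℝ := (∑ i, toVec x i) / n

open Classical in
/-- The unnormalised Ising weight `exp (β xᵀ A x + h 1ᵀ x)`, where `A` is the symmetric 0/1
adjacency matrix of `G`. -/
def weight {n : ℕ} (G : SimpleGraph (Fin n)) (β h : ℝ) (x : Spins n) : ℝ :=
  Real.exp (β * (toVec x ⬝ᵥ Matrix.mulVec (G.adjMatrix ℝ) (toVec x)) + h * ∑ i, toVec x i)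

/-- The partition function `Z_n(β, h)`. -/
def partitionFn {n : ℕ} (G : SimpleGraph (Fin n)) (β h : ℝ) : ℝ := ∑ x, weight G β h x

/-- The Ising prior `p(x)`. -/
def prior {n : ℕ} (G : SimpleGraph (Fin n)) (β h : ℝ) (x : Spins n) : ℝ :=
  weight G β h x / partitionFn G β h

/-- Expectation of `f(X)` under the Ising prior. -/
def expect {n : ℕ} (G : SimpleGraph (Fin n)) (β h : ℝ) (f : Spins n → ℝ) : ℝ :=
  ∑ x, prior G β h x * f x

/-- Probability of the event `X ∈ E` under the Ising prior. -/
def prob {n : ℕ} (G : SimpleGraph (Fin n)) (β h : ℝ) (E : Set (Spins n)) : ℝ :=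
  expect G β h (E.indicator 1)

/-- Conditional expectation of `f(X)` given the event `X ∈ E`. -/
def condExpect {n : ℕ} (G : SimpleGraph (Fin n)) (β h : ℝ) (E : Set (Spins n))
    (f : Spins n → ℝ) : ℝ :=
  expect G β h (E.indicator f) / prob G β h E

/-- The mean of the sample average of `X`. -/
def meanAvg {n : ℕ} (G : SimpleGraph (Fin n)) (β h : ℝ) : ℝ := expect G β h avg

/-- The variance of the sample average of `X`. -/
def varAvg {n : ℕ} (G : SimpleGraph (Fin n)) (β h : ℝ) : ℝ :=
  expect G β h fun x => (avg x - meanAvg G β h) ^ 2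

/-- The conditional variance of the sample average of `X` given the event `X ∈ E`. -/
def condVarAvg {n : ℕ} (G : SimpleGraph (Fin n)) (β h : ℝ) (E : Set (Spins n)) : ℝ :=
  condExpect G β h E fun x => (avg x - condExpect G β h E avg) ^ 2

/-- Transition probability from `x` to `y` of `n` independent uses of the binary symmetric channel
with cross-over probability `p`. -/
def channel {n : ℕ} (p : ℝ) (x y : Spins n) : ℝ := ∏ i, if y i = x i then 1 - p else p

/-- The detection error probability `P(m ≠ m̂)` under the joint law of `(X, Y)`, where
`m = sign (avg X - S)` and `m̂ = sign (avg Y - (1 - 2p) S)`. The sign takes the value `0` at `0`. -/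
def errorProb {n : ℕ} (G : SimpleGraph (Fin n)) (β h p S : ℝ) : ℝ :=
  ∑ x : Spins n, ∑ y : Spins n, prior G β h x * channel p x y *
    (if SignType.sign (avg x - S) ≠ SignType.sign (avg y - (1 - 2 * p) * S) then 1 else 0)

/-- The exponential rate `limsup (1/n) log P_e^(n)`, with `log 0 = -∞`. -/
def errorRate (G : ∀ n : ℕ, SimpleGraph (Fin n)) (β h p S : ℝ) : EReal :=
  limsup (fun n : ℕ => ENNReal.log (ENNReal.ofReal (errorProb (G n) β h p S)) / (n : EReal)) atTop

/-- The star graph on `n` vertices, with centre `0`. -/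
def star : ∀ n : ℕ, SimpleGraph (Fin n)
  | 0 => ⊥
  | _ + 1 => SimpleGraph.starGraph 0

/-- The wheel graph on `n` vertices: the star graph with centre `0` together with a ring on the
remaining `n - 1` vertices. -/
def wheel : ∀ n : ℕ, SimpleGraph (Fin n)
  | 0 => ⊥
  | m + 1 => SimpleGraph.starGraph 0 ⊔ (SimpleGraph.cycleGraph m).map (Fin.succEmb m)

/-- The event that the centre (vertex `0`) has positive sentiment. -/
def centrePos (n : ℕ) : Set (Spins n) := {x | ∀ i : Fin n, (i : ℕ) = 0 → x i = 1}

/-- The free entropy density `ψ_n(β, h) = (1/n) log Z_n(β, h)`. -/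
def freeEntropyN {n : ℕ} (G : SimpleGraph (Fin n)) (β h : ℝ) : ℝ :=
  1 / n * Real.log (partitionFn G β h)

/-- The limiting free entropy density `ψ(β, h)`. -/
def freeEntropy (G : ∀ n : ℕ, SimpleGraph (Fin n)) (β h : ℝ) : ℝ :=
  limUnder atTop fun n : ℕ => freeEntropyN (G n) β h

/-- The asymptotic mean `μ_{β,h} = lim E[avg X]`. -/
def asympMean (G : ∀ n : ℕ, SimpleGraph (Fin n)) (β h : ℝ) : ℝ :=
  limUnder atTop fun n : ℕ => meanAvg (G n) β h

/-- The asymptotic variance `σ²_{β,h} = lim n V[avg X]`. -/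
def asympVar (G : ∀ n : ℕ, SimpleGraph (Fin n)) (β h : ℝ) : ℝ :=
  limUnder atTop fun n : ℕ => n * varAvg (G n) β h

/-- The asymptotic positive mode `μ⁺_{β,0}`: the right derivative of `ψ(β, ·)` at `0`. -/
def posMode (G : ∀ n : ℕ, SimpleGraph (Fin n)) (β : ℝ) : ℝ :=
  derivWithin (freeEntropy G β) (Set.Ici 0) 0

/-- For `h = 0`: the asymptotic variance `σ²_{β,0} = lim n V[avg X | centre positive]`. -/
def modeVar (G : ∀ n : ℕ, SimpleGraph (Fin n)) (β : ℝ) : ℝ :=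
  limUnder atTop fun n : ℕ => n * condVarAvg (G n) β 0 (centrePos n)

/-- The constant `D_p = (1 - 2p) / √(4p(1 - p))`. -/
def Dconst (p : ℝ) : ℝ := (1 - 2 * p) / √(4 * p * (1 - p))

/-- The inverse cotangent with values in `(0, π)`. -/
def arccot (x : ℝ) : ℝ := Real.pi / 2 - Real.arctan x

end

end Sentiment

namespace Sentiment

noncomputable section

/-! ### The Ising model on a ring -/

/-! Star and wheel differ from an exactly solvable chain only by their centre. Once the centre spin
`e` is fixed, the other `m = n - 1` vertices form an Ising ring with coupling `K` (`0` for the star,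
`2β` for the wheel) in the uniform field `2β e + h`; `IsRingCone` records this, and everything after
it treats both graphs at once.

The transfer matrix gives the partition function of the ring exactly (`ringPFC_eq`): it is `λ₊ ^ m +
λ₋ ^ m` with `λ± = e ^ K (cosh z ± √(sinh² z + c))` and `c = e ^ (-4K)`, for complex fields `z` as
well. Real fields give the free entropy, mean and variance through logarithmic derivatives (`slope`
and `curv` of the leading eigenvalue) and exponential moments through shifts of the field. Fields `H
+ iτ` give characteristic functions, hence a central limit theorem.

The leading eigenvalue is even in the field and strictly increasing in its modulus. So for `h ≠ 0`
the centre agrees with the sign of `h` up to exponentially small probability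
(`expSmall_centreProb`), and all limits are those of the ring with field `sign h · (2β + |h|)`. For
`h = 0` the centre is a fair coin, and the law is an equal mixture of two mirror-image rings with
means near `± slope c (2β)`.

If `S` is not the mean of a ring, a Chernoff bound for `X` together with one for the channel makes
the conditional error exponentially small (`expSmall_errGiven`). If `S` is the mean, both statistics
fluctuate on the scale `1/√n`. The normalised magnetisation `U` and the normalised channel noise `W`
become independent standard Gaussians: the noise variance `4p(1-p)` at a site is the same for both
inputs, so the characteristic function of the noise given `X = x` converges uniformly in `x`. An
error is the event that `U` and `D_p σ U + W` have different signs, a double cone with two arcs of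
angle `arccot (D_p σ)`, of Gaussian measure `arccot (D_p σ) / π` (`gaussian_signCone`,
`tendsto_ringExp_errGiven`). For `h = 0` only one of the two mixture components is critical, which
halves the limit. -/

/-- The sum of all spins. -/
def spinSum {n : ℕ} (x : Spins n) : ℝ := ∑ i, toVec x i

/-- The weight of the ring interaction with coupling `K` on `m` sites. -/
def ringWeight (K : ℝ) {m : ℕ} (y : Spins m) : ℝ :=
  Real.exp (K * ∑ i, toVec y i * toVec y (finRotate m i))

/-- The partition function of the Ising ring with real field `H`. -/
def ringPF (K : ℝ) (m : ℕ) (H : ℝ) : ℝ :=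
  ∑ y : Spins m, ringWeight K y * Real.exp (H * spinSum y)

/-- The partition function of the Ising ring with complex field `z`. -/
def ringPFC (K : ℝ) (m : ℕ) (z : ℂ) : ℂ :=
  ∑ y : Spins m, (ringWeight K y : ℂ) * Complex.exp (z * spinSum y)

/-- Expectation under the Ising ring with field `H`. -/
def ringExp (K H : ℝ) (m : ℕ) (f : Spins m → ℝ) : ℝ :=
  (∑ y : Spins m, ringWeight K y * Real.exp (H * spinSum y) * f y) / ringPF K m H

lemma ofReal_ringPF (K : ℝ) (m : ℕ) (H : ℝ) : ((ringPF K m H : ℝ) : ℂ) = ringPFC K m H := by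
  simp [ringPF, ringPFC]

lemma ringPF_pos (K : ℝ) (m : ℕ) (H : ℝ) : 0 < ringPF K m H :=
  Finset.sum_pos (fun _ _ => mul_pos (Real.exp_pos _) (Real.exp_pos _)) Finset.univ_nonempty

/-! ### Transfer matrices -/

/-- The boundary weight `g` is arbitrary so that the induction can absorb the first edge of the path
into it; the choice `g a b = M b a` later closes the path into a cycle. -/
lemma sum_paths {ι R : Type*} [Fintype ι] [DecidableEq ι] [CommRing R] (M : Matrix ι ι R) (k : ℕ)
    (g : ι → ι → R) :
    ∑ y : Fin (k + 1) → ι, g (y 0) (y (Fin.last k)) * ∏ i : Fin k, M (y i.castSucc) (y i.succ) =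
      ∑ a, ∑ b, g a b * (M ^ k) a b := by
  induction k generalizing g with
  | zero =>
    rw [← (Equiv.funUnique (Fin 1) ι).symm.sum_comp]
    simp [Matrix.one_apply]
  | succ k ih =>
    have h := ih (fun a' b => ∑ a, g a b * M a a')
    rw [← (Fin.consEquiv (fun _ : Fin (k + 2) => ι)).sum_comp, Fintype.sum_prod_type,
      Finset.sum_comm]
    calc _ = ∑ y : Fin (k + 1) → ι, (∑ a, g a (y (Fin.last k)) * M a (y 0)) *
          ∏ i : Fin k, M (y i.castSucc) (y i.succ) := by
          refine Finset.sum_congr rfl fun y _ => ?_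
          rw [Finset.sum_mul]
          refine Finset.sum_congr rfl fun a _ => ?_
          rw [Fin.prod_univ_succ]
          simp [Fin.consEquiv, ← Fin.succ_last, mul_assoc]
      _ = _ := by
          rw [h, Finset.sum_comm]
          simp_rw [pow_succ', Matrix.mul_apply, Finset.sum_mul, Finset.mul_sum]
          rw [Finset.sum_comm]
          conv_rhs => rw [Finset.sum_comm]
          refine Eq.trans ?_ (Finset.sum_congr rfl fun b _ => Finset.sum_comm)
          rw [Finset.sum_comm]
          simp only [mul_assoc]

lemma sum_cycle_eq_trace {ι R : Type*} [Fintype ι] [DecidableEq ι] [CommRing R]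
    (M : Matrix ι ι R) (k : ℕ) :
    ∑ y : Fin (k + 1) → ι, ∏ i, M (y i) (y (finRotate (k + 1) i)) = (M ^ (k + 1)).trace := by
  have h := sum_paths M k (fun a b => M b a)
  rw [Matrix.trace]
  simp_rw [Matrix.diag, pow_succ', Matrix.mul_apply]
  rw [Finset.sum_comm, ← h]
  refine Finset.sum_congr rfl fun y _ => ?_
  rw [Fin.prod_univ_castSucc, mul_comm]
  congr 1
  · rw [finRotate_last]
  · refine Finset.prod_congr rfl fun i _ => ?_
    rw [finRotate_apply, Fin.coeSucc_eq_succ]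

/-- By Cayley–Hamilton (`hM`) the traces of powers obey the same two-term recursion as `a ^ m + b ^
m`, so no diagonalisation is needed and `a = b` is harmless. -/
lemma trace_pow_eq_add_pow {ι R : Type*} [Fintype ι] [DecidableEq ι] [CommRing R]
    (M : Matrix ι ι R) (a b : R) (hcard : Fintype.card ι = 2) (htr : M.trace = a + b)
    (hM : M * M = (a + b) • M - (a * b) • 1) (m : ℕ) : (M ^ m).trace = a ^ m + b ^ m := by
  induction m using Nat.twoStepInduction with
  | zero => simp [hcard]; norm_num
  | one => simpa using htr
  | more m h1 h2 =>
    have : M ^ (m + 2) = (a + b) • M ^ (m + 1) - (a * b) • M ^ m := by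
      rw [pow_add, sq, hM, mul_sub, mul_smul_comm, mul_smul_comm, mul_one, pow_succ]
    rw [this, Matrix.trace_sub, Matrix.trace_smul, Matrix.trace_smul, h1, h2]
    simp only [smul_eq_mul]
    ring

lemma sum_spin {R : Type*} [AddCommMonoid R] (f : ℤˣ → R) : ∑ a, f a = f 1 + f (-1) := by
  rw [show (Finset.univ : Finset ℤˣ) = {1, -1} from rfl]
  exact Finset.sum_pair (by decide)

lemma forall_spin {P : ℤˣ → Prop} (h1 : P 1) (h2 : P (-1)) (e : ℤˣ) : P e := by
  rcases Int.units_eq_one_or e with rfl | rfl <;> assumption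

/-- The transfer matrix `M a b = exp (K a b + z b)` has trace `e ^ K (e ^ z + e ^ (-z))` and
determinant `e ^ (2K) - e ^ (-2K)`. The right side is symmetric in `± s`, so any square root serves:
the real `disc` as well as the analytic branch `cdisc`. -/
lemma ringPFC_eq (K : ℝ) {m : ℕ} (hm : m ≠ 0) (z s : ℂ)
    (hs : s ^ 2 = Complex.sinh z ^ 2 + Complex.exp (-4 * K)) :
    ringPFC K m z = (Complex.exp K * (Complex.cosh z + s)) ^ m +
      (Complex.exp K * (Complex.cosh z - s)) ^ m := by
  obtain ⟨k, rfl⟩ := Nat.exists_eq_succ_of_ne_zero hm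
  obtain ⟨M, hMab⟩ : ∃ M : Matrix ℤˣ ℤˣ ℂ, ∀ a b, M a b =
      Complex.exp (K * (((a : ℤ) : ℝ) : ℂ) * (((b : ℤ) : ℝ) : ℂ) + z * (((b : ℤ) : ℝ) : ℂ)) :=
    ⟨fun a b => _, fun _ _ => rfl⟩
  have hM : ringPFC K (k + 1) z = (M ^ (k + 1)).trace := by
    rw [← sum_cycle_eq_trace, ringPFC]
    refine Finset.sum_congr rfl fun y _ => ?_
    simp_rw [hMab]
    rw [← Complex.exp_sum, Finset.sum_add_distrib, ← Finset.mul_sum, spinSum, ringWeight,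
      Complex.ofReal_exp, ← Complex.exp_add,
      Equiv.sum_comp (finRotate (k + 1)) (fun i => (((y i : ℤ) : ℝ) : ℂ))]
    simp [toVec, Finset.mul_sum, mul_assoc]
  have e2 : Complex.exp K * Complex.exp (-K) = 1 := by
    rw [← Complex.exp_add]; simp
  have e4 : Complex.exp (-4 * K) = Complex.exp (-K) ^ 4 := by
    rw [← Complex.exp_nat_mul]; congr 1; push_cast; ring
  have e3 : Complex.exp z * Complex.exp (-z) = 1 := by
    rw [← Complex.exp_add]; simp
  have hprod : Complex.exp K * (Complex.cosh z + s) * (Complex.exp K * (Complex.cosh z - s)) =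
      Complex.exp K ^ 2 - Complex.exp (-K) ^ 2 := by
    have := Complex.cosh_sq z
    rw [e4] at hs
    generalize Complex.exp (-(K : ℂ)) = v at *
    generalize Complex.exp (K : ℂ) = u at *
    linear_combination u ^ 2 * (this - hs) - (u * v + 1) * v ^ 2 * e2
  have hsum : Complex.exp K * (Complex.cosh z + s) + Complex.exp K * (Complex.cosh z - s) =
      Complex.exp K * (Complex.exp z + Complex.exp (-z)) := by
    rw [Complex.cosh]; ring
  rw [hM]
  apply trace_pow_eq_add_pow
  · rfl
  · rw [hsum, Matrix.trace, sum_spin]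
    simp only [Matrix.diag, hMab]
    simp [Complex.exp_add]
    ring
  · rw [hsum, hprod]
    ext a b
    revert a b
    refine forall_spin (forall_spin ?_ ?_) (forall_spin ?_ ?_) <;>
      simp only [Matrix.sub_apply, Matrix.smul_apply, smul_eq_mul, Matrix.mul_apply, sum_spin,
        hMab] <;>
      simp [Complex.exp_add] <;>
      generalize Complex.exp (-(K : ℂ)) = v at * <;>
      generalize Complex.exp (K : ℂ) = u at * <;>
      generalize Complex.exp (-z) = w at * <;>
      generalize Complex.exp z = t at *
    · linear_combination (v ^ 2 - u ^ 2) * e3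
    · ring
    · ring
    · linear_combination (v ^ 2 - u ^ 2) * e3

/-! ### Star and wheel weights -/

lemma quadForm_eq {n : ℕ} (G : SimpleGraph (Fin n)) [DecidableRel G.Adj] (v : Fin n → ℝ) :
    v ⬝ᵥ Matrix.mulVec (G.adjMatrix ℝ) v = ∑ i, ∑ j, if G.Adj i j then v i * v j else 0 := by
  simp [dotProduct, Matrix.mulVec, Finset.mul_sum, SimpleGraph.adjMatrix_apply]

/-- Every ring edge occurs as two ordered pairs. At least three vertices are needed for the two
neighbours `i ± 1` to be distinct; this is `hex`. -/
lemma sum_cycleGraph (k : ℕ) (v : Fin (k + 3) → ℝ)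
    [DecidableRel (SimpleGraph.cycleGraph (k + 3)).Adj] :
    (∑ i, ∑ j, if (SimpleGraph.cycleGraph (k + 3)).Adj i j then v i * v j else 0) =
      2 * ∑ i, v i * v (finRotate (k + 3) i) := by
  have key : ∀ i j : Fin (k + 3),
      (if (SimpleGraph.cycleGraph (k + 3)).Adj i j then v i * v j else 0)
      = (if j = i + 1 then v i * v j else 0) + if i = j + 1 then v i * v j else 0 := by
    intro i j
    have hadj : (SimpleGraph.cycleGraph (k + 3)).Adj i j ↔ j = i + 1 ∨ i = j + 1 := by
      rw [SimpleGraph.cycleGraph_adj (n := k + 1), sub_eq_iff_eq_add', sub_eq_iff_eq_add', or_comm]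
    have hex : ¬ (j = i + 1 ∧ i = j + 1) := by
      rintro ⟨h1, h2⟩
      rw [h1, add_assoc] at h2
      have h3 : (1 + 1 : Fin (k + 3)) = 0 := left_eq_add.1 h2
      have := congrArg Fin.val h3
      simp only [Fin.val_add, Fin.val_zero, Fin.val_one] at this
      rw [Nat.mod_eq_of_lt (by omega)] at this
      omega
    by_cases h1 : j = i + 1 <;> by_cases h2 : i = j + 1
    · exact absurd ⟨h1, h2⟩ hex
    · rw [if_pos (hadj.2 (Or.inl h1)), if_pos h1, if_neg h2, add_zero]
    · rw [if_pos (hadj.2 (Or.inr h2)), if_neg h1, if_pos h2, zero_add]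
    · rw [if_neg (fun h => (hadj.1 h).elim h1 h2), if_neg h1, if_neg h2, zero_add]
  simp_rw [key, Finset.sum_add_distrib, finRotate_apply]
  rw [two_mul]
  congr 1
  · simp
  · rw [Finset.sum_comm]
    simp [mul_comm]

/-- The factor `ringWeight 0` equals `1`; it gives the star the same shape as the wheel. -/
lemma weight_star (β h : ℝ) (m : ℕ) (x : Spins (m + 1)) :
    weight (star (m + 1)) β h x = Real.exp (h * toVec x 0) * (ringWeight 0 (Fin.tail x) *
      Real.exp ((2 * β * toVec x 0 + h) * spinSum (Fin.tail x))) := by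
  classical
  have : (∑ i, ∑ j, if (star (m + 1)).Adj i j then toVec x i * toVec x j else 0) =
      2 * toVec x 0 * spinSum (Fin.tail x) := by
    simp [Fin.sum_univ_succ, star, spinSum, Fin.tail, toVec, Finset.mul_sum,
      (Fin.succ_ne_zero _).symm]
    rw [← Finset.sum_add_distrib]
    exact Finset.sum_congr rfl fun i _ => by ring
  rw [weight, quadForm_eq]
  simp only [ringWeight, ← Real.exp_add]
  congr 1
  rw [show (∑ i, toVec x i) = toVec x 0 + spinSum (Fin.tail x) from Fin.sum_univ_succ _]
  have h2 := this
  convert (congrArg (fun t => β * t + h * (toVec x 0 + spinSum (Fin.tail x))) h2) using 1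
  ring

lemma weight_wheel (β h : ℝ) (k : ℕ) (x : Spins (k + 3 + 1)) :
    weight (wheel (k + 3 + 1)) β h x = Real.exp (h * toVec x 0) *
      (ringWeight (2 * β) (Fin.tail x) *
      Real.exp ((2 * β * toVec x 0 + h) * spinSum (Fin.tail x))) := by
  classical
  have hcyc := sum_cycleGraph k (toVec (Fin.tail x : Spins (k + 3)))
  have hadj : ∀ i j : Fin (k + 3), (wheel (k + 3 + 1)).Adj i.succ j.succ ↔
      (SimpleGraph.cycleGraph (k + 3)).Adj i j := by
    intro i j
    have h := SimpleGraph.map_adj_apply (G := SimpleGraph.cycleGraph (k + 3))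
      (f := Fin.succEmb (k + 3)) (a := i) (b := j)
    simp only [Fin.coe_succEmb] at h
    simp [wheel, h]
  have hadj0 : ∀ j : Fin (k + 3), (wheel (k + 3 + 1)).Adj 0 j.succ := by
    intro j
    simp [wheel, (Fin.succ_ne_zero _).symm]
  have hadj1 : ∀ j : Fin (k + 3), (wheel (k + 3 + 1)).Adj j.succ 0 := fun j => (hadj0 j).symm
  have : (∑ i, ∑ j, if (wheel (k + 3 + 1)).Adj i j then toVec x i * toVec x j else 0) =
      2 * toVec x 0 * spinSum (Fin.tail x) + 2 * ∑ i, toVec (Fin.tail x : Spins (k + 3)) i *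
        toVec (Fin.tail x : Spins (k + 3)) (finRotate (k + 3) i) := by
    rw [Fin.sum_univ_succ, Fin.sum_univ_succ, ← hcyc]
    simp_rw [Fin.sum_univ_succ (fun j => if (wheel (k + 3 + 1)).Adj (Fin.succ _) j then _ else _)]
    simp_rw [hadj, hadj0, hadj1]
    simp [Finset.sum_add_distrib, spinSum, Fin.tail, toVec, Finset.mul_sum]
    rw [← add_assoc, ← Finset.sum_add_distrib]
    congr 1
    exact Finset.sum_congr rfl fun i _ => by ring
  rw [weight, quadForm_eq]
  simp only [ringWeight, ← Real.exp_add]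
  congr 1
  rw [show (∑ i, toVec x i) = toVec x 0 + spinSum (Fin.tail x) from Fin.sum_univ_succ _]
  convert (congrArg (fun t => β * t + h * (toVec x 0 + spinSum (Fin.tail x))) this) using 1
  ring

end

end Sentiment

namespace Sentiment

noncomputable section

/-! ### The leading eigenvalue and its logarithmic derivatives -/

/-- Half the distance of the two normalised eigenvalues of the transfer matrix. -/
def disc (c H : ℝ) : ℝ := √(Real.sinh H ^ 2 + c)

/-- The leading normalised eigenvalue of the transfer matrix. -/
def eig (c H : ℝ) : ℝ := Real.cosh H + disc c H

/-- The logarithmic derivative of `eig`. -/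
def slope (c H : ℝ) : ℝ := Real.sinh H / disc c H

/-- The second logarithmic derivative of `eig`. -/
def curv (c H : ℝ) : ℝ := c * Real.cosh H / disc c H ^ 3

/-- The ratio of the two eigenvalues of the transfer matrix. -/
def ratio (c H : ℝ) : ℝ := (Real.cosh H - disc c H) / eig c H

variable {c : ℝ}

lemma disc_pos (hc : 0 < c) (H : ℝ) : 0 < disc c H := Real.sqrt_pos.2 (by positivity)

lemma disc_sq (hc : 0 < c) (H : ℝ) : disc c H ^ 2 = Real.sinh H ^ 2 + c :=
  Real.sq_sqrt (by positivity)

lemma disc_le_cosh (hc1 : c ≤ 1) (H : ℝ) : disc c H ≤ Real.cosh H := by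
  rw [disc, Real.sqrt_le_left (Real.cosh_pos H).le, Real.cosh_sq]
  linarith

lemma eig_pos (H : ℝ) : 0 < eig c H :=
  add_pos_of_pos_of_nonneg (Real.cosh_pos H) (Real.sqrt_nonneg _)

lemma disc_neg (H : ℝ) : disc c (-H) = disc c H := by simp [disc]
lemma eig_neg (H : ℝ) : eig c (-H) = eig c H := by simp [eig, disc_neg]
lemma slope_neg (H : ℝ) : slope c (-H) = -slope c H := by simp [slope, disc_neg, neg_div]
lemma curv_neg (H : ℝ) : curv c (-H) = curv c H := by simp [curv, disc_neg]
lemma eig_abs (H : ℝ) : eig c |H| = eig c H := by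
  rcases abs_choice H with h | h <;> simp [h, eig_neg]

lemma curv_pos (hc : 0 < c) (H : ℝ) : 0 < curv c H :=
  div_pos (mul_pos hc (Real.cosh_pos H)) (pow_pos (disc_pos hc H) 3)

/-- The condition `c ≤ 1` means `K ≥ 0`: in the ferromagnetic case the smaller eigenvalue is
nonnegative, so the ratio lies in `[0, 1)`. -/
lemma ratio_nonneg (hc1 : c ≤ 1) (H : ℝ) : 0 ≤ ratio c H :=
  div_nonneg (sub_nonneg.2 (disc_le_cosh hc1 H)) (eig_pos H).le

lemma ratio_lt_one (hc : 0 < c) (H : ℝ) : ratio c H < 1 := by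
  rw [ratio, div_lt_one (eig_pos H), eig]
  linarith [disc_pos hc H]

lemma hasDerivAt_disc (hc : 0 < c) (H : ℝ) :
    HasDerivAt (disc c) (Real.sinh H * Real.cosh H / disc c H) H := by
  have hd := disc_pos hc H
  have h := (((Real.hasDerivAt_sinh H).fun_pow 2).add_const c).sqrt (by positivity)
  refine HasDerivAt.congr_deriv (f := disc c) h ?_
  rw [← disc]
  field_simp
  simp

lemma hasDerivAt_eig (hc : 0 < c) (H : ℝ) : HasDerivAt (eig c) (slope c H * eig c H) H := by
  have hd := disc_pos hc H
  refine HasDerivAt.congr_deriv (f := eig c)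
    ((Real.hasDerivAt_cosh H).fun_add (hasDerivAt_disc hc H)) ?_
  rw [slope, eig]
  field_simp
  ring

lemma hasDerivAt_slope (hc : 0 < c) (H : ℝ) : HasDerivAt (slope c) (curv c H) H := by
  have hd := disc_pos hc H
  refine HasDerivAt.congr_deriv (f := slope c)
    ((Real.hasDerivAt_sinh H).fun_div (hasDerivAt_disc hc H) hd.ne') ?_
  rw [curv]
  field_simp
  rw [disc_sq hc]
  ring

/-- The product `cosh² - disc² = 1 - c` of the eigenvalues does not depend on the field, so their
logarithmic derivatives are `± slope`. -/
lemma hasDerivAt_ratio (hc : 0 < c) (H : ℝ) :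
    HasDerivAt (ratio c) (-2 * slope c H * ratio c H) H := by
  have hd := disc_pos hc H
  have he := eig_pos (c := c) H
  refine HasDerivAt.congr_deriv (f := ratio c) (((Real.hasDerivAt_cosh H).fun_sub
    (hasDerivAt_disc hc H)).fun_div (hasDerivAt_eig hc H) he.ne') ?_
  rw [ratio, slope]
  field_simp
  ring

lemma eig_strictMonoOn (hc : 0 < c) : StrictMonoOn (eig c) (Set.Ici 0) := by
  apply strictMonoOn_of_hasDerivWithinAt_pos (convex_Ici 0)
    (fun x _ => (hasDerivAt_eig hc x).continuousAt.continuousWithinAt)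
    (fun x _ => (hasDerivAt_eig hc x).hasDerivWithinAt)
  intro x hx
  rw [interior_Ici] at hx
  exact mul_pos (div_pos (Real.sinh_pos_iff.2 hx) (disc_pos hc x)) (eig_pos x)

lemma eig_lt_eig (hc : 0 < c) {H H' : ℝ} (h : |H| < |H'|) : eig c H < eig c H' := by
  rw [← eig_abs H, ← eig_abs H']
  exact eig_strictMonoOn hc (Set.mem_Ici.2 (abs_nonneg _)) (Set.mem_Ici.2 (abs_nonneg _)) h

lemma hasDerivAt_log_eig (hc : 0 < c) (H : ℝ) :
    HasDerivAt (fun t => Real.log (eig c t)) (slope c H) H := by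
  convert (hasDerivAt_eig hc H).log (eig_pos H).ne' using 1
  rw [mul_div_cancel_right₀ _ (eig_pos H).ne']

/-! ### Mean and variance of the ring -/

lemma ringPF_eq (K : ℝ) {m : ℕ} (hm : m ≠ 0) (H : ℝ) :
    ringPF K m H = Real.exp K ^ m * (eig (Real.exp (-4 * K)) H ^ m *
      (1 + ratio (Real.exp (-4 * K)) H ^ m)) := by
  have hc := Real.exp_pos (-4 * K)
  have h := ringPFC_eq K hm H (disc (Real.exp (-4 * K)) H) (by exact_mod_cast disc_sq hc H)
  rw [← ofReal_ringPF] at h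
  have h2 : ringPF K m H = (Real.exp K * (Real.cosh H + disc (Real.exp (-4 * K)) H)) ^ m +
      (Real.exp K * (Real.cosh H - disc (Real.exp (-4 * K)) H)) ^ m := by exact_mod_cast h
  have he := eig_pos (c := Real.exp (-4 * K)) H
  rw [h2, ratio, div_pow, mul_pow, mul_pow, ← eig]
  generalize Real.exp (-4 * K) = c at *
  field_simp

lemma hasDerivAt_sum_exp {m : ℕ} (w f : Spins m → ℝ) (H : ℝ) :
    HasDerivAt (fun t => ∑ y, w y * Real.exp (t * spinSum y) * f y)
      (∑ y, w y * Real.exp (H * spinSum y) * (spinSum y * f y)) H := by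
  refine HasDerivAt.fun_sum fun y _ => ?_
  refine ((((hasDerivAt_id' H).mul_const (spinSum y)).exp.const_mul (w y)).mul_const
    (f y)).congr_deriv ?_
  ring

lemma ringExp_add (K H : ℝ) (m : ℕ) (f g : Spins m → ℝ) :
    ringExp K H m (fun y => f y + g y) = ringExp K H m f + ringExp K H m g := by
  simp only [ringExp, mul_add, Finset.sum_add_distrib, add_div]

lemma ringExp_const_mul (K H : ℝ) (m : ℕ) (a : ℝ) (f : Spins m → ℝ) :
    ringExp K H m (fun y => a * f y) = a * ringExp K H m f := by
  simp only [ringExp, mul_div_assoc', Finset.mul_sum]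
  congr 1
  exact Finset.sum_congr rfl fun y _ => by ring

lemma ringExp_const (K H : ℝ) (m : ℕ) (a : ℝ) : ringExp K H m (fun _ => a) = a := by
  rw [ringExp, ← Finset.sum_mul, ← ringPF, mul_div_cancel_left₀ _ (ringPF_pos K m H).ne']

lemma ringExp_mono (K H : ℝ) (m : ℕ) {f g : Spins m → ℝ} (h : ∀ y, f y ≤ g y) :
    ringExp K H m f ≤ ringExp K H m g :=
  div_le_div_of_nonneg_right (Finset.sum_le_sum fun y _ => mul_le_mul_of_nonneg_left (h y)
    (mul_pos (Real.exp_pos _) (Real.exp_pos _)).le) (ringPF_pos K m H).le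

lemma hasDerivAt_ratio_pow (hc : 0 < c) {m : ℕ} (hm : m ≠ 0) (H : ℝ) :
    HasDerivAt (fun t => ratio c t ^ m) (-2 * m * slope c H * ratio c H ^ m) H := by
  obtain ⟨k, rfl⟩ := Nat.exists_eq_succ_of_ne_zero hm
  refine ((hasDerivAt_ratio hc H).fun_pow (k + 1)).congr_deriv ?_
  simp
  ring

lemma hasDerivAt_eig_pow (hc : 0 < c) {m : ℕ} (hm : m ≠ 0) (H : ℝ) :
    HasDerivAt (fun t => eig c t ^ m) (m * slope c H * eig c H ^ m) H := by
  obtain ⟨k, rfl⟩ := Nat.exists_eq_succ_of_ne_zero hm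
  refine ((hasDerivAt_eig hc H).fun_pow (k + 1)).congr_deriv ?_
  simp
  ring

/-- The finite size correction of the mean of the ring. -/
def sizeCorr (c : ℝ) (m : ℕ) (H : ℝ) : ℝ := (1 - ratio c H ^ m) / (1 + ratio c H ^ m)

lemma one_add_ratio_pow_pos (hc1 : c ≤ 1) (m : ℕ) (H : ℝ) : 0 < 1 + ratio c H ^ m :=
  add_pos_of_pos_of_nonneg one_pos (pow_nonneg (ratio_nonneg hc1 H) m)

lemma hasDerivAt_sizeCorr (hc : 0 < c) (hc1 : c ≤ 1) {m : ℕ} (hm : m ≠ 0) (H : ℝ) :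
    HasDerivAt (sizeCorr c m)
      (4 * slope c H * (m * ratio c H ^ m) / (1 + ratio c H ^ m) ^ 2) H := by
  have hr := hasDerivAt_ratio_pow hc hm H
  have h1 := one_add_ratio_pow_pos hc1 m H
  refine ((hr.const_sub 1).fun_div (hr.const_add 1) h1.ne').congr_deriv ?_
  field_simp
  ring

lemma exp_neg_four_mul_le_one {K : ℝ} (hK : 0 ≤ K) : Real.exp (-4 * K) ≤ 1 :=
  Real.exp_le_one_iff.2 (by linarith)

lemma hasDerivAt_ringPF (K : ℝ) (m : ℕ) (H : ℝ) : HasDerivAt (ringPF K m)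
    (∑ y : Spins m, ringWeight K y * Real.exp (H * spinSum y) * spinSum y) H := by
  simpa [ringPF] using! hasDerivAt_sum_exp (fun y : Spins m => ringWeight K y) (fun _ => 1) H

/-- The mean is the logarithmic derivative of the partition function: the derivative of the defining
sum is compared with that of the closed form. -/
lemma ringExp_spinSum {K : ℝ} (hK : 0 ≤ K) {m : ℕ} (hm : m ≠ 0) (H : ℝ) :
    ringExp K H m spinSum =
      m * (slope (Real.exp (-4 * K)) H * sizeCorr (Real.exp (-4 * K)) m H) := by
  have hc := Real.exp_pos (-4 * K)
  have hc1 := exp_neg_four_mul_le_one hK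
  set c := Real.exp (-4 * K) with hcdef
  have h1 := hasDerivAt_ringPF K m H
  have h2 : HasDerivAt (ringPF K m) (Real.exp K ^ m * (m * slope c H * eig c H ^ m *
      (1 - ratio c H ^ m))) H := by
    rw [show ringPF K m = _ from funext fun t => ringPF_eq K hm t]
    refine (((hasDerivAt_eig_pow hc hm H).fun_mul
      ((hasDerivAt_ratio_pow hc hm H).const_add 1)).const_mul _).congr_deriv ?_
    ring
  rw [ringExp, h1.unique h2, ringPF_eq K hm, ← hcdef, sizeCorr]
  have := one_add_ratio_pow_pos hc1 m H
  have := eig_pos (c := c) H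
  field_simp

/-- The variance is the derivative of the mean in the field. The term with `m * ratio ^ m` comes
from differentiating the finite size correction, and it vanishes in the limit because `ratio < 1`.
-/
lemma ringExp_variance {K : ℝ} (hK : 0 ≤ K) {m : ℕ} (hm : m ≠ 0) (H : ℝ) :
    ringExp K H m (fun y => (spinSum y - ringExp K H m spinSum) ^ 2) =
      m * (curv (Real.exp (-4 * K)) H * sizeCorr (Real.exp (-4 * K)) m H +
      4 * slope (Real.exp (-4 * K)) H ^ 2 * (m * ratio (Real.exp (-4 * K)) H ^ m) /
        (1 + ratio (Real.exp (-4 * K)) H ^ m) ^ 2) := by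
  have hc := Real.exp_pos (-4 * K)
  have hc1 := exp_neg_four_mul_le_one hK
  have hF := ringPF_pos K m H
  have h1 : HasDerivAt (fun t => ringExp K t m spinSum) _ H :=
    (hasDerivAt_sum_exp (fun y : Spins m => ringWeight K y) spinSum H).fun_div
      (hasDerivAt_ringPF K m H) hF.ne'
  have h2 := ((hasDerivAt_slope hc H).fun_mul (hasDerivAt_sizeCorr hc hc1 hm H)).const_mul (m : ℝ)
  rw [← funext fun t => ringExp_spinSum hK hm t] at h2
  have h3 := h1.unique h2
  have h4 : ∀ y : Spins m, (spinSum y - ringExp K H m spinSum) ^ 2 = spinSum y * spinSum y +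
      ((-2 * ringExp K H m spinSum) * spinSum y + ringExp K H m spinSum ^ 2) := fun y => by ring
  simp_rw [h4]
  rw [ringExp_add, ringExp_add, ringExp_const_mul, ringExp_const]
  refine Eq.trans ?_ (h3.trans (by ring))
  rw [ringExp, ringExp]
  field_simp
  ring

lemma tendsto_ratio_pow (hc : 0 < c) (hc1 : c ≤ 1) (H : ℝ) :
    Tendsto (fun m : ℕ => ratio c H ^ m) atTop (𝓝 0) :=
  tendsto_pow_atTop_nhds_zero_of_lt_one (ratio_nonneg hc1 H) (ratio_lt_one hc H)

lemma tendsto_sizeCorr (hc : 0 < c) (hc1 : c ≤ 1) (H : ℝ) :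
    Tendsto (fun m : ℕ => sizeCorr c m H) atTop (𝓝 1) := by
  have h := tendsto_ratio_pow hc hc1 H
  simpa using! (h.const_sub 1).div (h.const_add 1) (by norm_num)

lemma tendsto_ringExp_spinSum {K : ℝ} (hK : 0 ≤ K) (H : ℝ) :
    Tendsto (fun m : ℕ => ringExp K H m spinSum / m) atTop
      (𝓝 (slope (Real.exp (-4 * K)) H)) := by
  have h := (tendsto_sizeCorr (Real.exp_pos _) (exp_neg_four_mul_le_one hK) H).const_mul
    (slope (Real.exp (-4 * K)) H)
  rw [mul_one] at h
  refine h.congr' ?_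
  filter_upwards [eventually_ne_atTop 0] with m hm
  rw [ringExp_spinSum hK hm, mul_div_cancel_left₀ _ (Nat.cast_ne_zero.2 hm)]

lemma tendsto_ringExp_variance {K : ℝ} (hK : 0 ≤ K) (H : ℝ) :
    Tendsto (fun m : ℕ => ringExp K H m (fun y => (spinSum y - ringExp K H m spinSum) ^ 2) / m)
      atTop (𝓝 (curv (Real.exp (-4 * K)) H)) := by
  have hc := Real.exp_pos (-4 * K)
  have hc1 := exp_neg_four_mul_le_one hK
  have h0 := tendsto_ratio_pow hc hc1 H
  have h1 := tendsto_self_mul_const_pow_of_lt_one (ratio_nonneg hc1 H) (ratio_lt_one hc H)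
  have h := ((tendsto_sizeCorr hc hc1 H).const_mul (curv (Real.exp (-4 * K)) H)).add
    ((h1.const_mul (4 * slope (Real.exp (-4 * K)) H ^ 2)).div
      ((h0.const_add 1).pow 2) (by norm_num))
  simp only [mul_one, mul_zero, zero_div, add_zero] at h
  refine h.congr' ?_
  filter_upwards [eventually_ne_atTop 0] with m hm
  rw [ringExp_variance hK hm, mul_div_cancel_left₀ _ (Nat.cast_ne_zero.2 hm)]
  rfl

/-! ### Exponential moments of the ring -/

lemma ringPF_le {K : ℝ} (hK : 0 ≤ K) {m : ℕ} (hm : m ≠ 0) (H : ℝ) :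
    ringPF K m H ≤ 2 * (Real.exp K * eig (Real.exp (-4 * K)) H) ^ m := by
  have hc := Real.exp_pos (-4 * K)
  have hc1 := exp_neg_four_mul_le_one hK
  have h := pow_le_one₀ (n := m) (ratio_nonneg hc1 H) (ratio_lt_one hc H).le
  have he := eig_pos (c := Real.exp (-4 * K)) H
  rw [ringPF_eq K hm, mul_pow]
  have : 0 < Real.exp K ^ m * eig (Real.exp (-4 * K)) H ^ m := by positivity
  nlinarith

lemma le_ringPF {K : ℝ} (hK : 0 ≤ K) {m : ℕ} (hm : m ≠ 0) (H : ℝ) :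
    (Real.exp K * eig (Real.exp (-4 * K)) H) ^ m ≤ ringPF K m H := by
  have hc1 := exp_neg_four_mul_le_one hK
  have h := pow_nonneg (ratio_nonneg hc1 H) m
  have he := eig_pos (c := Real.exp (-4 * K)) H
  rw [ringPF_eq K hm, mul_pow]
  have : 0 < Real.exp K ^ m * eig (Real.exp (-4 * K)) H ^ m := by positivity
  nlinarith

lemma ringPF_div_le {K : ℝ} (hK : 0 ≤ K) {m : ℕ} (hm : m ≠ 0) (H H' : ℝ) :
    ringPF K m H' / ringPF K m H ≤
      2 * (eig (Real.exp (-4 * K)) H' / eig (Real.exp (-4 * K)) H) ^ m := by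
  have he := eig_pos (c := Real.exp (-4 * K)) H
  rw [div_le_iff₀ (ringPF_pos K m H)]
  refine (ringPF_le hK hm H').trans ?_
  have h := le_ringPF hK hm H
  calc _ = 2 * (eig (Real.exp (-4 * K)) H' / eig (Real.exp (-4 * K)) H) ^ m *
        (Real.exp K * eig (Real.exp (-4 * K)) H) ^ m := by
        rw [mul_assoc, ← mul_pow]
        congr 2
        rw [mul_left_comm, div_mul_cancel₀ _ he.ne']
    _ ≤ _ := by
        refine mul_le_mul_of_nonneg_left h ?_
        have := eig_pos (c := Real.exp (-4 * K)) H'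
        positivity

/-- Exponential tilting is a shift of the field; every Chernoff bound for `X` rests on this. -/
lemma ringExp_exp (K H t : ℝ) (m : ℕ) :
    ringExp K H m (fun y => Real.exp (t * spinSum y)) = ringPF K m (H + t) / ringPF K m H := by
  rw [ringExp, ringPF]
  congr 1
  refine Finset.sum_congr rfl fun y _ => ?_
  rw [mul_assoc, ← Real.exp_add, add_mul]

end

end Sentiment

namespace Sentiment

noncomputable section

/-! ### Exponentially small sequences -/

/-- A sequence that decays at least exponentially fast. -/
def ExpSmall (u : ℕ → ℝ) : Prop :=
  ∃ α : ℝ, 0 < α ∧ u =O[atTop] fun n : ℕ => Real.exp (-(n * α))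

lemma isBigO_exp_of_le {α α' : ℝ} (h : α ≤ α') :
    (fun n : ℕ => Real.exp (-(n * α'))) =O[atTop] fun n : ℕ => Real.exp (-(n * α)) := by
  refine Asymptotics.IsBigO.of_norm_le fun n => ?_
  rw [Real.norm_of_nonneg (Real.exp_pos _).le, Real.exp_le_exp]
  have : (0 : ℝ) ≤ n := n.cast_nonneg
  nlinarith

lemma ExpSmall.add {u v : ℕ → ℝ} (hu : ExpSmall u) (hv : ExpSmall v) :
    ExpSmall fun n => u n + v n := by
  obtain ⟨a, ha, hu⟩ := hu
  obtain ⟨b, hb, hv⟩ := hv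
  exact ⟨min a b, lt_min ha hb, (hu.trans (isBigO_exp_of_le (min_le_left a b))).add
    (hv.trans (isBigO_exp_of_le (min_le_right a b)))⟩

lemma ExpSmall.const_mul {u : ℕ → ℝ} (hu : ExpSmall u) (a : ℝ) : ExpSmall fun n => a * u n := by
  obtain ⟨b, hb, hu⟩ := hu
  exact ⟨b, hb, hu.const_mul_left a⟩

lemma ExpSmall.of_le {u v : ℕ → ℝ} (hv : ExpSmall v) (hu : ∀ n, 0 ≤ u n)
    (h : ∀ᶠ n in atTop, u n ≤ v n) : ExpSmall u := by
  obtain ⟨b, hb, hv⟩ := hv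
  refine ⟨b, hb, Asymptotics.IsBigO.trans ?_ hv⟩
  refine Asymptotics.IsBigO.of_bound 1 ?_
  filter_upwards [h] with n hn
  rw [one_mul, Real.norm_of_nonneg (hu n)]
  exact hn.trans (le_abs_self _)

lemma expSmall_pow {r : ℝ} (h0 : 0 < r) (h1 : r < 1) : ExpSmall fun n => r ^ n := by
  refine ⟨-Real.log r, neg_pos.2 (Real.log_neg h0 h1), ?_⟩
  have : (fun n : ℕ => r ^ n) = fun n : ℕ => Real.exp (-(n * -Real.log r)) := by
    funext n
    rw [mul_neg, neg_neg, Real.exp_nat_mul, Real.exp_log h0]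
  rw [this]

lemma ExpSmall.of_succ {u : ℕ → ℝ} (h : ExpSmall fun n => u (n + 1)) : ExpSmall u := by
  obtain ⟨b, hb, h⟩ := h
  refine ⟨b, hb, ?_⟩
  obtain ⟨C, hC⟩ := h.bound
  -- The factor `exp b` pays for the index shift by one.
  refine Asymptotics.IsBigO.of_bound (C * Real.exp b) ?_
  obtain ⟨N, hN⟩ := eventually_atTop.1 hC
  refine eventually_atTop.2 ⟨N + 1, fun n hn => ?_⟩
  obtain ⟨k, rfl⟩ := Nat.exists_eq_add_of_le' (Nat.one_le_of_lt hn)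
  refine (hN k (by omega)).trans (le_of_eq ?_)
  rw [Real.norm_of_nonneg (Real.exp_pos _).le, Real.norm_of_nonneg (Real.exp_pos _).le, mul_assoc,
    ← Real.exp_add]
  congr 2
  push_cast
  ring

lemma ExpSmall.tendsto_mul {u : ℕ → ℝ} (h : ExpSmall u) :
    Tendsto (fun n : ℕ => n * u n) atTop (𝓝 0) := by
  obtain ⟨b, hb, h⟩ := h
  refine ((Asymptotics.isBigO_refl (fun n : ℕ => (n : ℝ)) atTop).mul h).trans_tendsto ?_
  convert tendsto_self_mul_const_pow_of_lt_one (Real.exp_pos (-b)).le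
    (Real.exp_lt_one_iff.2 (neg_lt_zero.2 hb)) using 3 with n
  rw [← Real.exp_nat_mul, mul_neg]

lemma ExpSmall.tendsto {u : ℕ → ℝ} (h : ExpSmall u) : Tendsto u atTop (𝓝 0) := by
  obtain ⟨b, hb, h⟩ := h
  refine h.trans_tendsto ?_
  convert tendsto_pow_atTop_nhds_zero_of_lt_one (Real.exp_pos (-b)).le
    (Real.exp_lt_one_iff.2 (neg_lt_zero.2 hb)) using 2 with n
  rw [← Real.exp_nat_mul, mul_neg]

lemma ExpSmall.exists_le {u : ℕ → ℝ} (h : ExpSmall u) :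
    ∃ α : ℝ, 0 < α ∧ ∀ᶠ n : ℕ in atTop, u n ≤ Real.exp (-(n * α)) := by
  obtain ⟨b, hb, h⟩ := h
  -- Halving the rate absorbs the constant of the `O`.
  refine ⟨b / 2, half_pos hb, ?_⟩
  have h2 : (fun n : ℕ => Real.exp (-(n * b))) =o[atTop]
      fun n : ℕ => Real.exp (-(n * (b / 2))) := by
    rw [Real.isLittleO_exp_comp_exp_comp]
    have := (tendsto_natCast_atTop_atTop (R := ℝ)).atTop_mul_const (half_pos hb)
    refine this.congr fun n => ?_
    ring
  filter_upwards [(h.trans_isLittleO h2).bound one_pos] with n hn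
  rw [one_mul, Real.norm_of_nonneg (Real.exp_pos _).le] at hn
  exact (le_abs_self _).trans hn

lemma ExpSmall.limsup_log_div_neg {u : ℕ → ℝ} (h : ExpSmall u) :
    limsup (fun n : ℕ => ENNReal.log (ENNReal.ofReal (u n)) / (n : EReal)) atTop < 0 := by
  obtain ⟨a, ha, h⟩ := h.exists_le
  refine lt_of_le_of_lt (b := ((-a : ℝ) : EReal)) (limsup_le_of_le (h := ?_)) ?_
  · filter_upwards [h, eventually_ne_atTop 0] with n hn h0
    have hn' : (0 : ℝ) < n := Nat.cast_pos.2 (Nat.pos_of_ne_zero h0)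
    have h1 : ENNReal.log (ENNReal.ofReal (u n)) ≤ ((-(n * a) : ℝ) : EReal) := by
      refine (ENNReal.log_monotone (ENNReal.ofReal_le_ofReal hn)).trans (le_of_eq ?_)
      rw [ENNReal.log_ofReal_of_pos (Real.exp_pos _), Real.log_exp]
    refine (EReal.div_le_div_right_of_nonneg (by positivity) h1).trans (le_of_eq ?_)
    rw [show (n : EReal) = ((n : ℝ) : EReal) from rfl, ← EReal.coe_div]
    congr 1
    field_simp
  · exact_mod_cast neg_lt_zero.2 ha

/-! ### Conditioning on the centre -/

/-- The real value of a spin. -/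
def sgn (e : ℤˣ) : ℝ := ((e : ℤ) : ℝ)

@[simp] lemma sgn_one : sgn 1 = 1 := by simp [sgn]
@[simp] lemma sgn_neg (e : ℤˣ) : sgn (-e) = -sgn e := by simp [sgn]

lemma sgn_eq (e : ℤˣ) : sgn e = 1 ∨ sgn e = -1 := by
  rcases Int.units_eq_one_or e with rfl | rfl <;> simp

/-- Given the centre, the other vertices of the graphs `G n` form an Ising ring of coupling `K`. -/
def IsRingCone (G : ∀ n : ℕ, SimpleGraph (Fin n)) (β K : ℝ) : Prop :=
  ∀ m, 3 ≤ m → ∀ (h : ℝ) (x : Spins (m + 1)), weight (G (m + 1)) β h x =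
    Real.exp (h * sgn (x 0)) * (ringWeight K (Fin.tail x) *
      Real.exp ((2 * β * sgn (x 0) + h) * spinSum (Fin.tail x)))

lemma isRingCone_star (β : ℝ) : IsRingCone star β 0 := fun m _ h x => weight_star β h m x

lemma isRingCone_wheel (β : ℝ) : IsRingCone wheel β (2 * β) := by
  intro m hm h x
  obtain ⟨k, rfl⟩ := Nat.exists_eq_add_of_le' hm
  exact weight_wheel β h k x

/-- The law of the centre. -/
def centreProb (K β h : ℝ) (m : ℕ) (e : ℤˣ) : ℝ :=
  Real.exp (h * sgn e) * ringPF K m (2 * β * sgn e + h) /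
    ∑ e', Real.exp (h * sgn e') * ringPF K m (2 * β * sgn e' + h)

variable {G : ∀ n : ℕ, SimpleGraph (Fin n)} {β K : ℝ}

lemma sum_weight_mul (hG : IsRingCone G β K) {m : ℕ} (hm : 3 ≤ m) (h : ℝ)
    (f : Spins (m + 1) → ℝ) : ∑ x, weight (G (m + 1)) β h x * f x =
      ∑ e, Real.exp (h * sgn e) * (ringPF K m (2 * β * sgn e + h) *
        ringExp K (2 * β * sgn e + h) m (fun y => f (Fin.cons e y))) := by
  rw [← (Fin.consEquiv (fun _ : Fin (m + 1) => ℤˣ)).sum_comp, Fintype.sum_prod_type]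
  refine Finset.sum_congr rfl fun e _ => ?_
  rw [ringExp, mul_div_cancel₀ _ (ringPF_pos _ _ _).ne', Finset.mul_sum]
  refine Finset.sum_congr rfl fun y _ => ?_
  rw [hG m hm]
  simp [Fin.consEquiv, mul_assoc]

lemma partitionFn_eq (hG : IsRingCone G β K) {m : ℕ} (hm : 3 ≤ m) (h : ℝ) :
    partitionFn (G (m + 1)) β h =
      ∑ e, Real.exp (h * sgn e) * ringPF K m (2 * β * sgn e + h) := by
  simpa [partitionFn, ringExp_const] using sum_weight_mul hG hm h (fun _ => 1)

/-- The law of total expectation over the centre; it reduces every later statement to rings. -/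
lemma expect_eq (hG : IsRingCone G β K) {m : ℕ} (hm : 3 ≤ m) (h : ℝ)
    (f : Spins (m + 1) → ℝ) : expect (G (m + 1)) β h f =
      ∑ e, centreProb K β h m e *
        ringExp K (2 * β * sgn e + h) m (fun y => f (Fin.cons e y)) := by
  have h1 : expect (G (m + 1)) β h f =
      (∑ x, weight (G (m + 1)) β h x * f x) / partitionFn (G (m + 1)) β h := by
    rw [expect, Finset.sum_div]
    exact Finset.sum_congr rfl fun x _ => by rw [prior]; ring
  rw [h1, sum_weight_mul hG hm, partitionFn_eq hG hm, Finset.sum_div]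
  exact Finset.sum_congr rfl fun e _ => by rw [centreProb]; ring

lemma centre_term_pos (K β h : ℝ) (m : ℕ) (e : ℤˣ) :
    0 < Real.exp (h * sgn e) * ringPF K m (2 * β * sgn e + h) :=
  mul_pos (Real.exp_pos _) (ringPF_pos _ _ _)

lemma centreProb_pos (K β h : ℝ) (m : ℕ) (e : ℤˣ) : 0 < centreProb K β h m e :=
  div_pos (centre_term_pos ..)
    (Finset.sum_pos (fun _ _ => centre_term_pos ..) Finset.univ_nonempty)

lemma sum_spin' {R : Type*} [AddCommMonoid R] (f : ℤˣ → R) (e : ℤˣ) :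
    ∑ a, f a = f e + f (-e) := by
  rw [sum_spin]
  revert e
  exact forall_spin rfl (by rw [neg_neg, add_comm])

lemma centreProb_add (K β h : ℝ) (m : ℕ) (e : ℤˣ) :
    centreProb K β h m e + centreProb K β h m (-e) = 1 := by
  rw [← sum_spin' (centreProb K β h m)]
  simp only [centreProb]
  rw [← Finset.sum_div]
  exact div_self (Finset.sum_pos (fun _ _ => centre_term_pos ..) Finset.univ_nonempty).ne'

lemma centreProb_le_one (K β h : ℝ) (m : ℕ) (e : ℤˣ) : centreProb K β h m e ≤ 1 := by
  linarith [centreProb_add K β h m e, centreProb_pos K β h m (-e)]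

lemma ringPF_neg (K : ℝ) {m : ℕ} (hm : m ≠ 0) (H : ℝ) : ringPF K m (-H) = ringPF K m H := by
  rw [ringPF_eq K hm, ringPF_eq K hm, ratio, ratio, eig_neg, disc_neg, Real.cosh_neg]

lemma centreProb_zero_field (K β : ℝ) {m : ℕ} (hm : m ≠ 0) (e : ℤˣ) :
    centreProb K β 0 m e = 1 / 2 := by
  have h : centreProb K β 0 m (-e) = centreProb K β 0 m e := by
    simp [centreProb, ringPF_neg K hm]
  linarith [centreProb_add K β 0 m e]

/-- A centre opposed to the external field exposes the ring to a field of smaller modulus, hence to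
a strictly smaller leading eigenvalue. -/
lemma expSmall_centreProb (hK : 0 ≤ K) (hβ : 0 < β) {h : ℝ} {e : ℤˣ} (he : sgn e * h < 0) :
    ExpSmall fun m => centreProb K β h m e := by
  set c := Real.exp (-4 * K) with hcdef
  have hlt : eig c (2 * β * sgn e + h) < eig c (2 * β * sgn (-e) + h) := by
    apply eig_lt_eig (Real.exp_pos _)
    -- The squares of the two fields differ by `8β · sgn e · h < 0`.
    rw [← sq_lt_sq, sgn_neg]
    nlinarith
  have hpos := eig_pos (c := c) (2 * β * sgn e + h)
  have hpos' := eig_pos (c := c) (2 * β * sgn (-e) + h)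
  refine ((expSmall_pow (div_pos hpos hpos') ((div_lt_one hpos').2 hlt)).const_mul 2).of_le
    (fun m => (centreProb_pos ..).le) ?_
  filter_upwards [eventually_ne_atTop 0] with m hm
  refine le_trans ?_ (ringPF_div_le hK hm _ _)
  have hF := ringPF_pos K m (2 * β * sgn (-e) + h)
  have hF' := ringPF_pos K m (2 * β * sgn e + h)
  rw [centreProb, sum_spin' _ e]
  rw [div_le_div_iff₀ (add_pos (centre_term_pos ..) (centre_term_pos ..)) hF]
  have hexp : Real.exp (h * sgn e) ≤ Real.exp (h * sgn (-e)) := by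
    rw [Real.exp_le_exp, sgn_neg]
    nlinarith
  have := mul_le_mul_of_nonneg_right hexp (mul_pos hF' hF).le
  have := mul_pos (mul_pos (Real.exp_pos (h * sgn e)) hF') hF'
  nlinarith

lemma ringPF_ratio_expSmall (hK : 0 ≤ K) {H τ κ : ℝ}
    (hneg : κ + Real.log (eig (Real.exp (-4 * K)) (H + τ)) -
      Real.log (eig (Real.exp (-4 * K)) H) < 0) :
    ExpSmall fun m : ℕ => Real.exp (m * κ) * (ringPF K m (H + τ) / ringPF K m H) := by
  have hpos := eig_pos (c := Real.exp (-4 * K)) H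
  have hpos' := eig_pos (c := Real.exp (-4 * K)) (H + τ)
  have hr : Real.exp κ * (eig (Real.exp (-4 * K)) (H + τ) / eig (Real.exp (-4 * K)) H) < 1 := by
    rw [← Real.log_neg_iff (by positivity), Real.log_mul (Real.exp_pos _).ne' (by positivity),
      Real.log_exp, Real.log_div hpos'.ne' hpos.ne']
    linarith
  refine ((expSmall_pow (by positivity) hr).const_mul 2).of_le (fun m => ?_) ?_
  · exact mul_nonneg (Real.exp_pos _).le (div_pos (ringPF_pos ..) (ringPF_pos ..)).le
  · filter_upwards [eventually_ne_atTop 0] with m hm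
    rw [Real.exp_nat_mul, mul_pow, mul_left_comm]
    exact mul_le_mul_of_nonneg_left (ringPF_div_le hK hm _ _) (by positivity)

lemma spinSum_cons {m : ℕ} (e : ℤˣ) (y : Spins m) :
    spinSum (Fin.cons e y : Spins (m + 1)) = sgn e + spinSum y := by
  simp [spinSum, Fin.sum_univ_succ, toVec, sgn]

/-- The moment grows at most like `exp (m r)`, where `r` is the left side of `hneg`. The centre,
which turns `m` into `m + 1`, contributes only the constant factor `exp (κ + τ (sgn e - S))`. -/
lemma expSmall_ringExp_exp (hK : 0 ≤ K) {H τ κ S : ℝ} (e : ℤˣ)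
    (hneg : κ - τ * S + Real.log (eig (Real.exp (-4 * K)) (H + τ)) -
      Real.log (eig (Real.exp (-4 * K)) H) < 0) :
    ExpSmall fun m : ℕ => ringExp K H m fun y =>
      Real.exp (κ * (m + 1 : ℕ) + τ * (spinSum (Fin.cons e y : Spins (m + 1)) -
        (m + 1 : ℕ) * S)) := by
  have h := (ringPF_ratio_expSmall hK hneg).const_mul (Real.exp (κ + τ * (sgn e - S)))
  convert h using 2 with m
  rw [← ringExp_exp, ← mul_assoc, ← ringExp_const_mul]
  congr 1
  funext y
  rw [← Real.exp_add, ← Real.exp_add, spinSum_cons]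
  congr 1
  push_cast
  ring

end

end Sentiment

namespace Sentiment

noncomputable section

/-! ### The channel -/

lemma sum_prod_spins {R : Type*} [CommSemiring R] {n : ℕ} (g : Fin n → ℤˣ → R) :
    ∑ y : Spins n, ∏ i, g i (y i) = ∏ i, ∑ a, g i a := by
  rw [Finset.prod_univ_sum, Fintype.piFinset_univ]

/-- The error probability given `X = x`. -/
def errGiven {n : ℕ} (p S : ℝ) (x : Spins n) : ℝ :=
  ∑ y : Spins n, channel p x y *
    (if SignType.sign (avg x - S) ≠ SignType.sign (avg y - (1 - 2 * p) * S) then 1 else 0)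

lemma errorProb_eq_expect {n : ℕ} (G : SimpleGraph (Fin n)) (β h p S : ℝ) :
    errorProb G β h p S = expect G β h (errGiven p S) := by
  simp only [errorProb, expect, errGiven, Finset.mul_sum, mul_assoc]

variable {n : ℕ} {p : ℝ}

lemma channel_nonneg (hp : 0 ≤ p) (hp1 : p ≤ 1) (x y : Spins n) : 0 ≤ channel p x y :=
  Finset.prod_nonneg fun i _ => by split_ifs <;> linarith

lemma sum_channel (p : ℝ) (x : Spins n) : ∑ y, channel p x y = 1 := by
  have h := sum_prod_spins (fun i a => if a = x i then 1 - p else p)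
  simp only [channel]
  rw [h]
  refine Finset.prod_eq_one fun i _ => ?_
  rw [sum_spin' _ (x i), if_pos rfl, if_neg (by simp)]
  ring

lemma errGiven_nonneg (hp : 0 ≤ p) (hp1 : p ≤ 1) (S : ℝ) (x : Spins n) : 0 ≤ errGiven p S x :=
  Finset.sum_nonneg fun y _ => mul_nonneg (channel_nonneg hp hp1 x y) (by split_ifs <;> norm_num)

lemma errGiven_le_one (hp : 0 ≤ p) (hp1 : p ≤ 1) (S : ℝ) (x : Spins n) : errGiven p S x ≤ 1 := by
  rw [← sum_channel p x]
  refine Finset.sum_le_sum fun y _ => ?_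
  have := channel_nonneg hp hp1 x y
  split_ifs <;> simp [this]

/-- The centred output takes the values `2ps` and `-2(1-p)s`. In `exp u ≤ 1 + u + u²`, valid for
`|u| ≤ 1` and hence for `|t| ≤ 1/2`, the linear terms cancel and the quadratic ones sum to
`4t²p(1-p) ≤ 4t²`. -/
lemma site_mgf_le (hp : 0 ≤ p) (hp1 : p ≤ 1) {t : ℝ} (ht : |t| ≤ 1 / 2) (e : ℤˣ) :
    ∑ a, (if a = e then 1 - p else p) * Real.exp (t * sgn a) ≤
      Real.exp (4 * t ^ 2 + t * ((1 - 2 * p) * sgn e)) := by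
  rw [sum_spin' _ e, if_pos rfl, if_neg (by revert e; decide), sgn_neg]
  have hs : |sgn e| = 1 := by rcases sgn_eq e with h | h <;> simp [h]
  have hs2 : sgn e ^ 2 = 1 := by rw [← sq_abs, hs, one_pow]
  generalize sgn e = s at *
  have hp2 : |p| ≤ 1 := by rw [abs_of_nonneg hp]; exact hp1
  have hq2 : |1 - p| ≤ 1 := by rw [abs_of_nonneg (by linarith)]; linarith
  have e1 : |2 * t * s * p| ≤ 1 := by
    rw [abs_mul, abs_mul, abs_mul, hs, abs_two]
    nlinarith [abs_nonneg t, abs_nonneg p]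
  have e2 : |-(2 * t * s * (1 - p))| ≤ 1 := by
    rw [abs_neg, abs_mul, abs_mul, abs_mul, hs, abs_two]
    nlinarith [abs_nonneg t, abs_nonneg (1 - p)]
  have b1 := (abs_le.1 (Real.abs_exp_sub_one_sub_id_le e1)).2
  have b2 := (abs_le.1 (Real.abs_exp_sub_one_sub_id_le e2)).2
  have h3 : (1 - p) * Real.exp (2 * t * s * p) + p * Real.exp (-(2 * t * s * (1 - p))) ≤
      Real.exp (4 * t ^ 2) := by
    refine le_trans ?_ (Real.add_one_le_exp _)
    have m1 := mul_le_mul_of_nonneg_left b1 (by linarith : 0 ≤ 1 - p)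
    have m2 := mul_le_mul_of_nonneg_left b2 hp
    have hpp : 0 ≤ p * (1 - p) := mul_nonneg hp (by linarith)
    have hpq : p * (1 - p) ≤ 1 := by nlinarith
    have : (1 - p) * (2 * t * s * p) ^ 2 + p * (-(2 * t * s * (1 - p))) ^ 2 =
        4 * t ^ 2 * (p * (1 - p)) := by
      linear_combination 4 * t ^ 2 * (p * (1 - p)) * hs2
    nlinarith [mul_le_mul_of_nonneg_left hpq (by positivity : 0 ≤ 4 * t ^ 2)]
  have h4 := mul_le_mul_of_nonneg_right h3 (Real.exp_pos (t * ((1 - 2 * p) * s))).le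
  rw [← Real.exp_add] at h4
  refine le_trans (le_of_eq ?_) h4
  have q1 : t * s = 2 * t * s * p + t * ((1 - 2 * p) * s) := by ring
  have q2 : t * -s = -(2 * t * s * (1 - p)) + t * ((1 - 2 * p) * s) := by ring
  rw [q2, q1, Real.exp_add, Real.exp_add]
  ring

lemma sum_channel_exp_le (hp : 0 ≤ p) (hp1 : p ≤ 1) {t : ℝ} (ht : |t| ≤ 1 / 2) (x : Spins n) :
    ∑ y, channel p x y * Real.exp (t * spinSum y) ≤
      Real.exp (4 * t ^ 2 * n + t * ((1 - 2 * p) * spinSum x)) := by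
  have h : ∀ y : Spins n, channel p x y * Real.exp (t * spinSum y) =
      ∏ i, (if y i = x i then 1 - p else p) * Real.exp (t * sgn (y i)) := by
    intro y
    rw [Finset.prod_mul_distrib, ← Real.exp_sum, ← Finset.mul_sum]
    rfl
  simp_rw [h]
  rw [sum_prod_spins (fun i a => (if a = x i then 1 - p else p) * Real.exp (t * sgn a))]
  calc _ ≤ ∏ i, Real.exp (4 * t ^ 2 + t * ((1 - 2 * p) * sgn (x i))) :=
        Finset.prod_le_prod (fun i _ => Finset.sum_nonneg fun a _ =>
          mul_nonneg (by split_ifs <;> linarith) (Real.exp_pos _).le)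
          fun i _ => site_mgf_le hp hp1 ht _
    _ = _ := by
      rw [← Real.exp_sum, Finset.sum_add_distrib, ← Finset.mul_sum _ _ t,
        ← Finset.mul_sum _ _ (1 - 2 * p), show ∑ i, sgn (x i) = spinSum x from rfl,
        Finset.sum_const, Finset.card_univ,
        Fintype.card_fin, nsmul_eq_mul, mul_comm (n : ℝ)]

/-- If both exponentials are below `1`, then `u` and `v` both have the strict sign opposite to that
of `t`, so they do not disagree. Ties at `0` are covered as well. -/
lemma sign_ne_le {t u v : ℝ} (ht : t ≠ 0) :
    (if SignType.sign u ≠ SignType.sign v then (1 : ℝ) else 0) ≤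
      Real.exp (t * u) + Real.exp (t * v) := by
  have hu := Real.exp_pos (t * u)
  have hv := Real.exp_pos (t * v)
  split_ifs with h
  · by_contra! hlt
    have h1 : t * u < 0 := by
      by_contra! h0
      linarith [Real.one_le_exp h0]
    have h2 : t * v < 0 := by
      by_contra! h0
      linarith [Real.one_le_exp h0]
    apply h
    rcases lt_or_gt_of_ne ht with ht | ht
    · rw [sign_pos (pos_of_mul_neg_right h1 ht.le), sign_pos (pos_of_mul_neg_right h2 ht.le)]
    · rw [sign_neg (neg_of_mul_neg_right h1 ht.le), sign_neg (neg_of_mul_neg_right h2 ht.le)]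
  · positivity

lemma avg_eq {n : ℕ} (x : Spins n) : avg x = spinSum x / n := rfl

lemma natCast_mul_avg_sub {n : ℕ} (hn : n ≠ 0) (x : Spins n) (S : ℝ) :
    n * (avg x - S) = spinSum x - n * S := by
  have : (n : ℝ) ≠ 0 := Nat.cast_ne_zero.2 hn
  rw [avg_eq]
  field_simp

/-- The disagreement bound is averaged over the channel: this replaces the sum of `Y` by `1 - 2p`
times the sum of `X`, at the second-order cost `4 t² n`. -/
lemma errGiven_le (hp : 0 ≤ p) (hp1 : p ≤ 1) {t : ℝ} (ht0 : t ≠ 0) (ht : |t| ≤ 1 / 2)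
    (hn : n ≠ 0) (S : ℝ) (x : Spins n) :
    errGiven p S x ≤ Real.exp (t * (spinSum x - n * S)) +
      Real.exp (4 * t ^ 2 * n + t * (1 - 2 * p) * (spinSum x - n * S)) := by
  have hn0 : (n : ℝ) ≠ 0 := Nat.cast_ne_zero.2 hn
  calc errGiven p S x ≤ ∑ y : Spins n, channel p x y * (Real.exp (t * (spinSum x - n * S)) +
        Real.exp (t * (spinSum y - n * ((1 - 2 * p) * S)))) := by
        refine Finset.sum_le_sum fun y _ => mul_le_mul_of_nonneg_left ?_ (channel_nonneg hp hp1 x y)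
        have h := sign_ne_le (u := avg x - S) (v := avg y - (1 - 2 * p) * S)
          (mul_ne_zero ht0 hn0)
        rwa [mul_assoc, mul_assoc, natCast_mul_avg_sub hn, natCast_mul_avg_sub hn] at h
    _ = Real.exp (t * (spinSum x - n * S)) + (∑ y : Spins n, channel p x y *
          Real.exp (t * spinSum y)) * Real.exp (-(t * (n * ((1 - 2 * p) * S)))) := by
        simp_rw [mul_add, Finset.sum_add_distrib, ← Finset.sum_mul, sum_channel, one_mul]
        rw [Finset.sum_mul]
        congr 1
        refine Finset.sum_congr rfl fun y _ => ?_
        rw [mul_assoc, ← Real.exp_add]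
        congr 2
        ring
    _ ≤ _ := by
        have h := mul_le_mul_of_nonneg_right (sum_channel_exp_le hp hp1 ht x)
          (Real.exp_pos (-(t * (n * ((1 - 2 * p) * S))))).le
        rw [← Real.exp_add] at h
        refine add_le_add_right (h.trans (le_of_eq ?_)) _
        congr 1
        ring

/-! ### Exponential decay of the conditional error probabilities -/

lemma eventually_neg_of_hasDerivAt {g : ℝ → ℝ} {d : ℝ} (hg : HasDerivAt g d 0) (h0 : g 0 = 0)
    (hd : d < 0) : ∀ᶠ t in 𝓝[>] 0, g t < 0 := by
  have h := (hasDerivAt_iff_tendsto_slope.1 hg).mono_left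
    (nhdsWithin_mono (0 : ℝ) (fun t (ht : 0 < t) => ht.ne'))
  filter_upwards [h.eventually (eventually_lt_nhds hd), self_mem_nhdsWithin] with t ht ht0
  have ht0' : 0 < t := ht0
  rw [slope_def_field, h0, sub_zero, sub_zero, div_neg_iff] at ht
  rcases ht with ht | ht
  · linarith
  · exact ht.1

/-- The exponent vanishes at `t = 0` with derivative `b d (slope - S)`; the cost `κ t²` is of second
order, so small tilts win. -/
lemma eventually_exponent_neg {c H S d : ℝ} (hc : 0 < c) (κ b : ℝ)
    (hd : b * d * (Sentiment.slope c H - S) < 0) :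
    ∀ᶠ t in 𝓝[>] (0 : ℝ), κ * t ^ 2 - b * (d * t) * S + Real.log (eig c (H + b * (d * t))) -
      Real.log (eig c H) < 0 := by
  have h1 : HasDerivAt (fun t : ℝ => H + b * (d * t)) (b * d) 0 := by
    simpa using (((hasDerivAt_id (0 : ℝ)).const_mul d).const_mul b).const_add H
  have h2 := (hasDerivAt_log_eig hc (H + b * (d * 0))).comp (0 : ℝ) h1
  have h3 : HasDerivAt (fun t : ℝ => κ * t ^ 2 - b * (d * t) * S +
      Real.log (eig c (H + b * (d * t))) - Real.log (eig c H))
      (b * d * (Sentiment.slope c H - S)) 0 := by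
    refine (((((hasDerivAt_pow 2 (0 : ℝ)).const_mul κ).fun_sub
      ((((hasDerivAt_id (0 : ℝ)).const_mul d).const_mul b).mul_const S)).fun_add h2).sub_const
      _).congr_deriv ?_
    simp
    ring
  exact eventually_neg_of_hasDerivAt h3 (by simp) hd

lemma exists_direction {a b : ℝ} (h : a ≠ b) : ∃ d : ℝ, (d = 1 ∨ d = -1) ∧ d * (a - b) < 0 := by
  rcases lt_or_gt_of_ne h with h | h
  · exact ⟨1, Or.inl rfl, by linarith⟩
  · exact ⟨-1, Or.inr rfl, by linarith⟩

lemma ringExp_nonneg (K H : ℝ) (m : ℕ) {f : Spins m → ℝ} (hf : ∀ y, 0 ≤ f y) :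
    0 ≤ ringExp K H m f := by
  rw [← ringExp_const K H m 0]
  exact ringExp_mono K H m hf

lemma expSmall_errGiven {K : ℝ} (hK : 0 ≤ K) (hp : 0 ≤ p) (hp1 : p < 1 / 2) {H S : ℝ} (e : ℤˣ)
    (hS : S ≠ slope (Real.exp (-4 * K)) H) :
    ExpSmall fun m : ℕ => ringExp K H m fun y => errGiven p S (Fin.cons e y : Spins (m + 1)) := by
  have hc := Real.exp_pos (-4 * K)
  obtain ⟨d, hd, hneg⟩ := exists_direction hS.symm
  -- The term for `X` has no quadratic cost and factor `1`; the term for `Y` has the channel cost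
  -- `4` and factor `1 - 2p`, positive because `p < 1/2`. One `t` must serve both.
  have h1 := eventually_exponent_neg hc 0 1 (by rwa [one_mul])
  have h2 := eventually_exponent_neg (d := d) hc 4 (1 - 2 * p)
    (by rw [mul_assoc]; exact mul_neg_of_pos_of_neg (by linarith) hneg)
  have h3 : ∀ᶠ t in 𝓝[>] (0 : ℝ), t < 1 / 2 :=
    nhdsWithin_le_nhds (eventually_lt_nhds (by norm_num))
  obtain ⟨t, h1, h2, h3, h4⟩ := (h1.and (h2.and (h3.and self_mem_nhdsWithin))).exists
  have h4' : 0 < t := h4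
  have hd2 : d ^ 2 = 1 := by rcases hd with rfl | rfl <;> norm_num
  have hd0 : d ≠ 0 := by rcases hd with rfl | rfl <;> norm_num
  have hd1 : |d| = 1 := by rcases hd with rfl | rfl <;> norm_num
  rw [one_mul, zero_mul] at h1
  refine ((expSmall_ringExp_exp hK e h1).add (expSmall_ringExp_exp hK e h2)).of_le
    (fun m => ringExp_nonneg _ _ _ fun y => errGiven_nonneg hp (by linarith) _ _)
    (Eventually.of_forall fun m => ?_)
  rw [← ringExp_add]
  refine ringExp_mono _ _ _ fun y => ?_
  refine (errGiven_le hp (by linarith) (mul_ne_zero hd0 h4'.ne')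
    (by rw [abs_mul, hd1, one_mul, abs_of_pos h4']; exact h3.le) m.succ_ne_zero S _).trans
    (le_of_eq ?_)
  rw [mul_pow, hd2, zero_mul, zero_add, one_mul, mul_comm (d * t) (1 - 2 * p)]

lemma expSmall_deviation {K : ℝ} (hK : 0 ≤ K) {H b : ℝ} (hb : 0 < b) (e : ℤˣ) :
    ExpSmall fun m : ℕ => ringExp K H m fun y =>
      {x : Spins (m + 1) | |avg x - slope (Real.exp (-4 * K)) H| ≤ b}ᶜ.indicator 1
        (Fin.cons e y : Spins (m + 1)) := by
  have hc := Real.exp_pos (-4 * K)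
  set μ := slope (Real.exp (-4 * K)) H with hμ
  -- The upper tail is tilted upwards at the threshold `μ + b`, the lower tail downwards at `μ - b`.
  have h1 := eventually_exponent_neg (H := H) (S := μ + b) (d := 1) hc 0 1 (by rw [← hμ]; linarith)
  have h2 := eventually_exponent_neg (H := H) (S := μ - b) (d := -1) hc 0 1
    (by rw [← hμ]; linarith)
  obtain ⟨t, h1, h2, h4⟩ := (h1.and (h2.and self_mem_nhdsWithin)).exists
  have h4' : 0 < t := h4
  simp only [one_mul, zero_mul] at h1 h2
  refine ((expSmall_ringExp_exp hK e h1).add (expSmall_ringExp_exp hK e h2)).of_le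
    (fun m => ringExp_nonneg _ _ _ fun y => Set.indicator_nonneg (fun _ _ => zero_le_one) _)
    (Eventually.of_forall fun m => ?_)
  rw [← ringExp_add]
  refine ringExp_mono _ _ _ fun y => ?_
  generalize (Fin.cons e y : Spins (m + 1)) = x
  have hn : (0 : ℝ) < (m + 1 : ℕ) := by positivity
  rw [← natCast_mul_avg_sub m.succ_ne_zero, ← natCast_mul_avg_sub m.succ_ne_zero]
  by_cases hx : |avg x - μ| ≤ b
  · rw [Set.indicator_of_notMem (by simpa using hx)]
    positivity
  · rw [Set.indicator_of_mem (by simpa using hx)]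
    push Not at hx
    have e1 := Real.exp_pos (0 * (m + 1 : ℕ) + t * ((m + 1 : ℕ) * (avg x - (μ + b))))
    have e2 := Real.exp_pos (0 * (m + 1 : ℕ) + -1 * t * ((m + 1 : ℕ) * (avg x - (μ - b))))
    rcases lt_abs.1 hx with hx | hx
    · refine le_trans ?_ (le_add_of_nonneg_right e2.le)
      refine Real.one_le_exp ?_
      have : 0 ≤ avg x - (μ + b) := by linarith
      positivity
    · refine le_trans ?_ (le_add_of_nonneg_left e1.le)
      refine Real.one_le_exp ?_
      have : 0 ≤ -(avg x - (μ - b)) := by linarith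
      have := mul_nonneg h4'.le (mul_nonneg hn.le this)
      linarith

end

end Sentiment

namespace Sentiment

noncomputable section

/-! ### The standard Gaussian measure of a double cone -/

open MeasureTheory ProbabilityTheory in
lemma gaussian_prod_apply {A : Set (ℝ × ℝ)} (hA : MeasurableSet A) :
    ((gaussianReal 0 1).prod (gaussianReal 0 1)) A =
      ∫⁻ q : ℝ × ℝ, A.indicator 1 q *
        ENNReal.ofReal ((2 * Real.pi)⁻¹ * Real.exp (-(q.1 ^ 2 + q.2 ^ 2) / 2)) := by
  have h : ∀ q : ℝ × ℝ, gaussianPDF 0 1 q.1 * gaussianPDF 0 1 q.2 =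
      ENNReal.ofReal ((2 * Real.pi)⁻¹ * Real.exp (-(q.1 ^ 2 + q.2 ^ 2) / 2)) := by
    intro q
    rw [gaussianPDF, gaussianPDF, ← ENNReal.ofReal_mul (gaussianPDFReal_nonneg _ _ _)]
    congr 1
    simp only [gaussianPDFReal, NNReal.coe_one, mul_one, sub_zero]
    rw [mul_mul_mul_comm, ← Real.exp_add, ← mul_inv, Real.mul_self_sqrt (by positivity)]
    congr 2
    ring
  rw [gaussianReal_of_var_ne_zero 0 one_ne_zero,
    prod_withDensity (measurable_gaussianPDF 0 1) (measurable_gaussianPDF 0 1),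
    withDensity_apply _ hA, ← lintegral_indicator hA]
  refine lintegral_congr fun q => ?_
  rw [← h q]
  by_cases hq : q ∈ A <;> simp [hq]

open MeasureTheory ProbabilityTheory in
lemma gaussian_prod_cone_aux {A : Set (ℝ × ℝ)} (hA : MeasurableSet A)
    (hcone : ∀ r θ : ℝ, 0 < r → ((r * Real.cos θ, r * Real.sin θ) ∈ A ↔
      (Real.cos θ, Real.sin θ) ∈ A)) :
    ((gaussianReal 0 1).prod (gaussianReal 0 1)) A =
      (∫⁻ r in Set.Ioi (0 : ℝ), ENNReal.ofReal r *
        ENNReal.ofReal ((2 * Real.pi)⁻¹ * Real.exp (-(r ^ 2) / 2))) *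
      volume ({θ : ℝ | (Real.cos θ, Real.sin θ) ∈ A} ∩ Set.Ioo (-Real.pi) Real.pi) := by
  have hΘ : MeasurableSet {θ : ℝ | (Real.cos θ, Real.sin θ) ∈ A} :=
    (Real.measurable_cos.prodMk Real.measurable_sin) hA
  have h1 : volume ({θ : ℝ | (Real.cos θ, Real.sin θ) ∈ A} ∩ Set.Ioo (-Real.pi) Real.pi) =
      ∫⁻ θ in Set.Ioo (-Real.pi) Real.pi,
        {θ : ℝ | (Real.cos θ, Real.sin θ) ∈ A}.indicator 1 θ := by
    rw [lintegral_indicator_one hΘ, Measure.restrict_apply hΘ]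
  rw [gaussian_prod_apply hA, ← lintegral_comp_polarCoord_symm, h1, ← lintegral_prod_mul
    (by fun_prop) ((measurable_one.indicator hΘ).aemeasurable), Measure.prod_restrict,
    ← Measure.volume_eq_prod]
  refine setLIntegral_congr_fun (measurableSet_Ioi.prod measurableSet_Ioo) fun q hq => ?_
  have hr : 0 < q.1 := hq.1
  have hnorm : (q.1 * Real.cos q.2) ^ 2 + (q.1 * Real.sin q.2) ^ 2 = q.1 ^ 2 := by
    linear_combination q.1 ^ 2 * Real.sin_sq_add_cos_sq q.2
  simp only [polarCoord_symm_apply, smul_eq_mul, hnorm]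
  by_cases hθ : (Real.cos q.2, Real.sin q.2) ∈ A
  · rw [Set.indicator_of_mem ((hcone _ _ hr).2 hθ), Set.indicator_of_mem (by exact hθ)]
    simp
  · rw [Set.indicator_of_notMem (fun h => hθ ((hcone _ _ hr).1 h)),
      Set.indicator_of_notMem (by exact hθ)]
    simp

open MeasureTheory ProbabilityTheory in
lemma gaussian_prod_cone {A : Set (ℝ × ℝ)} (hA : MeasurableSet A)
    (hcone : ∀ r θ : ℝ, 0 < r → ((r * Real.cos θ, r * Real.sin θ) ∈ A ↔
      (Real.cos θ, Real.sin θ) ∈ A)) :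
    ((gaussianReal 0 1).prod (gaussianReal 0 1)).real A = (2 * Real.pi)⁻¹ *
      volume.real ({θ : ℝ | (Real.cos θ, Real.sin θ) ∈ A} ∩ Set.Ioo (-Real.pi) Real.pi) := by
  -- The radial integral need not be evaluated: the cone that is the whole plane has measure `1`, so
  -- this integral is `1 / (2π)`.
  have h1 := gaussian_prod_cone_aux MeasurableSet.univ (fun r θ _ => by simp)
  have h2 := gaussian_prod_cone_aux hA hcone
  rw [measure_univ] at h1
  simp only [Set.mem_univ, Set.ofPred_true, Set.univ_inter, Real.volume_Ioo] at h1
  have h3 := congrArg ENNReal.toReal h1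
  rw [ENNReal.toReal_mul, ENNReal.toReal_ofReal (by linarith [Real.pi_pos]), ENNReal.toReal_one]
    at h3
  have hpi := Real.pi_pos
  rw [measureReal_def, h2, ENNReal.toReal_mul, measureReal_def]
  congr 1
  refine eq_inv_of_mul_eq_one_left (Eq.trans ?_ h3.symm)
  ring

lemma sign_eq_sign_iff {a b : ℝ} : SignType.sign a = SignType.sign b ↔
    (0 < a ∧ 0 < b) ∨ (a < 0 ∧ b < 0) ∨ (a = 0 ∧ b = 0) := by
  rcases lt_trichotomy a 0 with ha | rfl | ha <;> rcases lt_trichotomy b 0 with hb | rfl | hb <;>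
    simp [*, not_lt_of_gt, ne_of_lt, ne_of_gt]

/-- The points at which the signs of `u` and `c * u + w` differ. -/
def signCone (c : ℝ) : Set (ℝ × ℝ) :=
  {q | SignType.sign q.1 ≠ SignType.sign (c * q.1 + q.2)}

lemma measurableSet_signCone (c : ℝ) : MeasurableSet (signCone c) := by
  have h : signCone c = (({q : ℝ × ℝ | 0 < q.1} ∩ {q | 0 < c * q.1 + q.2}) ∪
      ({q | q.1 < 0} ∩ {q | c * q.1 + q.2 < 0}) ∪
      ({q | q.1 = 0} ∩ {q | c * q.1 + q.2 = 0}))ᶜ := by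
    ext q
    simp [signCone, sign_eq_sign_iff, and_assoc]
  rw [h]
  have hf : Measurable fun q : ℝ × ℝ => c * q.1 + q.2 := by fun_prop
  exact ((((measurableSet_lt measurable_const measurable_fst).inter
    (measurableSet_lt measurable_const hf)).union ((measurableSet_lt measurable_fst
    measurable_const).inter (measurableSet_lt hf measurable_const))).union
    ((measurableSet_eq_fun measurable_fst measurable_const).inter
    (measurableSet_eq_fun hf measurable_const))).compl

/-- On the unit circle `c cos θ + sin θ` is a positive multiple of `sin (θ + arctan c)`. The four
excluded angles are the zeros of the two linear forms. The remaining arcs have length `π/2 - arctan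
c` each. -/
lemma signCone_angle {c : ℝ} (hc : 0 ≤ c) {θ : ℝ} (hθ : θ ∈ Set.Ioo (-Real.pi) Real.pi)
    (h1 : θ ≠ Real.pi / 2) (h2 : θ ≠ -(Real.pi / 2)) (h3 : θ ≠ -Real.arctan c)
    (h4 : θ ≠ Real.pi - Real.arctan c) :
    (Real.cos θ, Real.sin θ) ∈ signCone c ↔
      θ ∈ Set.Ioo (-(Real.pi / 2)) (-Real.arctan c) ∪
        Set.Ioo (Real.pi / 2) (Real.pi - Real.arctan c) := by
  have hδ0 : 0 ≤ Real.arctan c := by simpa using Real.arctan_strictMono.monotone hc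
  have hδ1 := Real.arctan_lt_pi_div_two c
  have hcos : 0 < Real.cos (Real.arctan c) := Real.cos_arctan_pos c
  have hsum : c * Real.cos θ + Real.sin θ =
      Real.sin (θ + Real.arctan c) * (Real.cos (Real.arctan c))⁻¹ := by
    rw [Real.sin_add]
    have : Real.sin (Real.arctan c) = c * Real.cos (Real.arctan c) := by
      conv_rhs => rw [← Real.tan_arctan c, Real.arctan_tan (by linarith) hδ1]
      rw [Real.tan_mul_cos hcos.ne']
    rw [this]
    field_simp
    ring
  have hsign : SignType.sign (c * Real.cos θ + Real.sin θ) =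
      SignType.sign (Real.sin (θ + Real.arctan c)) := by
    rw [hsum, sign_mul, sign_pos (inv_pos.2 hcos), mul_one]
  have hpi := Real.pi_pos
  obtain ⟨ha, hb⟩ := hθ
  simp only [signCone, Set.mem_ofPred_eq, hsign, Set.mem_union, Set.mem_Ioo]
  generalize Real.arctan c = δ at *
  rcases lt_or_gt_of_ne h2 with g2 | g2
  · rw [sign_neg (show Real.cos θ < 0 by
      rw [← Real.cos_neg]; exact Real.cos_neg_of_pi_div_two_lt_of_lt (by linarith) (by linarith)),
      sign_neg (Real.sin_neg_of_neg_of_neg_pi_lt (by linarith) (by linarith))]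
    constructor
    · intro h; exact absurd rfl h
    · rintro (h | h) <;> linarith
  rcases lt_or_gt_of_ne h3 with g3 | g3
  · rw [sign_pos (Real.cos_pos_of_mem_Ioo ⟨g2, by linarith⟩),
      sign_neg (Real.sin_neg_of_neg_of_neg_pi_lt (by linarith) (by linarith))]
    simp [g2, g3]
  rcases lt_or_gt_of_ne h1 with g1 | g1
  · rw [sign_pos (Real.cos_pos_of_mem_Ioo ⟨g2, g1⟩),
      sign_pos (Real.sin_pos_of_pos_of_lt_pi (by linarith) (by linarith))]
    constructor
    · intro h; exact absurd rfl h
    · rintro (h | h) <;> linarith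
  have hcn : Real.cos θ < 0 := Real.cos_neg_of_pi_div_two_lt_of_lt g1 (by linarith)
  rcases lt_or_gt_of_ne h4 with g4 | g4
  · rw [sign_neg hcn, sign_pos (Real.sin_pos_of_pos_of_lt_pi (by linarith) (by linarith))]
    simp [g1, g4]
  · rw [sign_neg hcn, sign_neg (show Real.sin (θ + δ) < 0 by
      rw [← Real.sin_sub_two_pi]
      exact Real.sin_neg_of_neg_of_neg_pi_lt (by linarith) (by linarith))]
    constructor
    · intro h; exact absurd rfl h
    · rintro (h | h) <;> linarith

open MeasureTheory ProbabilityTheory in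
lemma gaussian_signCone {c : ℝ} (hc : 0 ≤ c) :
    ((gaussianReal 0 1).prod (gaussianReal 0 1)).real (signCone c) =
      1 / Real.pi * arccot c := by
  have hpi := Real.pi_pos
  have hδ0 : 0 ≤ Real.arctan c := by simpa using Real.arctan_strictMono.monotone hc
  have hδ1 := Real.arctan_lt_pi_div_two c
  rw [gaussian_prod_cone (measurableSet_signCone c)]
  · have hae : ({θ : ℝ | (Real.cos θ, Real.sin θ) ∈ signCone c} ∩ Set.Ioo (-Real.pi) Real.pi :
        Set ℝ) =ᵐ[volume] (Set.Ioo (-(Real.pi / 2)) (-Real.arctan c) ∪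
        Set.Ioo (Real.pi / 2) (Real.pi - Real.arctan c) : Set ℝ) := by
      have hfin := (Set.toFinite ({Real.pi / 2, -(Real.pi / 2), -Real.arctan c,
        Real.pi - Real.arctan c} : Set ℝ)).measure_zero volume
      filter_upwards [measure_eq_zero_iff_ae_notMem.1 hfin] with θ hθ
      simp only [Set.mem_insert_iff, Set.mem_singleton_iff, not_or] at hθ
      refine propext ⟨fun h => (signCone_angle hc h.2 hθ.1 hθ.2.1 hθ.2.2.1 hθ.2.2.2).1 h.1,
        fun h => ?_⟩
      have hm : θ ∈ Set.Ioo (-Real.pi) Real.pi := by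
        rcases h with h | h <;> exact ⟨by linarith [h.1], by linarith [h.2]⟩
      exact ⟨(signCone_angle hc hm hθ.1 hθ.2.1 hθ.2.2.1 hθ.2.2.2).2 h, hm⟩
    rw [measureReal_congr hae, measureReal_union ?_ measurableSet_Ioo (by simp) (by simp),
      Real.volume_real_Ioo_of_le,
      Real.volume_real_Ioo_of_le, arccot]
    · field_simp
      ring
    · linarith
    · linarith
    · rw [Set.disjoint_left]
      intro x hx hx'
      linarith [hx.2, hx'.1]
  · intro r θ hr
    have h : c * (r * Real.cos θ) + r * Real.sin θ = r * (c * Real.cos θ + Real.sin θ) := by ring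
    simp only [signCone, Set.mem_ofPred_eq]
    rw [h, sign_mul, sign_mul, sign_pos hr, one_mul, one_mul]

-- These two lines contain the frontier of `signCone c`, so weak convergence applies to that set.
open MeasureTheory ProbabilityTheory in
lemma gaussian_line (c : ℝ) :
    ((gaussianReal 0 1).prod (gaussianReal 0 1)) ({q | q.1 = 0} ∪ {q | c * q.1 + q.2 = 0}) = 0 := by
  have hna := nullSingletonClass_gaussianReal (μ := 0) (v := 1) one_ne_zero
  refine measure_union_null ?_ ?_
  · have : {q : ℝ × ℝ | q.1 = 0} = {0} ×ˢ Set.univ := by ext q; simp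
    rw [this, Measure.prod_prod, measure_singleton, zero_mul]
  · have hm : MeasurableSet {q : ℝ × ℝ | c * q.1 + q.2 = 0} :=
      measurableSet_eq_fun (by fun_prop) (by fun_prop)
    rw [Measure.measure_prod_null hm]
    refine Eventually.of_forall fun u => ?_
    have : Prod.mk u ⁻¹' {q : ℝ × ℝ | c * q.1 + q.2 = 0} = {-(c * u)} := by
      ext w
      simp [add_comm, eq_neg_iff_add_eq_zero]
    simp [this]

open MeasureTheory ProbabilityTheory in
/-- The two-dimensional central limit theorem for sign disagreement, from characteristic
functions. -/
lemma tendsto_sum_sign_ne {Ω : ℕ → Type*} [∀ n, Fintype (Ω n)] (w U W : ∀ n, Ω n → ℝ)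
    (hw : ∀ n ω, 0 ≤ w n ω) (hsum : ∀ n, ∑ ω, w n ω = 1)
    (hchar : ∀ s t : ℝ, Tendsto (fun n => ∑ ω, (w n ω : ℂ) *
      Complex.exp (((s * U n ω + t * W n ω : ℝ) : ℂ) * Complex.I)) atTop
      (𝓝 (Complex.exp (-((s : ℂ) ^ 2 + (t : ℂ) ^ 2) / 2)))) {c : ℝ} (hc : 0 ≤ c) :
    Tendsto (fun n => ∑ ω, w n ω *
      (if SignType.sign (U n ω) ≠ SignType.sign (c * U n ω + W n ω) then 1 else 0)) atTop
      (𝓝 (1 / Real.pi * arccot c)) := by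
  -- The finite laws become sums of Dirac masses on the Euclidean plane, where Lévy's continuity
  -- theorem applies.
  let ν : ℕ → Measure (WithLp 2 (ℝ × ℝ)) := fun n =>
    ∑ ω, ENNReal.ofReal (w n ω) • Measure.dirac (WithLp.toLp 2 (U n ω, W n ω))
  have hν : ∀ n, IsProbabilityMeasure (ν n) := fun n => ⟨by
    simp only [ν, Measure.coe_finsetSum, Finset.sum_apply, Measure.smul_apply, measure_univ,
      smul_eq_mul, mul_one]
    rw [← ENNReal.ofReal_sum_of_nonneg fun ω _ => hw n ω, hsum, ENNReal.ofReal_one]⟩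
  let γ : Measure (WithLp 2 (ℝ × ℝ)) :=
    ((gaussianReal 0 1).prod (gaussianReal 0 1)).map (WithLp.toLp 2)
  have hmeas : Measurable (WithLp.toLp 2 : ℝ × ℝ → WithLp 2 (ℝ × ℝ)) := by fun_prop
  have hmeas' : Measurable (WithLp.ofLp : WithLp 2 (ℝ × ℝ) → ℝ × ℝ) := by fun_prop
  have hγ : IsProbabilityMeasure γ := Measure.isProbabilityMeasure_map hmeas.aemeasurable
  have hlim : Tendsto (β := ProbabilityMeasure (WithLp 2 (ℝ × ℝ))) (fun n => ⟨ν n, hν n⟩) atTop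
      (𝓝 ⟨γ, hγ⟩) := by
    refine ProbabilityMeasure.tendsto_of_tendsto_charFun fun t => ?_
    have h1 : charFun γ t =
        Complex.exp (-(((WithLp.ofLp t).1 : ℂ) ^ 2 + ((WithLp.ofLp t).2 : ℂ) ^ 2) / 2) := by
      rw [charFun_prod, charFun_gaussianReal, charFun_gaussianReal, ← Complex.exp_add]
      congr 1
      simp
      ring
    have h2 : ∀ n, charFun (ν n) t = ∑ ω, (w n ω : ℂ) * Complex.exp
        ((((WithLp.ofLp t).1 * U n ω + (WithLp.ofLp t).2 * W n ω : ℝ) : ℂ) * Complex.I) := by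
      intro n
      rw [charFun_apply, integral_finsetSum_measure]
      · refine Finset.sum_congr rfl fun ω _ => ?_
        rw [integral_smul_measure, integral_dirac, ENNReal.toReal_ofReal (hw n ω)]
        simp [WithLp.prod_inner_apply]
      · intro ω _
        exact (integrable_dirac (by simp)).smul_measure ENNReal.ofReal_ne_top
    change Tendsto (fun n => charFun (ν n) t) atTop (𝓝 (charFun γ t))
    rw [h1]
    simp_rw [h2]
    exact hchar _ _
  let A : Set (WithLp 2 (ℝ × ℝ)) := WithLp.ofLp ⁻¹' signCone c
  have hA : MeasurableSet A := hmeas' (measurableSet_signCone c)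
  have hfr : γ (frontier A) = 0 := by
    have hcont : Continuous (WithLp.ofLp : WithLp 2 (ℝ × ℝ) → ℝ × ℝ) := by fun_prop
    have hcont2 : Continuous fun q : WithLp 2 (ℝ × ℝ) =>
        c * (WithLp.ofLp q).1 + (WithLp.ofLp q).2 := by fun_prop
    have hcont1 : Continuous fun q : WithLp 2 (ℝ × ℝ) => (WithLp.ofLp q).1 := by fun_prop
    have hdisc : ∀ (f : WithLp 2 (ℝ × ℝ) → SignType) q, ContinuousAt f q →
        ∀ᶠ r in 𝓝 q, f r = f q := fun f q hf =>
      hf.eventually (p := fun x => x = f q) (by rw [nhds_discrete]; exact eventually_pure.2 rfl)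
    -- Off the two lines both signs are locally constant, so such a point cannot be approached both
    -- from `A` and from its complement.
    have hsub : frontier A ⊆ WithLp.ofLp ⁻¹' ({q | q.1 = 0} ∪ {q | c * q.1 + q.2 = 0}) := by
      intro q hq
      by_contra hne
      simp only [Set.preimage_union, Set.mem_union, Set.mem_preimage, Set.mem_ofPred_eq,
        not_or] at hne
      have e1 : ∀ᶠ r in 𝓝 q, SignType.sign (WithLp.ofLp r).1 = SignType.sign (WithLp.ofLp q).1 :=
        hdisc _ _ ((continuousAt_sign_of_ne_zero hne.1).comp_of_eq hcont1.continuousAt rfl)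
      have e2 : ∀ᶠ r in 𝓝 q, SignType.sign (c * (WithLp.ofLp r).1 + (WithLp.ofLp r).2) =
          SignType.sign (c * (WithLp.ofLp q).1 + (WithLp.ofLp q).2) :=
        hdisc _ _ ((continuousAt_sign_of_ne_zero hne.2).comp_of_eq hcont2.continuousAt rfl)
      rw [frontier_eq_closure_inter_closure] at hq
      have h3 := mem_closure_iff_frequently.1 hq.1
      have h4 := mem_closure_iff_frequently.1 hq.2
      obtain ⟨r, hr, hr1, hr2⟩ := (h3.and_eventually (e1.and e2)).exists
      obtain ⟨r', hr', hr1', hr2'⟩ := (h4.and_eventually (e1.and e2)).exists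
      simp only [A, signCone, Set.mem_preimage, Set.mem_ofPred_eq, Set.mem_compl_iff, not_not]
        at hr hr'
      exact hr (by rw [hr1, hr2, ← hr1', ← hr2', hr'])
    refine measure_mono_null hsub ?_
    rw [Measure.map_apply hmeas]
    · exact gaussian_line c
    · exact hmeas' ((measurableSet_eq_fun measurable_fst measurable_const).union
        (measurableSet_eq_fun (by fun_prop) measurable_const))
  have h := ProbabilityMeasure.tendsto_measure_of_null_frontier_of_tendsto' hlim hfr
  have h' := (ENNReal.tendsto_toReal (measure_ne_top γ A)).comp h
  have hγA : (γ A).toReal = 1 / Real.pi * arccot c := by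
    rw [← gaussian_signCone hc, Measure.map_apply hmeas hA]
    rfl
  rw [← hγA]
  refine h'.congr fun n => ?_
  change (ν n A).toReal = _
  simp only [ν, Measure.coe_finsetSum, Finset.sum_apply, Measure.smul_apply, smul_eq_mul]
  rw [ENNReal.toReal_sum fun ω _ => ENNReal.mul_ne_top ENNReal.ofReal_ne_top (measure_ne_top _ _)]
  refine Finset.sum_congr rfl fun ω _ => ?_
  rw [ENNReal.toReal_mul, ENNReal.toReal_ofReal (hw n ω), Measure.dirac_apply' _ hA]
  congr 1
  by_cases hmem : SignType.sign (U n ω) ≠ SignType.sign (c * U n ω + W n ω)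
  · rw [if_pos hmem, Set.indicator_of_mem (show _ ∈ A from hmem)]
    simp
  · rw [if_neg hmem, Set.indicator_of_notMem (show _ ∉ A from hmem)]
    simp

end

end Sentiment

namespace Sentiment

noncomputable section

/-! ### Second order expansions -/

/-- The mean value inequality is applied to `f` minus its quadratic part on the ball of radius `‖z -
z₀‖`, where the derivative is at most `ε ‖z - z₀‖`. -/
lemma isLittleO_second_order {f f' : ℂ → ℂ} {z₀ d : ℂ} (hf : ∀ᶠ z in 𝓝 z₀, HasDerivAt f (f' z) z)
    (h0 : f' z₀ = 0) (hf' : HasDerivAt f' d z₀) :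
    (fun z => f z - f z₀ - d * (z - z₀) ^ 2 / 2) =o[𝓝 z₀] fun z => (z - z₀) ^ 2 := by
  rw [Asymptotics.isLittleO_iff]
  intro ε hε
  have h1 := hf'.isLittleO
  rw [Asymptotics.isLittleO_iff] at h1
  obtain ⟨r, hr, hball⟩ := Metric.eventually_nhds_iff_ball.1 (hf.and (h1 hε))
  filter_upwards [Metric.ball_mem_nhds z₀ hr] with z hz
  have hsub : Metric.closedBall z₀ ‖z - z₀‖ ⊆ Metric.ball z₀ r :=
    Metric.closedBall_subset_ball (by rwa [Metric.mem_ball, dist_eq_norm] at hz)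
  have hd : ∀ x ∈ Metric.closedBall z₀ ‖z - z₀‖,
      HasDerivWithinAt (fun z => f z - d * (z - z₀) ^ 2 / 2) (f' x - d * (x - z₀))
        (Metric.closedBall z₀ ‖z - z₀‖) x := by
    intro x hx
    have h2 := ((((hasDerivAt_id' x).sub_const z₀).fun_pow 2).const_mul d).div_const 2
    refine (((hball x (hsub hx)).1.fun_sub h2).congr_deriv ?_).hasDerivWithinAt
    simp
    ring
  have hb : ∀ x ∈ Metric.closedBall z₀ ‖z - z₀‖, ‖f' x - d * (x - z₀)‖ ≤ ε * ‖z - z₀‖ := by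
    intro x hx
    have h3 := (hball x (hsub hx)).2
    rw [h0, sub_zero, smul_eq_mul, mul_comm] at h3
    refine h3.trans (mul_le_mul_of_nonneg_left ?_ hε.le)
    rwa [Metric.mem_closedBall, dist_eq_norm] at hx
  have h4 := (convex_closedBall z₀ ‖z - z₀‖).norm_image_sub_le_of_norm_hasDerivWithin_le hd hb
    (Metric.mem_closedBall_self (norm_nonneg _))
    (Metric.mem_closedBall.2 (by rw [dist_eq_norm]) : z ∈ Metric.closedBall z₀ ‖z - z₀‖)
  rw [norm_pow, sq ‖z - z₀‖, ← mul_assoc]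
  refine le_trans (le_of_eq ?_) h4
  congr 1
  ring

lemma tendsto_mul_sub_second_order {f f' : ℂ → ℂ} {z₀ d : ℂ}
    (hf : ∀ᶠ z in 𝓝 z₀, HasDerivAt f (f' z) z) (h0 : f' z₀ = 0) (hf' : HasDerivAt f' d z₀)
    {w N : ℕ → ℂ} {ω : ℂ} (hw : Tendsto w atTop (𝓝 0))
    (hN : Tendsto (fun n => N n * w n ^ 2) atTop (𝓝 ω)) :
    Tendsto (fun n => N n * (f (z₀ + w n) - f z₀)) atTop (𝓝 (d * ω / 2)) := by
  have hz : Tendsto (fun n => z₀ + w n) atTop (𝓝 z₀) := by simpa using hw.const_add z₀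
  have h1 := (isLittleO_second_order hf h0 hf').comp_tendsto hz
  have h2 := (Asymptotics.isBigO_refl N atTop).mul_isLittleO h1
  have h3 : (fun n => N n * w n ^ 2) =O[atTop] fun _ => (1 : ℂ) := hN.isBigO_one ℂ
  have h4 : Tendsto (fun n => N n * (f (z₀ + w n) - f z₀ - d * (w n) ^ 2 / 2)) atTop (𝓝 0) := by
    rw [← Asymptotics.isLittleO_one_iff ℂ]
    have h4 := h2.congr_right (g₂ := fun n => N n * w n ^ 2) (fun n => by simp)
    simpa [Function.comp_def] using h4.trans_isBigO h3
  have h5 := h4.add ((hN.const_mul d).div_const 2)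
  rw [zero_add] at h5
  refine h5.congr fun n => ?_
  ring

/-! ### The ring with a complex field -/

/-- The analytic continuation of `disc` to a neighbourhood of the real line. -/
def cdisc (c : ℝ) (z : ℂ) : ℂ := Complex.exp (Complex.log (Complex.sinh z ^ 2 + c) / 2)

variable {c : ℝ}

lemma cdisc_sq {z : ℂ} (hz : Complex.sinh z ^ 2 + c ∈ Complex.slitPlane) :
    cdisc c z ^ 2 = Complex.sinh z ^ 2 + c := by
  rw [cdisc, ← Complex.exp_nat_mul, Nat.cast_ofNat, mul_div_cancel₀ _ two_ne_zero,
    Complex.exp_log (Complex.slitPlane_ne_zero hz)]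

lemma cdisc_ofReal (hc : 0 < c) (H : ℝ) : cdisc c H = disc c H := by
  have hpos : 0 < Real.sinh H ^ 2 + c := by positivity
  rw [cdisc, disc, ← Complex.ofReal_sinh, ← Complex.ofReal_pow, ← Complex.ofReal_add,
    ← Complex.ofReal_log hpos.le, ← Complex.ofReal_ofNat, ← Complex.ofReal_div,
    ← Complex.ofReal_exp, ← Real.log_sqrt hpos.le, Real.exp_log (Real.sqrt_pos.2 hpos)]

lemma cdisc_ne_zero (z : ℂ) : cdisc c z ≠ 0 := Complex.exp_ne_zero _

lemma hasDerivAt_cdisc {z : ℂ} (hz : Complex.sinh z ^ 2 + c ∈ Complex.slitPlane) :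
    HasDerivAt (cdisc c) (Complex.sinh z * Complex.cosh z / cdisc c z) z := by
  have h := ((((Complex.hasDerivAt_sinh z).fun_pow 2).add_const (c : ℂ)).clog hz).div_const 2
  refine HasDerivAt.congr_deriv (f := cdisc c) h.cexp ?_
  rw [← cdisc]
  have h0 := cdisc_ne_zero (c := c) z
  rw [← cdisc_sq hz]
  field_simp
  simp
  ring

lemma eventually_slitPlane (hc : 0 < c) (H : ℝ) :
    ∀ᶠ z in 𝓝 (H : ℂ), Complex.sinh z ^ 2 + c ∈ Complex.slitPlane := by
  have hcont : ContinuousAt (fun z : ℂ => Complex.sinh z ^ 2 + c) (H : ℂ) := by fun_prop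
  refine hcont.eventually (Complex.isOpen_slitPlane.mem_nhds ?_)
  beta_reduce
  rw [← Complex.ofReal_sinh, ← Complex.ofReal_pow, ← Complex.ofReal_add,
    Complex.ofReal_mem_slitPlane]
  positivity

/-- The analytic continuation of `eig`. -/
def ceig (c : ℝ) (z : ℂ) : ℂ := Complex.cosh z + cdisc c z

lemma ceig_ofReal (hc : 0 < c) (H : ℝ) : ceig c H = eig c H := by
  simp [ceig, eig, cdisc_ofReal hc]

lemma hasDerivAt_ceig {z : ℂ} (hz : Complex.sinh z ^ 2 + c ∈ Complex.slitPlane) :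
    HasDerivAt (ceig c) (Complex.sinh z / cdisc c z * ceig c z) z := by
  refine HasDerivAt.congr_deriv (f := ceig c)
    ((Complex.hasDerivAt_cosh z).fun_add (hasDerivAt_cdisc hz)) ?_
  have h0 := cdisc_ne_zero (c := c) z
  rw [ceig]
  field_simp
  ring

lemma hasDerivAt_cslope {z : ℂ} (hz : Complex.sinh z ^ 2 + c ∈ Complex.slitPlane) :
    HasDerivAt (fun z => Complex.sinh z / cdisc c z) (c * Complex.cosh z / cdisc c z ^ 3) z := by
  have h0 := cdisc_ne_zero (c := c) z
  refine ((Complex.hasDerivAt_sinh z).fun_div (hasDerivAt_cdisc hz) h0).congr_deriv ?_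
  field_simp
  rw [cdisc_sq hz]
  ring

/-- The normalised function `f z = ceig z · exp (-slope (z - H)) / eig H` has `f H = 1`, `f' H = 0`
and `f'' H = curv`, so `f (H + w n) = 1 + (curv · ω / 2 + o(1)) / n`. -/
lemma tendsto_ceig_pow (hc : 0 < c) (H : ℝ) {w : ℕ → ℂ} {ω : ℂ} (hw : Tendsto w atTop (𝓝 0))
    (hN : Tendsto (fun n : ℕ => n * w n ^ 2) atTop (𝓝 ω)) :
    Tendsto (fun n : ℕ => (ceig c (H + w n) * Complex.exp (-slope c H * w n) / eig c H) ^ n) atTop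
      (𝓝 (Complex.exp (curv c H * ω / 2))) := by
  have he : (eig c H : ℂ) ≠ 0 := Complex.ofReal_ne_zero.2 (eig_pos H).ne'
  have hslope : Complex.sinh H / cdisc c H = slope c H := by
    rw [cdisc_ofReal hc, slope]
    push_cast
    rfl
  let f : ℂ → ℂ := fun z => ceig c z * Complex.exp (-slope c H * (z - H)) / eig c H
  have hf0 : f H = 1 := by simp [f, ceig_ofReal hc, he]
  have hf : ∀ᶠ z in 𝓝 (H : ℂ),
      HasDerivAt f ((Complex.sinh z / cdisc c z - slope c H) * f z) z := by
    filter_upwards [eventually_slitPlane hc H] with z hz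
    have h1 := (((hasDerivAt_id' z).sub_const (H : ℂ)).const_mul (-slope c H : ℂ)).cexp
    refine (((hasDerivAt_ceig hz).fun_mul h1).div_const (eig c H : ℂ)).congr_deriv ?_
    simp only [f]
    field_simp
    ring
  have hH := (eventually_slitPlane hc H).self_of_nhds
  have hf' : HasDerivAt (fun z => (Complex.sinh z / cdisc c z - slope c H) * f z) (curv c H) H := by
    refine (((hasDerivAt_cslope hH).sub_const (slope c H : ℂ)).fun_mul
      hf.self_of_nhds).congr_deriv ?_
    rw [hslope, hf0, sub_self, cdisc_ofReal hc, curv]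
    simp
  have h := tendsto_mul_sub_second_order hf (by simp [hslope]) hf' hw hN
  refine (Complex.tendsto_one_add_pow_exp_of_tendsto h).congr fun n => ?_
  rw [hf0]
  simp [f]

lemma tendsto_cratio_pow (hc : 0 < c) (hc1 : c ≤ 1) (H : ℝ) {w : ℕ → ℂ}
    (hw : Tendsto w atTop (𝓝 0)) :
    Tendsto (fun n : ℕ => ((Complex.cosh (H + w n) - cdisc c (H + w n)) / ceig c (H + w n)) ^ n)
      atTop (𝓝 0) := by
  have hH := (eventually_slitPlane hc H).self_of_nhds
  have he : ceig c H ≠ 0 := by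
    rw [ceig_ofReal hc]
    exact Complex.ofReal_ne_zero.2 (eig_pos H).ne'
  have hcont : ContinuousAt (fun z => (Complex.cosh z - cdisc c z) / ceig c z) (H : ℂ) :=
    ((Complex.hasDerivAt_cosh _).continuousAt.sub (hasDerivAt_cdisc hH).continuousAt).div
      (hasDerivAt_ceig hH).continuousAt he
  have hval : (Complex.cosh H - cdisc c H) / ceig c H = (ratio c H : ℂ) := by
    rw [ceig_ofReal hc, cdisc_ofReal hc, ratio]
    push_cast
    rfl
  have hz : Tendsto (fun n => (H : ℂ) + w n) atTop (𝓝 (H : ℂ)) := by simpa using hw.const_add _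
  have h1 := (hcont.tendsto.comp hz).norm
  rw [hval, Complex.norm_real, Real.norm_of_nonneg (ratio_nonneg hc1 H)] at h1
  obtain ⟨q, hq1, hq2⟩ := exists_between (ratio_lt_one hc H)
  have hq0 : 0 ≤ q := (ratio_nonneg hc1 H).trans hq1.le
  refine squeeze_zero_norm' ?_ (tendsto_pow_atTop_nhds_zero_of_lt_one hq0 hq2)
  filter_upwards [h1.eventually (eventually_lt_nhds hq1)] with n hn
  rw [norm_pow]
  exact pow_le_pow_left₀ (norm_nonneg _) hn.le n

/-- The second eigenvalue enters only through `1 + ratio ^ n`, which tends to `1` for the complex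
and the real field. For imaginary `w` this is the central limit theorem of the ring. -/
lemma tendsto_ringPFC {K : ℝ} (hK : 0 ≤ K) (H : ℝ) {w : ℕ → ℂ} {ω : ℂ}
    (hw : Tendsto w atTop (𝓝 0)) (hN : Tendsto (fun n : ℕ => n * w n ^ 2) atTop (𝓝 ω)) :
    Tendsto (fun n : ℕ => ringPFC K n (H + w n) / ringPF K n H *
      Complex.exp (-slope (Real.exp (-4 * K)) H * w n * n)) atTop
      (𝓝 (Complex.exp (curv (Real.exp (-4 * K)) H * ω / 2))) := by
  have hc := Real.exp_pos (-4 * K)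
  have hc1 := exp_neg_four_mul_le_one hK
  have hcast : ((Real.exp (-4 * K) : ℝ) : ℂ) = Complex.exp (-4 * K) := by push_cast; rfl
  set c := Real.exp (-4 * K) with hcdef
  have h1 := tendsto_ceig_pow hc H hw hN
  have h2 := tendsto_cratio_pow hc hc1 H hw
  have h3 := (Complex.continuous_ofReal.tendsto _).comp (tendsto_ratio_pow hc hc1 H)
  have h4 := h1.mul ((h2.const_add 1).div (h3.const_add 1) (by simp))
  simp only [Complex.ofReal_zero, add_zero, div_one, mul_one] at h4
  have hz : Tendsto (fun n => (H : ℂ) + w n) atTop (𝓝 (H : ℂ)) := by simpa using hw.const_add _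
  have he : ceig c H ≠ 0 := by
    rw [ceig_ofReal hc]
    exact Complex.ofReal_ne_zero.2 (eig_pos H).ne'
  have hne := ((hasDerivAt_ceig (eventually_slitPlane hc H).self_of_nhds).continuousAt.tendsto.comp
    hz).eventually_ne he
  refine h4.congr' ?_
  filter_upwards [hz.eventually (eventually_slitPlane hc H), hne, eventually_ne_atTop 0]
    with n hn1 hn2 hn0
  simp only [Function.comp_apply] at hn2
  have hr : (1 : ℂ) + (ratio c H : ℂ) ^ n ≠ 0 := by
    have := (one_add_ratio_pow_pos hc1 n H).ne'
    exact_mod_cast this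
  have heig : (eig c H : ℂ) ≠ 0 := Complex.ofReal_ne_zero.2 (eig_pos H).ne'
  have hexpK : Complex.exp (K : ℂ) ≠ 0 := Complex.exp_ne_zero _
  rw [ringPFC_eq K hn0 _ (cdisc c (H + w n)) (by rw [cdisc_sq hn1, hcast]), ringPF_eq K hn0,
    ← hcdef, ← ceig]
  rw [mul_comm (-(slope c H : ℂ) * w n) (n : ℂ), Complex.exp_nat_mul]
  simp only [Function.comp_apply, Pi.div_apply]
  push_cast
  simp only [div_pow, mul_pow]
  field_simp

end

end Sentiment

namespace Sentiment

noncomputable section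

/-! ### Characteristic functions of the channel -/

/-- The characteristic function of the centred channel output at one site, with input `e`. -/
def siteChar (p : ℝ) (e : ℤˣ) (z : ℂ) : ℂ :=
  ∑ a, ((if a = e then 1 - p else p : ℝ) : ℂ) *
    Complex.exp (z * (((sgn a - (1 - 2 * p) * sgn e : ℝ) : ℂ) * Complex.I))

variable {p : ℝ}

lemma hasDerivAt_sum_cexp (q b : ℤˣ → ℂ) (z : ℂ) :
    HasDerivAt (fun z => ∑ a, q a * Complex.exp (z * b a))
      (∑ a, (q a * b a) * Complex.exp (z * b a)) z := by
  refine HasDerivAt.fun_sum fun a _ => ?_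
  refine ((((hasDerivAt_id' z).mul_const (b a)).cexp).const_mul (q a)).congr_deriv ?_
  ring

lemma siteChar_zero (p : ℝ) (e : ℤˣ) : siteChar p e 0 = 1 := by
  rw [siteChar, sum_spin' _ e]
  simp

lemma sgn_sq (e : ℤˣ) : sgn e ^ 2 = 1 := by
  rcases sgn_eq e with h | h <;> simp [h]

/-- Centring kills the first derivative at `0`; the second is minus the variance `4p(1-p)`, which
does not depend on the input `e` because `sgn e ^ 2 = 1`. -/
lemma tendsto_siteChar (p : ℝ) (e : ℤˣ) {w N : ℕ → ℂ} {ω : ℂ} (hw : Tendsto w atTop (𝓝 0))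
    (hN : Tendsto (fun n => N n * w n ^ 2) atTop (𝓝 ω)) :
    Tendsto (fun n => N n * (siteChar p e (w n) - 1)) atTop
      (𝓝 (-(4 * p * (1 - p) : ℝ) * ω / 2)) := by
  have hs : (sgn e : ℂ) ^ 2 = 1 := by exact_mod_cast sgn_sq e
  have h := tendsto_mul_sub_second_order (z₀ := 0)
    (Eventually.of_forall (hasDerivAt_sum_cexp
      (fun a => ((if a = e then 1 - p else p : ℝ) : ℂ))
      (fun a => ((sgn a - (1 - 2 * p) * sgn e : ℝ) : ℂ) * Complex.I)))
    (by
      rw [sum_spin' _ e]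
      simp
      ring)
    ((hasDerivAt_sum_cexp _ _ 0).congr_deriv (g' := -((4 * p * (1 - p) : ℝ) : ℂ)) (by
      rw [sum_spin' _ e]
      simp
      linear_combination (4 * (p : ℂ) * (1 - p) * Complex.I ^ 2) * hs +
        4 * (p : ℂ) * (1 - p) * Complex.I_sq)) hw hN
  refine h.congr fun n => ?_
  have h0 := siteChar_zero p e
  simp only [siteChar] at h0 ⊢
  rw [h0, zero_add]

lemma norm_siteChar_le (hp : 0 ≤ p) (hp1 : p ≤ 1) (e : ℤˣ) (t : ℝ) :
    ‖siteChar p e t‖ ≤ 1 := by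
  have h : ∀ a, ‖((if a = e then 1 - p else p : ℝ) : ℂ) *
      Complex.exp (t * (((sgn a - (1 - 2 * p) * sgn e : ℝ) : ℂ) * Complex.I))‖ =
      if a = e then 1 - p else p := by
    intro a
    rw [norm_mul, ← mul_assoc, ← Complex.ofReal_mul, Complex.norm_exp_ofReal_mul_I, mul_one,
      Complex.norm_real, Real.norm_of_nonneg]
    split_ifs <;> linarith
  refine (norm_sum_le _ _).trans ?_
  simp_rw [h]
  rw [sum_spin' _ e]
  simp

lemma sum_channel_cexp {n : ℕ} (p : ℝ) (x : Spins n) (t : ℝ) :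
    ∑ y, (channel p x y : ℂ) *
      Complex.exp (((t * (spinSum y - (1 - 2 * p) * spinSum x) : ℝ) : ℂ) * Complex.I) =
      ∏ i, siteChar p (x i) t := by
  have h : ∀ y : Spins n, (channel p x y : ℂ) *
      Complex.exp (((t * (spinSum y - (1 - 2 * p) * spinSum x) : ℝ) : ℂ) * Complex.I) =
      ∏ i, ((if y i = x i then 1 - p else p : ℝ) : ℂ) *
        Complex.exp (t * (((sgn (y i) - (1 - 2 * p) * sgn (x i) : ℝ) : ℂ) * Complex.I)) := by
    intro y
    rw [Finset.prod_mul_distrib, ← Complex.exp_sum, channel, Complex.ofReal_prod]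
    congr 2
    rw [← Finset.mul_sum, ← Finset.sum_mul, ← Complex.ofReal_sum, Finset.sum_sub_distrib,
      ← Finset.mul_sum, Complex.ofReal_mul, mul_assoc]
    rfl
  simp_rw [h]
  exact sum_prod_spins (fun i a => ((if a = x i then 1 - p else p : ℝ) : ℂ) *
    Complex.exp (t * (((sgn a - (1 - 2 * p) * sgn (x i) : ℝ) : ℂ) * Complex.I)))

lemma norm_prod_sub_prod_le {ι : Type*} (s : Finset ι) (f g : ι → ℂ) (hf : ∀ i, ‖f i‖ ≤ 1)
    (hg : ∀ i, ‖g i‖ ≤ 1) : ‖∏ i ∈ s, f i - ∏ i ∈ s, g i‖ ≤ ∑ i ∈ s, ‖f i - g i‖ := by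
  classical
  induction s using Finset.induction_on with
  | empty => simp
  | insert a s ha ih =>
    rw [Finset.prod_insert ha, Finset.prod_insert ha, Finset.sum_insert ha]
    have h1 : ‖∏ i ∈ s, f i‖ ≤ 1 := by
      rw [norm_prod]
      exact Finset.prod_le_one (fun _ _ => norm_nonneg _) fun i _ => hf i
    calc _ = ‖(f a - g a) * ∏ i ∈ s, f i + g a * (∏ i ∈ s, f i - ∏ i ∈ s, g i)‖ := by
          congr 1; ring
      _ ≤ ‖f a - g a‖ * ‖∏ i ∈ s, f i‖ + ‖g a‖ * ‖∏ i ∈ s, f i - ∏ i ∈ s, g i‖ := by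
          refine (norm_add_le _ _).trans ?_
          rw [norm_mul, norm_mul]
      _ ≤ ‖f a - g a‖ * 1 + 1 * ∑ i ∈ s, ‖f i - g i‖ :=
          add_le_add (mul_le_mul_of_nonneg_left h1 (norm_nonneg _))
            (mul_le_mul (hg a) ih (norm_nonneg _) zero_le_one)
      _ = _ := by ring

/-- Telescoping bounds the error of the product by the sum of `n` site errors. Uniformity in `x` is
what decouples noise and magnetisation in the limit. -/
lemma exists_prod_siteChar_error (hp : 0 < p) (hp1 : p < 1) (t : ℝ) :
    ∃ ε : ℕ → ℝ, Tendsto ε atTop (𝓝 0) ∧ ∀ n, n ≠ 0 → ∀ x : Spins n,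
      ‖∏ i, siteChar p (x i) (((√n)⁻¹ * (√(4 * p * (1 - p)))⁻¹ * t : ℝ) : ℂ) -
        Complex.exp (-(t : ℂ) ^ 2 / 2)‖ ≤ ε n := by
  have hv : 0 < 4 * p * (1 - p) := by nlinarith
  set v := 4 * p * (1 - p) with hvdef
  have hsq : Tendsto (fun n : ℕ => (√(n : ℝ))⁻¹) atTop (𝓝 0) :=
    tendsto_inv_atTop_zero.comp (Real.tendsto_sqrt_atTop.comp tendsto_natCast_atTop_atTop)
  have hτ : Tendsto (fun n : ℕ => (((√n)⁻¹ * (√v)⁻¹ * t : ℝ) : ℂ)) atTop (𝓝 0) := by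
    have h := (Complex.continuous_ofReal.tendsto _).comp ((hsq.mul_const (√v)⁻¹).mul_const t)
    rw [zero_mul, zero_mul, Complex.ofReal_zero] at h
    exact h
  have hsqv : (√v) ^ 2 = v := Real.sq_sqrt hv.le
  have hNτ : Tendsto (fun n : ℕ => (n : ℂ) * (((√n)⁻¹ * (√v)⁻¹ * t : ℝ) : ℂ) ^ 2) atTop
      (𝓝 ((t ^ 2 / v : ℝ) : ℂ)) := by
    refine tendsto_const_nhds.congr' ?_
    filter_upwards [eventually_ne_atTop 0] with n hn
    have hn' : (n : ℝ) ≠ 0 := Nat.cast_ne_zero.2 hn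
    have : t ^ 2 / v = n * ((√n)⁻¹ * (√v)⁻¹ * t) ^ 2 := by
      rw [mul_pow, mul_pow, inv_pow, inv_pow, hsqv, Real.sq_sqrt n.cast_nonneg]
      field_simp
    rw [this]
    push_cast
    rfl
  have hinv : Tendsto (fun n : ℕ => (n : ℂ)⁻¹) atTop (𝓝 0) := tendsto_inv_atTop_nhds_zero_nat
  -- Summing over both possible inputs makes the bound independent of `x`; each site then costs at
  -- most `ε n / n`.
  let ε : ℕ → ℝ := fun n => ∑ e : ℤˣ,
    ‖(n : ℂ) * (siteChar p e (((√n)⁻¹ * (√v)⁻¹ * t : ℝ) : ℂ) - 1) -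
    (n : ℂ) * (Complex.exp (-(t : ℂ) ^ 2 / 2 * (n : ℂ)⁻¹) - 1)‖
  have hexp : Tendsto (fun n : ℕ => (n : ℂ) * (Complex.exp (-(t : ℂ) ^ 2 / 2 * (n : ℂ)⁻¹) - 1))
      atTop (𝓝 (-(t : ℂ) ^ 2 / 2)) := by
    have hd : HasDerivAt (fun z : ℂ => Complex.exp (-(t : ℂ) ^ 2 / 2 * z))
        (-(t : ℂ) ^ 2 / 2) 0 := by
      simpa using ((hasDerivAt_id' (0 : ℂ)).const_mul (-(t : ℂ) ^ 2 / 2)).cexp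
    have h := (hasDerivAt_iff_tendsto_slope_zero.1 hd).comp
      (tendsto_nhdsWithin_iff.2 ⟨hinv, (eventually_ne_atTop 0).mono fun n hn => by simp [hn]⟩)
    simpa [Function.comp_def] using h
  refine ⟨ε, ?_, fun n hn x => ?_⟩
  · have h : ∀ e : ℤˣ, Tendsto (fun n : ℕ =>
        ‖(n : ℂ) * (siteChar p e (((√n)⁻¹ * (√v)⁻¹ * t : ℝ) : ℂ) - 1) -
          (n : ℂ) * (Complex.exp (-(t : ℂ) ^ 2 / 2 * (n : ℂ)⁻¹) - 1)‖) atTop (𝓝 0) := by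
      intro e
      have h1 := ((tendsto_siteChar p e hτ hNτ).sub hexp).norm
      convert h1 using 2
      rw [← hvdef]
      have hv' : (v : ℂ) ≠ 0 := Complex.ofReal_ne_zero.2 hv.ne'
      symm
      rw [norm_eq_zero]
      push_cast
      field_simp
      ring
    have hsum := tendsto_finsetSum Finset.univ fun e _ => h e
    rw [Finset.sum_const_zero] at hsum
    exact hsum
  · have hn' : (n : ℂ) ≠ 0 := Nat.cast_ne_zero.2 hn
    have hprod : Complex.exp (-(t : ℂ) ^ 2 / 2) =
        ∏ _i : Fin n, Complex.exp (-(t : ℂ) ^ 2 / 2 * (n : ℂ)⁻¹) := by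
      rw [Finset.prod_const, Finset.card_univ, Fintype.card_fin, ← Complex.exp_nat_mul]
      congr 1
      field_simp
    rw [hprod]
    refine (norm_prod_sub_prod_le _ _ _ (fun i => norm_siteChar_le hp.le hp1.le _ _)
      (fun i => ?_)).trans ?_
    · have : -(t : ℂ) ^ 2 / 2 * (n : ℂ)⁻¹ = ((-t ^ 2 / 2 * (n : ℝ)⁻¹ : ℝ) : ℂ) := by push_cast; rfl
      rw [this, Complex.norm_exp, Complex.ofReal_re, Real.exp_le_one_iff]
      have : 0 ≤ t ^ 2 / 2 * (n : ℝ)⁻¹ := by positivity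
      linarith
    · calc _ ≤ ∑ _i : Fin n, (n : ℝ)⁻¹ * ε n := by
            refine Finset.sum_le_sum fun i _ => ?_
            rw [← mul_le_mul_iff_right₀ (Nat.cast_pos.2 (Nat.pos_of_ne_zero hn) : (0 : ℝ) < n),
              mul_inv_cancel_left₀ (Nat.cast_ne_zero.2 hn)]
            refine le_trans (le_of_eq ?_) (Finset.single_le_sum (fun e _ => norm_nonneg _)
              (Finset.mem_univ (x i)))
            rw [← mul_sub, norm_mul, Complex.norm_natCast]
            congr 2
            ring
        _ = ε n := by
            rw [Finset.sum_const, Finset.card_univ, Fintype.card_fin, nsmul_eq_mul,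
              mul_inv_cancel_left₀ (Nat.cast_ne_zero.2 hn)]

end

end Sentiment

namespace Sentiment

noncomputable section

/-! ### The critical conditional error probability -/

/-- The probability of a configuration of the Ising ring with field `H`. -/
def ringProb (K H : ℝ) {m : ℕ} (y : Spins m) : ℝ :=
  ringWeight K y * Real.exp (H * spinSum y) / ringPF K m H

lemma ringProb_nonneg (K H : ℝ) {m : ℕ} (y : Spins m) : 0 ≤ ringProb K H y :=
  div_nonneg (mul_pos (Real.exp_pos _) (Real.exp_pos _)).le (ringPF_pos K m H).le

lemma ringExp_eq_sum (K H : ℝ) (m : ℕ) (f : Spins m → ℝ) :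
    ringExp K H m f = ∑ y, ringProb K H y * f y := by
  rw [ringExp, Finset.sum_div]
  exact Finset.sum_congr rfl fun y _ => by rw [ringProb]; ring

lemma sum_ringProb (K H : ℝ) (m : ℕ) : ∑ y : Spins m, ringProb K H y = 1 := by
  simpa [ringExp_eq_sum] using ringExp_const K H m 1

lemma sum_ringProb_cexp (K H : ℝ) (m : ℕ) (z : ℂ) :
    ∑ y : Spins m, (ringProb K H y : ℂ) * Complex.exp (z * spinSum y) =
      ringPFC K m (H + z) / ringPF K m H := by
  rw [ringPFC, Finset.sum_div]
  refine Finset.sum_congr rfl fun y _ => ?_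
  rw [ringProb, add_mul, Complex.exp_add]
  push_cast
  ring

lemma tendsto_inv_sqrt_succ :
    Tendsto (fun m : ℕ => (√((m + 1 : ℕ) : ℝ))⁻¹) atTop (𝓝 0) :=
  (tendsto_inv_atTop_zero.comp (Real.tendsto_sqrt_atTop.comp tendsto_natCast_atTop_atTop)).comp
    (tendsto_add_atTop_nat 1)

/-- The ring is evaluated at the field `H + iτ` with `τ = s / √((m + 1) curv)`. Normalising by `m +
1` instead of `m` and adding the centre both disappear in the limit. -/
lemma tendsto_magnetisation_charFun {K : ℝ} (hK : 0 ≤ K) (H : ℝ) (e : ℤˣ) (s : ℝ) :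
    Tendsto (fun m : ℕ => ∑ y : Spins m, (ringProb K H y : ℂ) * Complex.exp
      (((s * ((√((m + 1 : ℕ) : ℝ))⁻¹ * (√(curv (Real.exp (-4 * K)) H))⁻¹ *
        (spinSum (Fin.cons e y : Spins (m + 1)) -
          (m + 1 : ℕ) * slope (Real.exp (-4 * K)) H)) : ℝ) : ℂ) * Complex.I)) atTop
      (𝓝 (Complex.exp (-(s : ℂ) ^ 2 / 2))) := by
  set μ := slope (Real.exp (-4 * K)) H with hμ
  have hσ := curv_pos (Real.exp_pos (-4 * K)) H
  set σ := curv (Real.exp (-4 * K)) H with hσdef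
  let τ : ℕ → ℝ := fun m => s * ((√((m + 1 : ℕ) : ℝ))⁻¹ * (√σ)⁻¹)
  have hτ : Tendsto (fun m => (τ m : ℂ)) atTop (𝓝 0) := by
    have h := (Complex.continuous_ofReal.tendsto _).comp
      ((tendsto_inv_sqrt_succ.mul_const (√σ)⁻¹).const_mul s)
    rw [zero_mul, mul_zero, Complex.ofReal_zero] at h
    exact h
  have hw : Tendsto (fun m => (τ m : ℂ) * Complex.I) atTop (𝓝 0) := by
    simpa using hτ.mul_const Complex.I
  have hN : Tendsto (fun m : ℕ => (m : ℂ) * ((τ m : ℂ) * Complex.I) ^ 2) atTop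
      (𝓝 ((-(s ^ 2 / σ) : ℝ) : ℂ)) := by
    have h1 : Tendsto (fun m : ℕ => (m : ℝ) / (m + 1) * -(s ^ 2 / σ)) atTop (𝓝 (-(s ^ 2 / σ))) := by
      simpa using (tendsto_natCast_div_add_atTop (1 : ℝ)).mul_const (-(s ^ 2 / σ))
    refine ((Complex.continuous_ofReal.tendsto _).comp h1).congr fun m => ?_
    have h2 : (m : ℝ) / (m + 1) * -(s ^ 2 / σ) = -(m * τ m ^ 2) := by
      simp only [τ]
      rw [mul_pow, mul_pow, inv_pow, inv_pow, Real.sq_sqrt hσ.le, Real.sq_sqrt (by positivity)]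
      push_cast
      field_simp
    rw [Function.comp_apply, h2, mul_pow (τ m : ℂ), Complex.I_sq]
    push_cast
    ring
  have h3 := tendsto_ringPFC hK H hw hN
  rw [← hμ, ← hσdef] at h3
  have h4 : Tendsto (fun m => Complex.exp ((τ m : ℂ) * Complex.I * (sgn e - μ))) atTop (𝓝 1) := by
    have := (Complex.continuous_exp.tendsto _).comp (hw.mul_const ((sgn e : ℂ) - μ))
    rw [zero_mul, Complex.exp_zero] at this
    exact this
  have h5 := h3.mul h4
  have hlim : Complex.exp ((σ : ℂ) * ((-(s ^ 2 / σ) : ℝ) : ℂ) / 2) * 1 =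
      Complex.exp (-(s : ℂ) ^ 2 / 2) := by
    have : (σ : ℂ) ≠ 0 := Complex.ofReal_ne_zero.2 hσ.ne'
    rw [mul_one]
    congr 1
    push_cast
    field_simp
  rw [hlim] at h5
  refine h5.congr fun m => ?_
  rw [← sum_ringProb_cexp, Finset.sum_mul, Finset.sum_mul]
  refine Finset.sum_congr rfl fun y _ => ?_
  rw [mul_assoc, mul_assoc, ← Complex.exp_add, ← Complex.exp_add, spinSum_cons]
  congr 2
  simp only [τ]
  push_cast
  ring

lemma sign_mul_pos {a b : ℝ} (ha : 0 < a) : SignType.sign (a * b) = SignType.sign b := by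
  rw [sign_mul, sign_pos ha, one_mul]

lemma tendsto_ringExp_errGiven {K : ℝ} (hK : 0 ≤ K) {p : ℝ} (hp : 0 < p) (hp1 : p < 1 / 2) (H : ℝ)
    (e : ℤˣ) :
    Tendsto (fun m : ℕ => ringExp K H m fun y =>
      errGiven p (slope (Real.exp (-4 * K)) H) (Fin.cons e y : Spins (m + 1))) atTop
      (𝓝 (1 / Real.pi * arccot (Dconst p * √(curv (Real.exp (-4 * K)) H)))) := by
  have hlim := tendsto_magnetisation_charFun hK H e
  set μ := slope (Real.exp (-4 * K)) H with hμ
  have hσ := curv_pos (Real.exp_pos (-4 * K)) H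
  set σ := curv (Real.exp (-4 * K)) H with hσdef
  have hv : 0 < 4 * p * (1 - p) := by nlinarith
  have hsσ := Real.sqrt_pos.2 hσ
  have hsv := Real.sqrt_pos.2 hv
  let U : ∀ m : ℕ, Spins m × Spins (m + 1) → ℝ := fun m ω =>
    (√((m + 1 : ℕ) : ℝ))⁻¹ * (√σ)⁻¹ * (spinSum (Fin.cons e ω.1 : Spins (m + 1)) - (m + 1 : ℕ) * μ)
  let W : ∀ m : ℕ, Spins m × Spins (m + 1) → ℝ := fun m ω =>
    (√((m + 1 : ℕ) : ℝ))⁻¹ * (√(4 * p * (1 - p)))⁻¹ *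
      (spinSum ω.2 - (1 - 2 * p) * spinSum (Fin.cons e ω.1 : Spins (m + 1)))
  let w : ∀ m : ℕ, Spins m × Spins (m + 1) → ℝ := fun m ω =>
    ringProb K H ω.1 * channel p (Fin.cons e ω.1 : Spins (m + 1)) ω.2
  have hD : 0 ≤ Dconst p * √σ := mul_nonneg (div_nonneg (by linarith) hsv.le) hsσ.le
  have key := tendsto_sum_sign_ne w U W
    (fun m ω => mul_nonneg (ringProb_nonneg K H _) (channel_nonneg hp.le (by linarith) _ _))
    (fun m => by
      simp only [w, Fintype.sum_prod_type, ← Finset.mul_sum, sum_channel, mul_one]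
      exact sum_ringProb K H m)
    (fun s t => by
      obtain ⟨ε, hε, hbound⟩ := exists_prod_siteChar_error hp (by linarith) t
      have h1 := (hlim s).mul_const (Complex.exp (-(t : ℂ) ^ 2 / 2))
      rw [← Complex.exp_add, ← add_div, ← neg_add] at h1
      -- The factor `exp (-t² / 2)` stands in for the noise characteristic function given `X`, with
      -- an error at most `ε (m + 1)` whatever `X` is.
      refine h1.congr_dist (squeeze_zero (fun m => dist_nonneg) (fun m => ?_)
        (hε.comp (tendsto_add_atTop_nat 1)))
      rw [dist_comm, dist_eq_norm, Fintype.sum_prod_type, Finset.sum_mul, ← Finset.sum_sub_distrib,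
        Function.comp_apply, ← one_mul (ε (m + 1)), ← sum_ringProb K H m, Finset.sum_mul]
      refine (norm_sum_le _ _).trans (Finset.sum_le_sum fun y _ => ?_)
      have h2 : ∑ y' : Spins (m + 1), (w m (y, y') : ℂ) * Complex.exp
          (((s * U m (y, y') + t * W m (y, y') : ℝ) : ℂ) * Complex.I) =
          (ringProb K H y : ℂ) * Complex.exp (((s * U m (y, 1) : ℝ) : ℂ) * Complex.I) *
          ∏ i, siteChar p ((Fin.cons e y : Spins (m + 1)) i)
            (((√((m + 1 : ℕ) : ℝ))⁻¹ * (√(4 * p * (1 - p)))⁻¹ * t : ℝ) : ℂ) := by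
        rw [← sum_channel_cexp, Finset.mul_sum]
        refine Finset.sum_congr rfl fun y' _ => ?_
        simp only [w, U, W]
        rw [Complex.ofReal_add, add_mul, Complex.exp_add, Complex.ofReal_mul (ringProb K H y)]
        have : t * ((√((m + 1 : ℕ) : ℝ))⁻¹ * (√(4 * p * (1 - p)))⁻¹ *
            (spinSum y' - (1 - 2 * p) * spinSum (Fin.cons e y : Spins (m + 1)))) =
            (√((m + 1 : ℕ) : ℝ))⁻¹ * (√(4 * p * (1 - p)))⁻¹ * t *
            (spinSum y' - (1 - 2 * p) * spinSum (Fin.cons e y : Spins (m + 1))) := by ring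
        rw [this]
        ring
      rw [h2, ← mul_sub, norm_mul, norm_mul, Complex.norm_exp_ofReal_mul_I, mul_one,
        Complex.norm_real, Real.norm_of_nonneg (ringProb_nonneg K H y)]
      exact mul_le_mul_of_nonneg_left (hbound _ m.succ_ne_zero _) (ringProb_nonneg K H y)) hD
  refine key.congr fun m => ?_
  rw [Fintype.sum_prod_type, ringExp_eq_sum]
  refine Finset.sum_congr rfl fun y _ => ?_
  rw [errGiven, Finset.mul_sum]
  refine Finset.sum_congr rfl fun y' _ => ?_
  simp only [w]
  rw [mul_assoc]
  have hn : (0 : ℝ) < (m + 1 : ℕ) := by positivity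
  have hsn := Real.sqrt_pos.2 hn
  have e1 : U m (y, y') = (√((m + 1 : ℕ) : ℝ))⁻¹ * (√σ)⁻¹ * (m + 1 : ℕ) *
      (avg (Fin.cons e y : Spins (m + 1)) - μ) := by
    simp only [U]
    rw [mul_assoc _ ((m + 1 : ℕ) : ℝ), natCast_mul_avg_sub m.succ_ne_zero]
  -- This is where `D_p` arises: the centred output sum is `1 - 2p` times the centred input sum plus
  -- noise, measured in units of the noise deviation.
  have e2 : Dconst p * √σ * U m (y, y') + W m (y, y') =
      (√((m + 1 : ℕ) : ℝ))⁻¹ * (√(4 * p * (1 - p)))⁻¹ * (m + 1 : ℕ) *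
      (avg y' - (1 - 2 * p) * μ) := by
    rw [mul_assoc _ ((m + 1 : ℕ) : ℝ), natCast_mul_avg_sub m.succ_ne_zero]
    simp only [U, W, Dconst]
    field_simp
    ring
  rw [e2, e1, sign_mul_pos (by positivity), sign_mul_pos (by positivity)]

end

end Sentiment

namespace Sentiment

noncomputable section

variable {G : ∀ n : ℕ, SimpleGraph (Fin n)} {β K : ℝ}

/-! ### Limits of the free entropy, the mean and the variance -/

lemma exists_spin_sign (h : ℝ) : ∃ e : ℤˣ, sgn e * h = |h| ∧ (h ≠ 0 → sgn e = Real.sign h) := by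
  rcases lt_or_ge h 0 with hh | hh
  · exact ⟨-1, by simp [abs_of_neg hh], fun _ => by simp [Real.sign_of_neg hh]⟩
  · refine ⟨1, by simp [abs_of_nonneg hh], fun h0 => ?_⟩
    simp [Real.sign_of_pos (lt_of_le_of_ne hh (Ne.symm h0))]

lemma field_eq {h : ℝ} {e : ℤˣ} (he : sgn e * h = |h|) :
    2 * β * sgn e + h = sgn e * (2 * β + |h|) := by
  linear_combination -(h * sgn_sq e) + sgn e * he

lemma eig_sgn_mul (c : ℝ) (e : ℤˣ) (t : ℝ) : eig c (sgn e * t) = eig c t := by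
  rcases sgn_eq e with h | h <;> simp [h, eig_neg]

lemma curv_sgn_mul (c : ℝ) (e : ℤˣ) (t : ℝ) : curv c (sgn e * t) = curv c t := by
  rcases sgn_eq e with h | h <;> simp [h, curv_neg]

lemma slope_sgn_mul (c : ℝ) (e : ℤˣ) (t : ℝ) : slope c (sgn e * t) = sgn e * slope c t := by
  rcases sgn_eq e with h | h <;> simp [h, slope_neg]

/-- The centre aligned with `h` alone gives the lower bound. For the upper bound each of the two
centre terms is at most `2 exp |h|` times the same power. -/
lemma partitionFn_bounds (hG : IsRingCone G β K) (hK : 0 ≤ K) (hβ : 0 < β) (h : ℝ) {m : ℕ}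
    (hm : 3 ≤ m) :
    (Real.exp K * eig (Real.exp (-4 * K)) (2 * β + |h|)) ^ m ≤ partitionFn (G (m + 1)) β h ∧
    partitionFn (G (m + 1)) β h ≤ 4 * Real.exp |h| *
      (Real.exp K * eig (Real.exp (-4 * K)) (2 * β + |h|)) ^ m := by
  obtain ⟨e, he, -⟩ := exists_spin_sign h
  have hm0 : m ≠ 0 := by omega
  set c := Real.exp (-4 * K) with hc
  have hcp : 0 < c := Real.exp_pos _
  have hpos := Real.exp_pos K
  rw [partitionFn_eq hG hm, sum_spin' _ e, sgn_neg, mul_comm h, he, mul_neg, mul_comm h (sgn e), he,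
    field_eq he]
  have h1 := le_ringPF hK hm0 (sgn e * (2 * β + |h|))
  have h2 := ringPF_le hK hm0 (sgn e * (2 * β + |h|))
  have h3 := ringPF_le hK hm0 (2 * β * -sgn e + h)
  rw [← hc, eig_sgn_mul] at h1 h2
  rw [← hc] at h3
  have hle : eig c (2 * β * -sgn e + h) ≤ eig c (2 * β + |h|) := by
    rw [← eig_abs, ← eig_abs (2 * β + |h|)]
    refine (eig_strictMonoOn hcp).monotoneOn (Set.mem_Ici.2 (abs_nonneg _))
      (Set.mem_Ici.2 (abs_nonneg _)) ?_
    rw [abs_of_nonneg (by positivity : 0 ≤ 2 * β + |h|)]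
    refine (abs_add_le _ _).trans (le_of_eq ?_)
    rcases sgn_eq e with h | h <;> simp [h, abs_of_pos hβ]
  have h4 : (Real.exp K * eig c (2 * β * -sgn e + h)) ^ m ≤
      (Real.exp K * eig c (2 * β + |h|)) ^ m :=
    pow_le_pow_left₀ (mul_pos hpos (eig_pos _)).le (mul_le_mul_of_nonneg_left hle hpos.le) m
  have hF := ringPF_pos K m (sgn e * (2 * β + |h|))
  have hF' := ringPF_pos K m (2 * β * -sgn e + h)
  have e1 : 1 ≤ Real.exp |h| := Real.one_le_exp (abs_nonneg h)
  have e2 : Real.exp (-|h|) ≤ Real.exp |h| := Real.exp_le_exp.2 (by linarith [abs_nonneg h])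
  have e3 := Real.exp_pos (-|h|)
  constructor
  · nlinarith
  · nlinarith [mul_le_mul_of_nonneg_right e2 hF'.le]

lemma tendsto_freeEntropyN (hG : IsRingCone G β K) (hK : 0 ≤ K) (hβ : 0 < β) (h : ℝ) :
    Tendsto (fun n : ℕ => freeEntropyN (G n) β h) atTop
      (𝓝 (K + Real.log (eig (Real.exp (-4 * K)) (2 * β + |h|)))) := by
  rw [← tendsto_add_atTop_iff_nat 1]
  set L := K + Real.log (eig (Real.exp (-4 * K)) (2 * β + |h|)) with hL
  have heig := eig_pos (c := Real.exp (-4 * K)) (2 * β + |h|)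
  have hb : 0 < Real.exp K * eig (Real.exp (-4 * K)) (2 * β + |h|) := by positivity
  have hlog : ∀ m : ℕ, Real.log ((Real.exp K * eig (Real.exp (-4 * K)) (2 * β + |h|)) ^ m) =
      m * L := by
    intro m
    rw [Real.log_pow, Real.log_mul (Real.exp_pos K).ne' heig.ne', Real.log_exp]
  have t1 : Tendsto (fun m : ℕ => (m : ℝ) / (m + 1) * L) atTop (𝓝 L) := by
    simpa using (tendsto_natCast_div_add_atTop (1 : ℝ)).mul_const L
  have t2 : Tendsto (fun m : ℕ => (m : ℝ) / (m + 1) * L +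
      Real.log (4 * Real.exp |h|) * (1 / ((m : ℝ) + 1))) atTop (𝓝 L) := by
    simpa using t1.add ((tendsto_one_div_add_atTop_nhds_zero_nat (𝕜 := ℝ)).const_mul
      (Real.log (4 * Real.exp |h|)))
  refine tendsto_of_tendsto_of_tendsto_of_le_of_le' t1 t2 ?_ ?_
  · filter_upwards [eventually_ge_atTop 3] with m hm
    have h1 := Real.log_le_log (by positivity) (partitionFn_bounds hG hK hβ h hm).1
    rw [hlog] at h1
    rw [freeEntropyN, div_mul_eq_mul_div, div_mul_eq_mul_div, one_mul]
    push_cast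
    exact div_le_div_of_nonneg_right h1 (by positivity)
  · filter_upwards [eventually_ge_atTop 3] with m hm
    have h0 := (partitionFn_bounds hG hK hβ h hm).1
    have h1 := Real.log_le_log ((by positivity : 0 <
      (Real.exp K * eig (Real.exp (-4 * K)) (2 * β + |h|)) ^ m).trans_le h0)
      (partitionFn_bounds hG hK hβ h hm).2
    rw [Real.log_mul (by positivity) (by positivity), hlog] at h1
    rw [freeEntropyN, div_mul_eq_mul_div, div_mul_eq_mul_div, one_mul, mul_one_div, ← add_div]
    push_cast
    refine div_le_div_of_nonneg_right ?_ (by positivity)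
    linarith

lemma abs_avg_le_one {n : ℕ} (x : Spins n) : |avg x| ≤ 1 := by
  rw [avg_eq, abs_div, Nat.abs_cast]
  refine div_le_one_of_le₀ ?_ n.cast_nonneg
  refine (Finset.abs_sum_le_sum_abs _ _).trans (le_of_eq ?_)
  have : ∀ i, |toVec x i| = 1 := fun i => by
    rcases sgn_eq (x i) with h | h <;> simp only [sgn] at h <;> simp [toVec, h]
  simp [this]

lemma ringExp_avg (K H : ℝ) (m : ℕ) (e : ℤˣ) :
    ringExp K H m (fun y => avg (Fin.cons e y : Spins (m + 1))) =
      (sgn e + ringExp K H m spinSum) / (m + 1 : ℕ) := by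
  simp only [avg_eq, spinSum_cons, div_eq_inv_mul]
  rw [ringExp_const_mul, ringExp_add, ringExp_const]

lemma abs_ringExp_avg_le (K H : ℝ) (m : ℕ) (e : ℤˣ) :
    |ringExp K H m (fun y => avg (Fin.cons e y : Spins (m + 1)))| ≤ 1 := by
  rw [abs_le]
  constructor
  · rw [← ringExp_const K H m (-1)]
    exact ringExp_mono _ _ _ fun y => (abs_le.1 (abs_avg_le_one _)).1
  · conv_rhs => rw [← ringExp_const K H m 1]
    exact ringExp_mono _ _ _ fun y => (abs_le.1 (abs_avg_le_one _)).2

lemma tendsto_ringExp_avg (hK : 0 ≤ K) (H : ℝ) (e : ℤˣ) :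
    Tendsto (fun m : ℕ => ringExp K H m (fun y => avg (Fin.cons e y : Spins (m + 1)))) atTop
      (𝓝 (slope (Real.exp (-4 * K)) H)) := by
  have h := ((tendsto_one_div_add_atTop_nhds_zero_nat (𝕜 := ℝ)).const_mul (sgn e)).add
    ((tendsto_natCast_div_add_atTop (1 : ℝ)).mul (tendsto_ringExp_spinSum hK H))
  rw [mul_zero, zero_add, one_mul] at h
  refine h.congr' ?_
  filter_upwards [eventually_ne_atTop 0] with m hm
  have : (m : ℝ) ≠ 0 := Nat.cast_ne_zero.2 hm
  rw [ringExp_avg]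
  push_cast
  field_simp

/-- The variance of the average spin of the ring, with the centre fixed. -/
def ringVar (K H : ℝ) (m : ℕ) (e : ℤˣ) : ℝ :=
  ringExp K H m fun y => (avg (Fin.cons e y : Spins (m + 1)) -
    ringExp K H m (fun y => avg (Fin.cons e y : Spins (m + 1)))) ^ 2

lemma tendsto_ringVar (hK : 0 ≤ K) (H : ℝ) (e : ℤˣ) :
    Tendsto (fun m : ℕ => ((m + 1 : ℕ) : ℝ) * ringVar K H m e) atTop
      (𝓝 (curv (Real.exp (-4 * K)) H)) := by
  have h := (tendsto_natCast_div_add_atTop (1 : ℝ)).mul (tendsto_ringExp_variance hK H)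
  rw [one_mul] at h
  refine h.congr' ?_
  filter_upwards [eventually_ne_atTop 0] with m hm
  have : (m : ℝ) ≠ 0 := Nat.cast_ne_zero.2 hm
  have h1 : ∀ y : Spins m, (avg (Fin.cons e y : Spins (m + 1)) -
      ringExp K H m (fun y => avg (Fin.cons e y : Spins (m + 1)))) ^ 2 =
      (((m + 1 : ℕ) : ℝ) ^ 2)⁻¹ * (spinSum y - ringExp K H m spinSum) ^ 2 := by
    intro y
    rw [ringExp_avg, avg_eq, spinSum_cons]
    push_cast
    field_simp
    ring
  rw [ringVar]
  simp_rw [h1]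
  rw [ringExp_const_mul]
  push_cast
  field_simp

lemma ringExp_sub_sq (K H : ℝ) (m : ℕ) (f : Spins m → ℝ) (a : ℝ) :
    ringExp K H m (fun y => (f y - a) ^ 2) =
      ringExp K H m (fun y => (f y - ringExp K H m f) ^ 2) + (ringExp K H m f - a) ^ 2 := by
  have h : ∀ b : ℝ, ringExp K H m (fun y => (f y - b) ^ 2) =
      ringExp K H m (fun y => f y ^ 2) + (-2 * b * ringExp K H m f + b ^ 2) := by
    intro b
    rw [← ringExp_const_mul, ← ringExp_const K H m (b ^ 2), ← ringExp_add, ← ringExp_add]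
    congr 1
    funext y
    ring
  rw [h a, h (ringExp K H m f)]
  ring

lemma centre_wrong_sign (hh : h ≠ 0) {e : ℤˣ} (he : sgn e * h = |h|) : sgn (-e) * h < 0 := by
  rw [sgn_neg, neg_mul, he]
  exact neg_lt_zero.2 (abs_pos.2 hh)

lemma tendsto_centreProb (hK : 0 ≤ K) (hβ : 0 < β) {h : ℝ} {e : ℤˣ} (he : sgn (-e) * h < 0) :
    Tendsto (fun m => centreProb K β h m e) atTop (𝓝 1) := by
  have h1 := (expSmall_centreProb hK hβ he).tendsto.const_sub 1
  rw [sub_zero] at h1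
  refine h1.congr fun m => ?_
  linarith [centreProb_add K β h m e]

lemma tendsto_meanAvg (hG : IsRingCone G β K) (hK : 0 ≤ K) (hβ : 0 < β) {h : ℝ} {e : ℤˣ}
    (he : sgn (-e) * h < 0) :
    Tendsto (fun n : ℕ => meanAvg (G n) β h) atTop
      (𝓝 (slope (Real.exp (-4 * K)) (2 * β * sgn e + h))) := by
  rw [← tendsto_add_atTop_iff_nat 1]
  have h1 := ((tendsto_centreProb hK hβ he).mul
    (tendsto_ringExp_avg hK (2 * β * sgn e + h) e)).add
    ((expSmall_centreProb hK hβ he).tendsto.mul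
    (tendsto_ringExp_avg hK (2 * β * sgn (-e) + h) (-e)))
  rw [one_mul, zero_mul, add_zero] at h1
  refine h1.congr' ?_
  filter_upwards [eventually_ge_atTop 3] with m hm
  rw [meanAvg, expect_eq hG hm, sum_spin' _ e]

/-- The variance is that of the aligned ring up to terms carrying the probability of the wrong
centre, which stays negligible after multiplication by `n`. -/
lemma tendsto_varAvg (hG : IsRingCone G β K) (hK : 0 ≤ K) (hβ : 0 < β) {h : ℝ} {e : ℤˣ}
    (he : sgn (-e) * h < 0) :
    Tendsto (fun n : ℕ => n * varAvg (G n) β h) atTop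
      (𝓝 (curv (Real.exp (-4 * K)) (2 * β * sgn e + h))) := by
  rw [← tendsto_add_atTop_iff_nat 1]
  have hsmall : ExpSmall fun n => centreProb K β h (n - 1) (-e) :=
    ExpSmall.of_succ (by simpa using expSmall_centreProb hK hβ he)
  have hw : Tendsto (fun m : ℕ => ((m + 1 : ℕ) : ℝ) * centreProb K β h m (-e)) atTop (𝓝 0) := by
    simpa using (tendsto_add_atTop_iff_nat 1).2 hsmall.tendsto_mul
  have hmain := (tendsto_centreProb hK hβ he).mul (tendsto_ringVar hK (2 * β * sgn e + h) e)
  rw [one_mul] at hmain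
  -- Averages lie in `[-1, 1]`, so the wrong centre contributes at most `4` times its probability
  -- directly and `4` times it through the shift of the mean.
  have herr := hw.const_mul 8
  rw [mul_zero] at herr
  refine hmain.congr_dist (squeeze_zero' (Eventually.of_forall fun m => dist_nonneg) ?_ herr)
  filter_upwards [eventually_ge_atTop 3] with m hm
  have hM : meanAvg (G (m + 1)) β h = _ := expect_eq hG hm h avg
  rw [sum_spin' _ e] at hM
  rw [varAvg, expect_eq hG hm, sum_spin' _ e, ringExp_sub_sq K (2 * β * sgn e + h), ← ringVar]
  have hw0 := centreProb_pos K β h m (-e)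
  have hw1 := centreProb_le_one K β h m e
  have hp0 := centreProb_pos K β h m e
  have hsum := centreProb_add K β h m e
  have hE := abs_le.1 (abs_ringExp_avg_le K (2 * β * sgn e + h) m e)
  have hE' := abs_le.1 (abs_ringExp_avg_le K (2 * β * sgn (-e) + h) m (-e))
  have hwrong : ringExp K (2 * β * sgn (-e) + h) m (fun y =>
      (avg (Fin.cons (-e) y : Spins (m + 1)) - meanAvg (G (m + 1)) β h) ^ 2) ≤ 4 ∧
      0 ≤ ringExp K (2 * β * sgn (-e) + h) m (fun y =>
      (avg (Fin.cons (-e) y : Spins (m + 1)) - meanAvg (G (m + 1)) β h) ^ 2) := by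
    have hMabs : |meanAvg (G (m + 1)) β h| ≤ 1 := by
      rw [hM, abs_le]
      constructor <;> nlinarith
    refine ⟨?_, ringExp_nonneg _ _ _ fun y => sq_nonneg _⟩
    conv_rhs => rw [← ringExp_const K (2 * β * sgn (-e) + h) m 4]
    refine ringExp_mono _ _ _ fun y => ?_
    have h1 := abs_le.1 (abs_avg_le_one (Fin.cons (-e) y : Spins (m + 1)))
    have h2 := abs_le.1 hMabs
    nlinarith
  have hB : 0 ≤ (ringExp K (2 * β * sgn e + h) m (fun y => avg (Fin.cons e y : Spins (m + 1))) -
      meanAvg (G (m + 1)) β h) ^ 2 := sq_nonneg _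
  have hdiff : (ringExp K (2 * β * sgn e + h) m (fun y => avg (Fin.cons e y : Spins (m + 1))) -
      meanAvg (G (m + 1)) β h) ^ 2 ≤ 4 * centreProb K β h m (-e) := by
    have : ringExp K (2 * β * sgn e + h) m (fun y => avg (Fin.cons e y : Spins (m + 1))) -
        meanAvg (G (m + 1)) β h = centreProb K β h m (-e) *
        (ringExp K (2 * β * sgn e + h) m (fun y => avg (Fin.cons e y : Spins (m + 1))) -
        ringExp K (2 * β * sgn (-e) + h) m (fun y => avg (Fin.cons (-e) y : Spins (m + 1)))) := by
      rw [hM]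
      linear_combination -(ringExp K (2 * β * sgn e + h) m
        (fun y => avg (Fin.cons e y : Spins (m + 1)))) * hsum
    rw [this, mul_pow]
    have h4 : (ringExp K (2 * β * sgn e + h) m (fun y => avg (Fin.cons e y : Spins (m + 1))) -
        ringExp K (2 * β * sgn (-e) + h) m (fun y => avg (Fin.cons (-e) y : Spins (m + 1)))) ^ 2
        ≤ 4 := by nlinarith
    have hw2 : centreProb K β h m (-e) ≤ 1 := by linarith
    nlinarith [mul_le_mul_of_nonneg_left h4 (sq_nonneg (centreProb K β h m (-e)))]
  generalize ringExp K (2 * β * sgn (-e) + h) m (fun y =>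
      (avg (Fin.cons (-e) y : Spins (m + 1)) - meanAvg (G (m + 1)) β h) ^ 2) = A at *
  generalize (ringExp K (2 * β * sgn e + h) m (fun y => avg (Fin.cons e y : Spins (m + 1))) -
      meanAvg (G (m + 1)) β h) ^ 2 = B at *
  have hn : (0 : ℝ) ≤ (m + 1 : ℕ) := Nat.cast_nonneg _
  generalize ((m + 1 : ℕ) : ℝ) = N at *
  have h1 : N * (centreProb K β h m e * (ringVar K (2 * β * sgn e + h) m e + B) +
      centreProb K β h m (-e) * A) -
      centreProb K β h m e * (N * ringVar K (2 * β * sgn e + h) m e) =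
      N * (centreProb K β h m e * B + centreProb K β h m (-e) * A) := by ring
  have h2 : centreProb K β h m e * B ≤ 4 * centreProb K β h m (-e) :=
    (mul_le_of_le_one_left hB hw1).trans hdiff
  have h3 := mul_le_mul_of_nonneg_left hwrong.1 hw0.le
  rw [dist_comm, Real.dist_eq, h1, abs_of_nonneg (mul_nonneg hn (add_nonneg (mul_nonneg hp0.le hB)
    (mul_nonneg hw0.le hwrong.2)))]
  calc _ ≤ N * (8 * centreProb K β h m (-e)) := mul_le_mul_of_nonneg_left (by linarith) hn
    _ = _ := by ring

lemma condExpect_centrePos (hG : IsRingCone G β K) {m : ℕ} (hm : 3 ≤ m)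
    (f : Spins (m + 1) → ℝ) : condExpect (G (m + 1)) β 0 (centrePos (m + 1)) f =
      ringExp K (2 * β) m (fun y => f (Fin.cons 1 y)) := by
  have h1 : ∀ g : Spins (m + 1) → ℝ, expect (G (m + 1)) β 0 ((centrePos (m + 1)).indicator g) =
      centreProb K β 0 m 1 * ringExp K (2 * β) m (fun y => g (Fin.cons 1 y)) := by
    intro g
    have hpos : ∀ y : Spins m, (Fin.cons 1 y : Spins (m + 1)) ∈ centrePos (m + 1) := by
      intro y i hi
      have : i = 0 := Fin.ext hi
      rw [this, Fin.cons_zero]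
    have hneg : ∀ y : Spins m, (Fin.cons (-1) y : Spins (m + 1)) ∉ centrePos (m + 1) := by
      intro y hy
      have := hy 0 rfl
      rw [Fin.cons_zero] at this
      exact absurd this (by decide)
    rw [expect_eq hG hm, sum_spin]
    simp only [Set.indicator_of_mem (hpos _), Set.indicator_of_notMem (hneg _)]
    rw [ringExp_const]
    simp
  rw [condExpect, prob, h1, h1]
  simp only [Pi.one_apply]
  rw [ringExp_const, mul_one, mul_div_cancel_left₀ _ (centreProb_pos ..).ne']

lemma tendsto_condVarAvg (hG : IsRingCone G β K) (hK : 0 ≤ K) :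
    Tendsto (fun n : ℕ => n * condVarAvg (G n) β 0 (centrePos n)) atTop
      (𝓝 (curv (Real.exp (-4 * K)) (2 * β))) := by
  rw [← tendsto_add_atTop_iff_nat 1]
  refine (tendsto_ringVar hK (2 * β) 1).congr' ?_
  filter_upwards [eventually_ge_atTop 3] with m hm
  rw [condVarAvg, condExpect_centrePos hG hm, condExpect_centrePos hG hm, ringVar]

end

end Sentiment

namespace Sentiment

noncomputable section

variable {G : ∀ n : ℕ, SimpleGraph (Fin n)} {β K p : ℝ}

/-! ### The detection error probability -/

lemma errorProb_nonneg {n : ℕ} (G : SimpleGraph (Fin n)) (β h : ℝ) (hp : 0 ≤ p) (hp1 : p ≤ 1)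
    (S : ℝ) : 0 ≤ errorProb G β h p S := by
  rw [errorProb_eq_expect]
  refine Finset.sum_nonneg fun x _ => mul_nonneg (div_nonneg (Real.exp_pos _).le
    (Finset.sum_nonneg fun x _ => (Real.exp_pos _).le)) (errGiven_nonneg hp hp1 S x)

lemma errorProb_succ (hG : IsRingCone G β K) {m : ℕ} (hm : 3 ≤ m) (h p S : ℝ) (e : ℤˣ) :
    errorProb (G (m + 1)) β h p S =
      centreProb K β h m e * ringExp K (2 * β * sgn e + h) m
        (fun y => errGiven p S (Fin.cons e y : Spins (m + 1))) +
      centreProb K β h m (-e) * ringExp K (2 * β * sgn (-e) + h) m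
        (fun y => errGiven p S (Fin.cons (-e) y : Spins (m + 1))) := by
  rw [errorProb_eq_expect, expect_eq hG hm, sum_spin' _ e]

lemma ringExp_errGiven_nonneg (hp : 0 ≤ p) (hp1 : p ≤ 1) (K H S : ℝ) (m : ℕ) (e : ℤˣ) :
    0 ≤ ringExp K H m (fun y => errGiven p S (Fin.cons e y : Spins (m + 1))) :=
  ringExp_nonneg _ _ _ fun _ => errGiven_nonneg hp hp1 _ _

lemma ringExp_errGiven_le_one (hp : 0 ≤ p) (hp1 : p ≤ 1) (K H S : ℝ) (m : ℕ) (e : ℤˣ) :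
    ringExp K H m (fun y => errGiven p S (Fin.cons e y : Spins (m + 1))) ≤ 1 := by
  conv_rhs => rw [← ringExp_const K H m 1]
  exact ringExp_mono _ _ _ fun _ => errGiven_le_one hp hp1 _ _

lemma expSmall_errorProb (hG : IsRingCone G β K) (hK : 0 ≤ K) (hβ : 0 < β) (hp : 0 ≤ p)
    (hp1 : p < 1 / 2) {h S : ℝ} {e : ℤˣ} (he : sgn (-e) * h < 0)
    (hS : S ≠ slope (Real.exp (-4 * K)) (2 * β * sgn e + h)) :
    ExpSmall fun n => errorProb (G n) β h p S := by
  refine ExpSmall.of_succ (((expSmall_errGiven hK hp hp1 e hS).add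
    (expSmall_centreProb hK hβ he)).of_le
    (fun m => errorProb_nonneg _ _ _ hp (by linarith) _) ?_)
  filter_upwards [eventually_ge_atTop 3] with m hm
  rw [errorProb_succ hG hm h p S e]
  exact add_le_add (mul_le_of_le_one_left (ringExp_errGiven_nonneg hp (by linarith) ..)
    (centreProb_le_one ..)) (mul_le_of_le_one_right (centreProb_pos ..).le
    (ringExp_errGiven_le_one hp (by linarith) ..))

lemma tendsto_errorProb (hG : IsRingCone G β K) (hK : 0 ≤ K) (hβ : 0 < β) (hp : 0 < p)
    (hp1 : p < 1 / 2) {h : ℝ} {e : ℤˣ} (he : sgn (-e) * h < 0) :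
    Tendsto (fun n : ℕ => errorProb (G n) β h p
      (slope (Real.exp (-4 * K)) (2 * β * sgn e + h))) atTop
      (𝓝 (1 / Real.pi * arccot (Dconst p *
        √(curv (Real.exp (-4 * K)) (2 * β * sgn e + h))))) := by
  rw [← tendsto_add_atTop_iff_nat 1]
  have h1 := (tendsto_centreProb hK hβ he).mul
    (tendsto_ringExp_errGiven hK hp hp1 (2 * β * sgn e + h) e)
  rw [one_mul] at h1
  refine h1.congr_dist (squeeze_zero' (Eventually.of_forall fun m => dist_nonneg) ?_
    (expSmall_centreProb hK hβ he).tendsto)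
  filter_upwards [eventually_ge_atTop 3] with m hm
  rw [errorProb_succ hG hm h p _ e, dist_comm, Real.dist_eq, add_sub_cancel_left, abs_of_nonneg
    (mul_nonneg (centreProb_pos ..).le (ringExp_errGiven_nonneg hp.le (by linarith) ..))]
  exact mul_le_of_le_one_right (centreProb_pos ..).le
    (ringExp_errGiven_le_one hp.le (by linarith) ..)

lemma errorProb_zero_field (hG : IsRingCone G β K) {m : ℕ} (hm : 3 ≤ m) (p S : ℝ) (e : ℤˣ) :
    errorProb (G (m + 1)) β 0 p S =
      1 / 2 * ringExp K (sgn e * (2 * β)) m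
        (fun y => errGiven p S (Fin.cons e y : Spins (m + 1))) +
      1 / 2 * ringExp K (sgn (-e) * (2 * β)) m
        (fun y => errGiven p S (Fin.cons (-e) y : Spins (m + 1))) := by
  rw [errorProb_succ hG hm 0 p S e, centreProb_zero_field K β (by omega),
    centreProb_zero_field K β (by omega), add_zero, add_zero, mul_comm (2 * β), mul_comm (2 * β)]

lemma expSmall_errorProb_zero_field (hG : IsRingCone G β K) (hK : 0 ≤ K) (hp : 0 ≤ p)
    (hp1 : p < 1 / 2) {S : ℝ} (hS : S ≠ slope (Real.exp (-4 * K)) (2 * β))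
    (hS' : S ≠ -slope (Real.exp (-4 * K)) (2 * β)) :
    ExpSmall fun n => errorProb (G n) β 0 p S := by
  have hne : ∀ e : ℤˣ, S ≠ slope (Real.exp (-4 * K)) (sgn e * (2 * β)) := by
    intro e
    rw [slope_sgn_mul]
    rcases sgn_eq e with h | h
    · rwa [h, one_mul]
    · rwa [h, neg_one_mul]
  refine ExpSmall.of_succ ((((expSmall_errGiven hK hp hp1 1 (hne 1)).const_mul (1 / 2)).add
    ((expSmall_errGiven hK hp hp1 (-1) (hne (-1))).const_mul (1 / 2))).of_le
    (fun m => errorProb_nonneg _ _ _ hp (by linarith) _) ?_)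
  filter_upwards [eventually_ge_atTop 3] with m hm
  rw [errorProb_zero_field hG hm p S 1]

/-- Only the component with centre `e` is critical at this threshold. The other one has the opposite
nonzero mean, and its error is exponentially small. -/
lemma tendsto_errorProb_zero_field (hG : IsRingCone G β K) (hK : 0 ≤ K) (hp : 0 < p)
    (hp1 : p < 1 / 2) (hμ : slope (Real.exp (-4 * K)) (2 * β) ≠ 0) (e : ℤˣ) :
    Tendsto (fun n : ℕ => errorProb (G n) β 0 p
      (sgn e * slope (Real.exp (-4 * K)) (2 * β))) atTop
      (𝓝 (1 / (2 * Real.pi) * arccot (Dconst p * √(curv (Real.exp (-4 * K)) (2 * β))))) := by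
  rw [← tendsto_add_atTop_iff_nat 1]
  have hne : sgn e * slope (Real.exp (-4 * K)) (2 * β) ≠
      slope (Real.exp (-4 * K)) (sgn (-e) * (2 * β)) := by
    rw [slope_sgn_mul, sgn_neg]
    intro h
    have h0 : sgn e ≠ 0 := by rcases sgn_eq e with h | h <;> simp [h]
    exact (mul_ne_zero h0 hμ) (by linarith)
  have h1 := ((tendsto_ringExp_errGiven hK hp hp1 (sgn e * (2 * β)) e).const_mul (1 / 2)).add
    ((expSmall_errGiven hK hp.le hp1 (-e) hne).tendsto.const_mul (1 / 2))
  rw [mul_zero, add_zero, slope_sgn_mul, curv_sgn_mul] at h1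
  have hlim : 1 / 2 * (1 / Real.pi * arccot (Dconst p * √(curv (Real.exp (-4 * K)) (2 * β)))) =
      1 / (2 * Real.pi) * arccot (Dconst p * √(curv (Real.exp (-4 * K)) (2 * β))) := by
    field_simp
  rw [hlim] at h1
  refine h1.congr' ?_
  filter_upwards [eventually_ge_atTop 3] with m hm
  rw [errorProb_zero_field hG hm p _ e]

lemma arccot_pos (x : ℝ) : 0 < arccot x := by
  rw [arccot]
  linarith [Real.arctan_lt_pi_div_two x]

/-! ### Bimodality -/

/-- Without external field the global spin flip preserves the law. -/
lemma prob_neg {n : ℕ} (G : SimpleGraph (Fin n)) (β : ℝ) (P : ℝ → Prop) :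
    prob G β 0 {x | P (avg x)} = prob G β 0 {x | P (-avg x)} := by
  have hv : ∀ x : Spins n, toVec (-x) = -toVec x := fun x => by
    funext i
    simp [toVec]
  have ha : ∀ x : Spins n, avg (-x) = -avg x := fun x => by
    simp [avg, hv, neg_div]
  rw [prob, expect, ← Equiv.sum_comp (Equiv.neg (Spins n)), prob, expect]
  refine Finset.sum_congr rfl fun x _ => ?_
  have hw : prior G β 0 (-x) = prior G β 0 x := by
    simp [prior, weight, hv, Matrix.mulVec_neg]
  rw [Equiv.neg_apply, hw]
  congr 1
  have hmem : -x ∈ {x : Spins n | P (avg x)} ↔ x ∈ {x : Spins n | P (-avg x)} := by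
    rw [Set.mem_ofPred_eq, Set.mem_ofPred_eq, ha]
  by_cases hx : x ∈ {x : Spins n | P (-avg x)}
  · rw [Set.indicator_of_mem (hmem.2 hx), Set.indicator_of_mem hx]
    rfl
  · rw [Set.indicator_of_notMem (mt hmem.1 hx), Set.indicator_of_notMem hx]

/-- Only configurations with positive centre, of total probability exactly `1/2`, are kept. -/
lemma half_sub_le_prob (hG : IsRingCone G β K) {m : ℕ} (hm : 3 ≤ m) (b : ℝ) :
    1 / 2 - ringExp K (2 * β) m (fun y =>
      {x : Spins (m + 1) | |avg x - slope (Real.exp (-4 * K)) (2 * β)| ≤ b}ᶜ.indicator 1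
        (Fin.cons 1 y : Spins (m + 1))) ≤
    prob (G (m + 1)) β 0 {x | |avg x - slope (Real.exp (-4 * K)) (2 * β)| ≤ b} := by
  set E : Set (Spins (m + 1)) := {x | |avg x - slope (Real.exp (-4 * K)) (2 * β)| ≤ b}
  have h0 : ∀ (H : ℝ) (e : ℤˣ) (F : Set (Spins (m + 1))),
      0 ≤ ringExp K H m (fun y => F.indicator 1 (Fin.cons e y : Spins (m + 1))) := fun H e F =>
    ringExp_nonneg _ _ _ fun y => Set.indicator_nonneg (fun _ _ => zero_le_one) _
  have h1 : ringExp K (2 * β) m (fun y => E.indicator 1 (Fin.cons 1 y : Spins (m + 1))) +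
      ringExp K (2 * β) m (fun y => Eᶜ.indicator 1 (Fin.cons 1 y : Spins (m + 1))) = 1 := by
    rw [← ringExp_add, ← ringExp_const K (2 * β) m 1]
    congr 1
    funext y
    rw [← Set.indicator_self_add_compl E (1 : Spins (m + 1) → ℝ)]
    simp
  rw [prob, expect_eq hG hm, sum_spin, centreProb_zero_field K β (by omega),
    centreProb_zero_field K β (by omega), sgn_one, mul_one, add_zero]
  have h2 := h0 (2 * β * sgn (-1) + 0) (-1) E
  have h3 := h0 (2 * β) 1 Eᶜ
  linarith

lemma exists_bimodal_rate (hG : IsRingCone G β K) (hK : 0 ≤ K) {b : ℝ} (hb : 0 < b) :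
    ∃ α : ℝ, 0 < α ∧ ∀ n : ℕ, 1 / 2 - Real.exp (-(n * α)) ≤
      prob (G n) β 0 {x | |avg x - slope (Real.exp (-4 * K)) (2 * β)| ≤ b} := by
  have hsmall : ExpSmall fun n : ℕ => ringExp K (2 * β) (n - 1) (fun y =>
      {x : Spins (n - 1 + 1) | |avg x - slope (Real.exp (-4 * K)) (2 * β)| ≤ b}ᶜ.indicator 1
        (Fin.cons 1 y : Spins (n - 1 + 1))) :=
    ExpSmall.of_succ (expSmall_deviation hK hb 1)
  obtain ⟨a, ha, hle⟩ := hsmall.exists_le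
  obtain ⟨N, hN⟩ := eventually_atTop.1 hle
  have hprob : ∀ n : ℕ, 0 ≤ prob (G n) β 0
      {x | |avg x - slope (Real.exp (-4 * K)) (2 * β)| ≤ b} := fun n =>
    Finset.sum_nonneg fun x _ => mul_nonneg (div_nonneg (Real.exp_pos _).le
      (Finset.sum_nonneg fun x _ => (Real.exp_pos _).le))
      (Set.indicator_nonneg (fun _ _ => zero_le_one) _)
  -- For `n < N + 4` this rate makes `exp (-n α) ≥ 1/2`, so the bound is trivial. The `4` ensures `n
  -- ≥ 4`, where the ring description holds.
  refine ⟨min a (Real.log 2 / (N + 4)), lt_min ha (by positivity), fun n => ?_⟩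
  by_cases hn : N + 4 ≤ n
  · obtain ⟨m, rfl⟩ := Nat.exists_eq_add_of_le' (show 1 ≤ n by omega)
    have h1 : ringExp K (2 * β) m (fun y =>
        {x : Spins (m + 1) | |avg x - slope (Real.exp (-4 * K)) (2 * β)| ≤ b}ᶜ.indicator 1
          (Fin.cons 1 y : Spins (m + 1))) ≤ Real.exp (-((m + 1 : ℕ) * a)) := hN (m + 1) (by omega)
    have h2 := half_sub_le_prob hG (show 3 ≤ m by omega) b
    have h3 : Real.exp (-((m + 1 : ℕ) * a)) ≤
        Real.exp (-((m + 1 : ℕ) * min a (Real.log 2 / (N + 4)))) := by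
      rw [Real.exp_le_exp]
      exact neg_le_neg (mul_le_mul_of_nonneg_left (min_le_left _ _) (Nat.cast_nonneg _))
    linarith
  · refine le_trans ?_ (hprob n)
    have h1 : (n : ℝ) * min a (Real.log 2 / (N + 4)) ≤ Real.log 2 := by
      have h2 : (n : ℝ) ≤ N + 4 := by
        have : n ≤ N + 4 := by omega
        exact_mod_cast this
      calc (n : ℝ) * min a (Real.log 2 / (N + 4)) ≤ (N + 4) * (Real.log 2 / (N + 4)) :=
            mul_le_mul h2 (min_le_right _ _) (by positivity) (by positivity)
        _ = Real.log 2 := by field_simp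
    have h3 : Real.exp (-Real.log 2) ≤ Real.exp (-(n * min a (Real.log 2 / (N + 4)))) :=
      Real.exp_le_exp.2 (neg_le_neg h1)
    rw [Real.exp_neg, Real.exp_log two_pos] at h3
    linarith

/-! ### The limiting quantities -/

lemma freeEntropy_eq (hG : IsRingCone G β K) (hK : 0 ≤ K) (hβ : 0 < β) :
    freeEntropy G β = fun h => K + Real.log (eig (Real.exp (-4 * K)) (2 * β + |h|)) :=
  funext fun h => (tendsto_freeEntropyN hG hK hβ h).limUnder_eq

lemma exists_centre {h : ℝ} (hh : h ≠ 0) (β K : ℝ) : ∃ e : ℤˣ, sgn (-e) * h < 0 ∧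
    sgn e * h = |h| ∧ sgn e = Real.sign h ∧
    slope (Real.exp (-4 * K)) (2 * β * sgn e + h) =
      slope (Real.exp (-4 * K)) (2 * β + |h|) * Real.sign h ∧
    curv (Real.exp (-4 * K)) (2 * β * sgn e + h) = curv (Real.exp (-4 * K)) (2 * β + |h|) := by
  obtain ⟨e, he, hs⟩ := exists_spin_sign h
  refine ⟨e, centre_wrong_sign hh he, he, hs hh, ?_, ?_⟩
  · rw [field_eq he, slope_sgn_mul, hs hh, mul_comm]
  · rw [field_eq he, curv_sgn_mul]

lemma asympMean_eq (hG : IsRingCone G β K) (hK : 0 ≤ K) (hβ : 0 < β) {h : ℝ} (hh : h ≠ 0) :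
    Tendsto (fun n : ℕ => meanAvg (G n) β h) atTop (𝓝 (asympMean G β h)) ∧
    asympMean G β h = slope (Real.exp (-4 * K)) (2 * β + |h|) * Real.sign h := by
  obtain ⟨e, he, -, -, hs, -⟩ := exists_centre hh β K
  have h1 := tendsto_meanAvg hG hK hβ he
  rw [hs] at h1
  have h2 : asympMean G β h = _ := h1.limUnder_eq
  exact ⟨h2 ▸ h1, h2⟩

lemma asympVar_eq (hG : IsRingCone G β K) (hK : 0 ≤ K) (hβ : 0 < β) {h : ℝ} (hh : h ≠ 0) :
    Tendsto (fun n : ℕ => n * varAvg (G n) β h) atTop (𝓝 (asympVar G β h)) ∧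
    asympVar G β h = curv (Real.exp (-4 * K)) (2 * β + |h|) := by
  obtain ⟨e, he, -, -, -, hc⟩ := exists_centre hh β K
  have h1 := tendsto_varAvg hG hK hβ he
  rw [hc] at h1
  have h2 : asympVar G β h = _ := h1.limUnder_eq
  exact ⟨h2 ▸ h1, h2⟩

lemma modeVar_eq (hG : IsRingCone G β K) (hK : 0 ≤ K) :
    Tendsto (fun n : ℕ => n * condVarAvg (G n) β 0 (centrePos n)) atTop (𝓝 (modeVar G β)) ∧
    modeVar G β = curv (Real.exp (-4 * K)) (2 * β) := by
  have h1 := tendsto_condVarAvg hG hK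
  have h2 : modeVar G β = _ := h1.limUnder_eq
  exact ⟨h2 ▸ h1, h2⟩

lemma abs_eventuallyEq {h : ℝ} {e : ℤˣ} (hh : 0 < sgn e * h) :
    ∀ᶠ t in 𝓝 h, 0 < sgn e * t ∧ |t| = sgn e * t := by
  have hcont : ContinuousAt (fun t : ℝ => sgn e * t) h := by fun_prop
  filter_upwards [hcont.eventually (lt_mem_nhds hh)] with t ht
  refine ⟨ht, ?_⟩
  rw [← abs_of_pos ht, abs_mul]
  rcases sgn_eq e with h | h <;> simp [h]

/-- Away from `0` the modulus `|t|` agrees locally with `sgn e * t`, so the kink of the free entropy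
is not felt. -/
lemma hasDerivAt_freeEntropy (hG : IsRingCone G β K) (hK : 0 ≤ K) (hβ : 0 < β) {h : ℝ} {e : ℤˣ}
    (hh : 0 < sgn e * h) : HasDerivAt (freeEntropy G β)
      (slope (Real.exp (-4 * K)) (2 * β + sgn e * h) * sgn e) h := by
  rw [freeEntropy_eq hG hK hβ]
  have h1 : HasDerivAt (fun t : ℝ => 2 * β + sgn e * t) (sgn e) h := by
    simpa using ((hasDerivAt_id' h).const_mul (sgn e)).const_add (2 * β)
  have h2 := ((hasDerivAt_log_eig (Real.exp_pos (-4 * K)) (2 * β + sgn e * h)).comp h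
    h1).const_add K
  refine h2.congr_of_eventuallyEq ?_
  filter_upwards [abs_eventuallyEq hh] with t ht
  simp [ht.2]

lemma hasDerivAt_deriv_freeEntropy (hG : IsRingCone G β K) (hK : 0 ≤ K) (hβ : 0 < β) {h : ℝ}
    {e : ℤˣ} (hh : 0 < sgn e * h) : HasDerivAt (deriv (freeEntropy G β))
      (curv (Real.exp (-4 * K)) (2 * β + sgn e * h)) h := by
  have h1 : HasDerivAt (fun t : ℝ => 2 * β + sgn e * t) (sgn e) h := by
    simpa using ((hasDerivAt_id' h).const_mul (sgn e)).const_add (2 * β)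
  have h2 := ((hasDerivAt_slope (Real.exp_pos (-4 * K)) (2 * β + sgn e * h)).comp h h1).mul_const
    (sgn e)
  rw [mul_assoc, ← sq, sgn_sq, mul_one] at h2
  refine h2.congr_of_eventuallyEq ?_
  filter_upwards [abs_eventuallyEq hh] with t ht
  exact (hasDerivAt_freeEntropy hG hK hβ ht.1).deriv

lemma posMode_eq (hG : IsRingCone G β K) (hK : 0 ≤ K) (hβ : 0 < β) :
    HasDerivWithinAt (freeEntropy G β) (posMode G β) (Set.Ici 0) 0 ∧
    posMode G β = slope (Real.exp (-4 * K)) (2 * β) := by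
  have h1 : HasDerivAt (fun t : ℝ => 2 * β + t) 1 0 := (hasDerivAt_id' (0 : ℝ)).const_add (2 * β)
  have h2 := ((hasDerivAt_log_eig (Real.exp_pos (-4 * K)) (2 * β + 0)).comp 0 h1).const_add K
  rw [add_zero, mul_one] at h2
  have h3 : HasDerivWithinAt (freeEntropy G β) (slope (Real.exp (-4 * K)) (2 * β))
      (Set.Ici 0) 0 := by
    rw [freeEntropy_eq hG hK hβ]
    refine h2.hasDerivWithinAt.congr (fun t ht => ?_) (by simp)
    simp [abs_of_nonneg (Set.mem_Ici.1 ht)]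
  have h4 : posMode G β = slope (Real.exp (-4 * K)) (2 * β) :=
    h3.derivWithin (uniqueDiffOn_Ici 0 0 Set.self_mem_Ici)
  exact ⟨h4 ▸ h3, h4⟩

/-! ### Closed forms -/

/-- The star has `K = 0`, so `c = 1`: the smaller eigenvalue is zero. -/
lemma disc_one (H : ℝ) : disc 1 H = Real.cosh H := by
  rw [disc, ← Real.cosh_sq, Real.sqrt_sq (Real.cosh_pos H).le]

lemma slope_one (H : ℝ) : slope 1 H = Real.tanh H := by
  rw [slope, disc_one, Real.tanh_eq_sinh_div_cosh]

lemma curv_one (H : ℝ) : curv 1 H = 1 / Real.cosh H ^ 2 := by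
  have := Real.cosh_pos H
  rw [curv, disc_one]
  field_simp

lemma curv_eq_rpow {c : ℝ} (hc : 0 < c) (H : ℝ) :
    curv c H = c * Real.cosh H / (Real.sinh H ^ 2 + c) ^ (3 / 2 : ℝ) := by
  have hpos : 0 ≤ Real.sinh H ^ 2 + c := by positivity
  rw [curv, disc, Real.sqrt_eq_rpow, ← Real.rpow_natCast, ← Real.rpow_mul hpos]
  norm_num

end

end Sentiment

/-! ### Assembly for the star and the wheel. -/

theorem mainTheorem8
    (G : ∀ n : ℕ, SimpleGraph (Fin n)) (hG : G = Sentiment.star ∨ G = Sentiment.wheel)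
    (β : ℝ) (hβ : 0 < β) :
    -- existence of the limiting quantities and their relation to the free entropy density
    (∀ h : ℝ, Tendsto (fun n : ℕ => Sentiment.freeEntropyN (G n) β h) atTop
      (𝓝 (Sentiment.freeEntropy G β h))) ∧
    (∀ h : ℝ, h ≠ 0 →
      Tendsto (fun n : ℕ => Sentiment.meanAvg (G n) β h) atTop (𝓝 (Sentiment.asympMean G β h)) ∧
      HasDerivAt (Sentiment.freeEntropy G β) (Sentiment.asympMean G β h) h ∧
      Tendsto (fun n : ℕ => n * Sentiment.varAvg (G n) β h) atTop
        (𝓝 (Sentiment.asympVar G β h)) ∧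
      HasDerivAt (deriv (Sentiment.freeEntropy G β)) (Sentiment.asympVar G β h) h) ∧
    HasDerivWithinAt (Sentiment.freeEntropy G β) (Sentiment.posMode G β) (Set.Ici 0) 0 ∧
    Tendsto (fun n : ℕ => n * Sentiment.condVarAvg (G n) β 0 (Sentiment.centrePos n)) atTop
      (𝓝 (Sentiment.modeVar G β)) ∧
    -- their values; the coupling along each edge is `2β`
    (G = Sentiment.star →
      (∀ h : ℝ, Sentiment.freeEntropy G β h = Real.log (2 * Real.cosh (2 * β + |h|))) ∧
      (∀ h : ℝ, h ≠ 0 →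
        Sentiment.asympMean G β h = Real.tanh (2 * β + |h|) * Real.sign h ∧
        Sentiment.asympVar G β h = 1 / Real.cosh (2 * β + |h|) ^ 2) ∧
      Sentiment.posMode G β = Real.tanh (2 * β) ∧
      Sentiment.modeVar G β = 1 / Real.cosh (2 * β) ^ 2) ∧
    (G = Sentiment.wheel →
      (∀ h : ℝ, Sentiment.freeEntropy G β h = 2 * β + Real.log (Real.cosh (2 * β + |h|) +
        √(Real.sinh (2 * β + |h|) ^ 2 + Real.exp (-8 * β)))) ∧
      (∀ h : ℝ, h ≠ 0 →
        Sentiment.asympMean G β h = Real.sinh (2 * β + |h|) * Real.sign h /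
          √(Real.sinh (2 * β + |h|) ^ 2 + Real.exp (-8 * β)) ∧
        Sentiment.asympVar G β h = Real.exp (-8 * β) * Real.cosh (2 * β + |h|) /
          (Real.sinh (2 * β + |h|) ^ 2 + Real.exp (-8 * β)) ^ (3 / 2 : ℝ)) ∧
      Sentiment.posMode G β = Real.sinh (2 * β) /
        √(Real.sinh (2 * β) ^ 2 + Real.exp (-8 * β)) ∧
      Sentiment.modeVar G β = Real.exp (-8 * β) * Real.cosh (2 * β) /
        (Real.sinh (2 * β) ^ 2 + Real.exp (-8 * β)) ^ (3 / 2 : ℝ)) ∧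
    -- bimodality for `h = 0`
    0 < Sentiment.posMode G β ∧
    (∀ b : ℝ, 0 < b → ∃ α : ℝ, 0 < α ∧ ∀ n : ℕ,
      Sentiment.prob (G n) β 0 {x | |Sentiment.avg x - Sentiment.posMode G β| ≤ b} =
        Sentiment.prob (G n) β 0 {x | |Sentiment.avg x + Sentiment.posMode G β| ≤ b} ∧
      1 / 2 - Real.exp (-(n * α)) ≤
        Sentiment.prob (G n) β 0 {x | |Sentiment.avg x - Sentiment.posMode G β| ≤ b}) ∧
    -- the detection error probability
    ∀ p : ℝ, 0 ≤ p → p < 1 / 2 → ∀ S : ℝ, -1 < S → S < 1 →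
      (∀ h : ℝ, h ≠ 0 →
        (S ≠ Sentiment.asympMean G β h →
          Tendsto (fun n : ℕ => Sentiment.errorProb (G n) β h p S) atTop (𝓝 0) ∧
          Sentiment.errorRate G β h p S < 0) ∧
        (S = Sentiment.asympMean G β h → 0 < p →
          Tendsto (fun n : ℕ => Sentiment.errorProb (G n) β h p S) atTop
            (𝓝 (1 / Real.pi *
              Sentiment.arccot (Sentiment.Dconst p * √(Sentiment.asympVar G β h)))) ∧
          0 < 1 / Real.pi *
            Sentiment.arccot (Sentiment.Dconst p * √(Sentiment.asympVar G β h)))) ∧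
      ((S ≠ Sentiment.posMode G β ∧ S ≠ -Sentiment.posMode G β →
          Tendsto (fun n : ℕ => Sentiment.errorProb (G n) β 0 p S) atTop (𝓝 0) ∧
          Sentiment.errorRate G β 0 p S < 0) ∧
        (S = Sentiment.posMode G β ∨ S = -Sentiment.posMode G β → 0 < p →
          Tendsto (fun n : ℕ => Sentiment.errorProb (G n) β 0 p S) atTop
            (𝓝 (1 / (2 * Real.pi) *
              Sentiment.arccot (Sentiment.Dconst p * √(Sentiment.modeVar G β)))) ∧
          0 < 1 / (2 * Real.pi) *
            Sentiment.arccot (Sentiment.Dconst p * √(Sentiment.modeVar G β)))) := by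
  obtain ⟨K, hK, hcone⟩ : ∃ K : ℝ, 0 ≤ K ∧ Sentiment.IsRingCone G β K := by
    rcases hG with rfl | rfl
    · exact ⟨0, le_rfl, Sentiment.isRingCone_star β⟩
    · exact ⟨2 * β, by positivity, Sentiment.isRingCone_wheel β⟩
  have hJ : 0 < 2 * β := by positivity
  have hslope : 0 < Sentiment.slope (Real.exp (-4 * K)) (2 * β) :=
    div_pos (Real.sinh_pos_iff.2 hJ) (Sentiment.disc_pos (Real.exp_pos _) _)
  have hpi := Real.pi_pos
  have hmode := Sentiment.posMode_eq hcone hK hβ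
  have hmvar := Sentiment.modeVar_eq hcone hK
  refine ⟨fun h => ?_, fun h hh => ?_, hmode.1, hmvar.1, ?_, ?_, ?_, fun b hb => ?_,
    fun p hp hp1 S _ _ => ⟨fun h hh => ⟨fun hS => ?_, fun hS hp0 => ?_⟩,
      fun hS => ?_, fun hS hp0 => ?_⟩⟩
  · have h1 := Sentiment.tendsto_freeEntropyN hcone hK hβ h
    rwa [Sentiment.freeEntropy_eq hcone hK hβ]
  · obtain ⟨e, he, habs, hsign, -, -⟩ := Sentiment.exists_centre hh β K
    have hpos : 0 < Sentiment.sgn e * h := by rw [habs]; exact abs_pos.2 hh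
    have hm := Sentiment.asympMean_eq hcone hK hβ hh
    have hv := Sentiment.asympVar_eq hcone hK hβ hh
    refine ⟨hm.1, ?_, hv.1, ?_⟩
    · rw [hm.2, ← habs, ← hsign]
      exact Sentiment.hasDerivAt_freeEntropy hcone hK hβ hpos
    · rw [hv.2, ← habs]
      exact Sentiment.hasDerivAt_deriv_freeEntropy hcone hK hβ hpos
  · rintro rfl
    have hc := Sentiment.isRingCone_star β
    have h0 : Real.exp (-4 * 0) = 1 := by simp
    refine ⟨fun h => ?_, fun h hh => ⟨?_, ?_⟩, ?_, ?_⟩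
    · rw [Sentiment.freeEntropy_eq hc le_rfl hβ]
      beta_reduce
      rw [h0, Sentiment.eig, Sentiment.disc_one, zero_add,
        two_mul (Real.cosh _)]
    · rw [(Sentiment.asympMean_eq hc le_rfl hβ hh).2, h0, Sentiment.slope_one]
    · rw [(Sentiment.asympVar_eq hc le_rfl hβ hh).2, h0, Sentiment.curv_one]
    · rw [(Sentiment.posMode_eq hc le_rfl hβ).2, h0, Sentiment.slope_one]
    · rw [(Sentiment.modeVar_eq hc le_rfl).2, h0, Sentiment.curv_one]
  · rintro rfl
    have hc := Sentiment.isRingCone_wheel β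
    -- With `J = 2β` this is the constant `e ^ (-4J)`.
    have h0 : Real.exp (-4 * (2 * β)) = Real.exp (-8 * β) := by congr 1; ring
    refine ⟨fun h => ?_, fun h hh => ⟨?_, ?_⟩, ?_, ?_⟩
    · rw [Sentiment.freeEntropy_eq hc hJ.le hβ]
      beta_reduce
      rw [h0, Sentiment.eig, Sentiment.disc]
    · rw [(Sentiment.asympMean_eq hc hJ.le hβ hh).2, h0, Sentiment.slope, Sentiment.disc,
        div_mul_eq_mul_div]
    · rw [(Sentiment.asympVar_eq hc hJ.le hβ hh).2, h0,
        Sentiment.curv_eq_rpow (Real.exp_pos _)]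
    · rw [(Sentiment.posMode_eq hc hJ.le hβ).2, h0, Sentiment.slope, Sentiment.disc]
    · rw [(Sentiment.modeVar_eq hc hJ.le).2, h0, Sentiment.curv_eq_rpow (Real.exp_pos _)]
  · rw [hmode.2]
    exact hslope
  · obtain ⟨α, hα, hrate⟩ := Sentiment.exists_bimodal_rate hcone hK hb
    refine ⟨α, hα, fun n => ⟨?_, ?_⟩⟩
    · rw [Sentiment.prob_neg (G n) β (fun t => |t - Sentiment.posMode G β| ≤ b)]
      congr 1
      ext x
      simp only [Set.mem_ofPred_eq]
      rw [← abs_neg, neg_sub, sub_neg_eq_add, add_comm]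
    · rw [hmode.2]
      exact hrate n
  · obtain ⟨e, he, -, -, hs, -⟩ := Sentiment.exists_centre hh β K
    rw [(Sentiment.asympMean_eq hcone hK hβ hh).2, ← hs] at hS
    have h1 := Sentiment.expSmall_errorProb hcone hK hβ hp hp1 he hS
    exact ⟨h1.tendsto, h1.limsup_log_div_neg⟩
  · obtain ⟨e, he, -, -, hs, hc⟩ := Sentiment.exists_centre hh β K
    refine ⟨?_, mul_pos (by positivity) (Sentiment.arccot_pos _)⟩
    rw [hS, (Sentiment.asympMean_eq hcone hK hβ hh).2, (Sentiment.asympVar_eq hcone hK hβ hh).2,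
      ← hs, ← hc]
    exact Sentiment.tendsto_errorProb hcone hK hβ hp0 hp1 he
  · rw [hmode.2] at hS
    have h1 := Sentiment.expSmall_errorProb_zero_field hcone hK hp hp1 hS.1 hS.2
    exact ⟨h1.tendsto, h1.limsup_log_div_neg⟩
  · refine ⟨?_, mul_pos (by positivity) (Sentiment.arccot_pos _)⟩
    rw [hmode.2] at hS
    rw [hmvar.2]
    rcases hS with rfl | rfl
    · simpa using Sentiment.tendsto_errorProb_zero_field hcone hK hp0 hp1 hslope.ne' 1
    · simpa using Sentiment.tendsto_errorProb_zero_field hcone hK hp0 hp1 hslope.ne' (-1)
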